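/- Let $\{T(x,t)\}_{(x,t)\in\mathbb S^2\times\mathbb Z}$ be a real-valued, zero-mean, isotropic stationary random field on a probability space, i.e. $T(\cdot,t)$ is jointly measurable in $(x,\omega)$ for each $t$, $\mathbb E|T(x,t)|^2<\infty$, and $\mathbb E[T(x,t)T(y,s)]=\mathbb E[T(gx,t+h)T(gy,s+h)]$ for all $x,y\in\mathbb S^2$, $g\in SO(3)$, $t,s,h\in\mathbb Z$. Let $r_t(x,y)=\mathbb E[T(x,t)T(y,0)]$ be its autocovariance kernels, assumed continuous on $\mathbb S^2\times\mathbb S^2$, and let $\mathscr R_t$ be the autocovariance operators on $L^2(\mathbb S^2;\mathbb C)$, $(\mathscr R_t h)(x)=\int_{\mathbb S^2} r_t(x,y)h(y)\,dy$. Let $Y_{\ell,m}$ ($\ell\ge 0$, $|m|\le\ell$) be the standard orthonormal spherical harmonics, $a_{\ell,m}(t)=\int_{\mathbb S^2}T(x,t)\overline{Y_{\ell,m}(x)}\,dx$, $C_\ell(t)=\mathbb E[a_{\ell,m}(t)\overline{a_{\ell,m}(0)}]$ (which does not depend on $m$), and $f_\ell(\lambda)=\frac1{2\pi}\sum_{t\in\mathbb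 Z}e^{-it\lambda}C_\ell(t)$. (i) Suppose $\sum_{t\in\mathbb Z}\|r_t\|_{L^2(\mathbb S^2\times\mathbb S^2)}<\infty$, and let $f_\lambda=\frac1{2\pi}\sum_{t}e^{-i\lambda t}r_t$ (convergence in $L^2(\mathbb S^2\times\mathbb S^2;\mathbb C)$) be the spectral density kernels. Then for every $\epsilon>0$ there exist $L,q\ge 0$ and, on some probability space, an isotropic stationary, invertible $\operatorname{SPHMA}(q)$ process, band-limited at $L$, $$T_L(x,t)=Z_L(x,t)+\sum_{j=1}^q(\Theta_jZ_L(\cdot,t-j))(x),$$ whose spectral density kernels $\tilde f_\lambda$ satisfy $\|\tilde f_\lambda-f_\lambda\|_{L^2(\mathbb S^2\times\mathbb S^2)}\le\epsilon$ for all $\lambda\in[-\pi,\pi]$. Here the equality holds in $L^2(\Omega)$ for every $(x,t)$ and in $L^2(\mathbb S^2\times\Omega)$ for every $t$; each $\Theta_j$ is an isotropic kernel operator $(\Theta_jf)(x)=\int_{\mathbb S^2}k_j(\langle x,y\rangle)f(y)\,dy$ with $k_j:[-1,1]\to\mathbb R$ continuous, and $\Theta_jY_{\ell,m}=\vartheta_{\ell;j}Y_{\ell,m}$;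 invertible means that $1+\sum_{j=1}^q\vartheta_{\ell;j}z^j\neq0$ for all $\ell\ge0$ and all complex $|z|\le1$; band-limited at $L$ means that $T_L$ and $Z_L$ are expanded in the $Y_{\ell,m}$ with $\ell\le L$ only; and $Z_L$ is a spherical white noise with angular power spectrum $$\sigma_\ell^2=(1+\vartheta_{\ell;1}^2+\dots+\vartheta_{\ell;q}^2)^{-1}\int_{-\pi}^{\pi}f_\ell(\lambda)\,d\lambda\quad(0\le\ell\le L),\qquad\sigma_\ell^2=0\quad(\ell>L),$$ that is, a zero-mean, jointly measurable field with $\mathbb E[Z_L(x,t)Z_L(y,t)]=\sum_{\ell}\frac{2\ell+1}{4\pi}\sigma_\ell^2P_\ell(\langle x,y\rangle)$ for all $t$ ($P_\ell$ the Legendre polynomials) whose harmonic coefficients at distinct times are uncorrelated. (ii) Suppose instead $\sum_{t\in\mathbb Z}\|\mathscr R_t\|_{\mathrm{TR}}<\infty$ (trace norm), and let $\mathscr F_\lambda=\frac1{2\pi}\sum_te^{-i\lambda t}\mathscr R_t$ be the spectral density operators. Then for every $\epsilon>0$ there exists a process $T_L$ with all the properties in (i), including the formula for $\sigma_\ell^2$,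 except that the kernel bound is replaced by $\|\tilde{\mathscr F}_\lambda-\mathscr F_\lambda\|_{\mathrm{TR}}\le\epsilon$ for all $\lambda\in[-\pi,\pi]$, where $\tilde{\mathscr F}_\lambda$ are the spectral density operators of $T_L$. -/

import Mathlib

open MeasureTheory Filter Topology
open scoped ENNReal ComplexConjugate

noncomputable section

namespace SphereTime

/-! ### The sphere, Legendre polynomials and spherical harmonics -/

/-- Euclidean three-space. -/
abbrev E3 : Type := EuclideanSpace ℝ (Fin 3)

/-- The unit sphere of Euclidean three-space. -/
abbrev S2 : Type := Metric.sphere (0 : E3) 1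

/-- The surface measure of the unit sphere (total mass `4π`). -/
abbrev surf : Measure S2 := (volume : Measure E3).toSphere

/-- The complex Hilbert space of square-integrable functions on the sphere. -/
abbrev L2S : Type := Lp ℂ 2 surf

/-- The complex Hilbert space of square-integrable kernels on the sphere. -/
abbrev L2SS : Type := Lp ℂ 2 (surf.prod surf)

/-- The standard inner product of two points of the sphere. -/
def dot (x y : S2) : ℝ := inner ℝ (x : E3) (y : E3)

/-- The image of a point of the sphere under a linear isometry. -/
def rotate (g : E3 ≃ₗᵢ[ℝ] E3) (x : S2) : S2 :=
  ⟨g x, by simp⟩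

/-- A rotation, that is, an element of `SO(3)`: a linear isometry of determinant one. -/
def IsRotation (g : E3 ≃ₗᵢ[ℝ] E3) : Prop :=
  LinearMap.det (g.toLinearEquiv : E3 →ₗ[ℝ] E3) = 1

/-- The Legendre polynomial of degree `l` (Rodrigues' formula), normalised by `P_l(1) = 1`. -/
def legendre (l : ℕ) : Polynomial ℝ :=
  Polynomial.C (1 / (2 ^ l * (l.factorial : ℝ))) *
    Polynomial.derivative^[l] ((Polynomial.X ^ 2 - 1) ^ l)

/-- The spherical harmonic `Y_{l,m}` for `m ≥ 0`. In polar coordinates the factor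
`(x₀ + i x₁) ^ m` is `(sin θ) ^ m e ^ (i m φ)`, and
`(-1) ^ m (sin θ) ^ m P_l^{(m)}(cos θ)` is the associated Legendre function. -/
def sphHarmonicNat (l m : ℕ) (x : S2) : ℂ :=
  (-1) ^ m *
    ((Real.sqrt ((2 * l + 1) / (4 * Real.pi) *
      (((l - m).factorial : ℝ) / ((l + m).factorial : ℝ))) : ℝ) : ℂ) *
    (((x : E3) 0 : ℂ) + Complex.I * ((x : E3) 1 : ℂ)) ^ m *
    (((Polynomial.derivative^[m] (legendre l)).eval ((x : E3) 2) : ℝ) : ℂ)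

/-- The standard orthonormal spherical harmonics `Y_{l,m}`, `-l ≤ m ≤ l`, with
`Y_{l,-m} = (-1) ^ m conj Y_{l,m}` (the function is zero for `|m| > l`). -/
def sphHarmonic (l : ℕ) (m : ℤ) (x : S2) : ℂ :=
  if 0 ≤ m then sphHarmonicNat l m.natAbs x
  else (-1) ^ m.natAbs * conj (sphHarmonicNat l m.natAbs x)

/-! ### Isotropic kernel operators, integral operators, trace norm -/

/-- The isotropic kernel operator `(Φ f)(x) = ∫ k(⟨x, y⟩) f(y) dy`. -/
def isotropicOp {E : Type*} [NormedAddCommGroup E] [NormedSpace ℝ E]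
    (k : ℝ → ℝ) (f : S2 → E) (x : S2) : E :=
  ∫ y, k (dot x y) • f y ∂surf

section IntegralOperator

theorem ae_memLp_section {K : S2 × S2 → ℂ} (hK : MemLp K 2 (surf.prod surf)) :
    ∀ᵐ x ∂surf, MemLp (fun y => K (x, y)) 2 surf := by
  have h1 : ∀ᵐ x ∂surf, AEStronglyMeasurable (fun y => K (x, y)) surf :=
    hK.1.prodMk_left
  have h2 : Integrable (fun p => ‖K p‖ ^ 2) (surf.prod surf) :=
    (memLp_two_iff_integrable_sq_norm hK.1).1 hK
  filter_upwards [h1, h2.prod_right_ae] with x hx1 hx2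
  exact (memLp_two_iff_integrable_sq_norm hx1).2 hx2

theorem ae_integrable_section {K : S2 × S2 → ℂ} (hK : MemLp K 2 (surf.prod surf))
    {h : S2 → ℂ} (hh : MemLp h 2 surf) :
    ∀ᵐ x ∂surf, Integrable (fun y => K (x, y) * h y) surf := by
  filter_upwards [ae_memLp_section hK] with x hx
  exact hx.integrable_mul hh

theorem eLpNorm_integralOp_le {K : S2 × S2 → ℂ} (hK : MemLp K 2 (surf.prod surf))
    {h : S2 → ℂ} (hh : MemLp h 2 surf) :
    eLpNorm (fun x => ∫ y, K (x, y) * h y ∂surf) 2 surf ≤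
      eLpNorm K 2 (surf.prod surf) * eLpNorm h 2 surf := by
  have e2 : ∀ {α : Type} [MeasurableSpace α] (μ : Measure α) (f : α → ℂ),
      eLpNorm f 2 μ ^ 2 = ∫⁻ a, ‖f a‖ₑ ^ 2 ∂μ := by
    intro α _ μ f
    rw [eLpNorm_eq_lintegral_rpow_enorm_toReal (by norm_num) (by norm_num)]
    simp only [ENNReal.toReal_ofNat, ENNReal.rpow_ofNat]
    rw [← ENNReal.rpow_natCast, ← ENNReal.rpow_mul]
    norm_num
  have key : ∀ᵐ x ∂surf, ‖∫ y, K (x, y) * h y ∂surf‖ₑ ^ 2 ≤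
      (∫⁻ y, ‖K (x, y)‖ₑ ^ 2 ∂surf) * eLpNorm h 2 surf ^ 2 := by
    filter_upwards [ae_memLp_section hK] with x hx
    rw [← e2 surf (fun y => K (x, y)), ← mul_pow]
    gcongr
    calc ‖∫ y, K (x, y) * h y ∂surf‖ₑ ≤ ∫⁻ y, ‖K (x, y) * h y‖ₑ ∂surf :=
          enorm_integral_le_lintegral_enorm _
      _ = eLpNorm ((fun y => K (x, y)) • h) 1 surf := by
          rw [eLpNorm_one_eq_lintegral_enorm]; rfl
      _ ≤ eLpNorm (fun y => K (x, y)) 2 surf * eLpNorm h 2 surf :=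
          eLpNorm_smul_le_mul_eLpNorm hh.1 hx.1
  have hsq : eLpNorm (fun x => ∫ y, K (x, y) * h y ∂surf) 2 surf ^ 2 ≤
      (eLpNorm K 2 (surf.prod surf) * eLpNorm h 2 surf) ^ 2 := by
    rw [e2, mul_pow, e2 (surf.prod surf) K]
    refine (lintegral_mono_ae key).trans ?_
    have hm : AEMeasurable (fun p => ‖K p‖ₑ ^ 2) (surf.prod surf) :=
      hK.1.enorm.pow_const 2
    rw [lintegral_mul_const'' _ hm.lintegral_prod_right', lintegral_prod _ hm]
  exact (ENNReal.pow_le_pow_left_iff two_ne_zero).1 hsq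

theorem memLp_integralOp {K : S2 × S2 → ℂ} (hK : MemLp K 2 (surf.prod surf))
    {h : S2 → ℂ} (hh : MemLp h 2 surf) :
    MemLp (fun x => ∫ y, K (x, y) * h y ∂surf) 2 surf := by
  refine ⟨?_, (eLpNorm_integralOp_le hK hh).trans_lt (ENNReal.mul_lt_top hK.2 hh.2)⟩
  have h2 : AEStronglyMeasurable (fun p : S2 × S2 => h p.2) (surf.prod surf) :=
    hh.1.comp_snd
  exact (hK.1.mul h2).integral_prod_right'

/-- The operator on `L²(S²; ℂ)` induced by a kernel in `L²(S² × S²; ℂ)` through right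
integration, `(A h)(x) = ∫ K(x, y) h(y) dy`. -/
def kernelOp (K : L2SS) : L2S →L[ℂ] L2S :=
  LinearMap.mkContinuous
    { toFun := fun h => (memLp_integralOp (Lp.memLp K) (Lp.memLp h)).toLp _
      map_add' := fun h₁ h₂ => by
        rw [← MemLp.toLp_add, MemLp.toLp_eq_toLp_iff]
        filter_upwards [ae_integrable_section (Lp.memLp K) (Lp.memLp h₁),
          ae_integrable_section (Lp.memLp K) (Lp.memLp h₂)] with x hx1 hx2
        simp only [Pi.add_apply]
        rw [← integral_add hx1 hx2]
        refine integral_congr_ae ?_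
        filter_upwards [Lp.coeFn_add h₁ h₂] with y hy
        rw [hy, Pi.add_apply, mul_add]
      map_smul' := fun c h => by
        rw [RingHom.id_apply, ← MemLp.toLp_const_smul, MemLp.toLp_eq_toLp_iff]
        refine Eventually.of_forall fun x => ?_
        simp only [Pi.smul_apply]
        rw [← integral_smul]
        refine integral_congr_ae ?_
        filter_upwards [Lp.coeFn_smul c h] with y hy
        rw [hy, Pi.smul_apply, smul_eq_mul, smul_eq_mul, mul_left_comm] }
    ‖K‖ (fun h => by
      have := eLpNorm_integralOp_le (Lp.memLp K) (Lp.memLp h)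
      simp only [LinearMap.coe_mk, AddHom.coe_mk, Lp.norm_toLp]
      rw [Lp.norm_def, Lp.norm_def, ← ENNReal.toReal_mul]
      exact ENNReal.toReal_mono
        (ENNReal.mul_lt_top (Lp.memLp K).2 (Lp.memLp h).2).ne this)

end IntegralOperator

/-- The trace norm `tr |A| = ∑ ⟨|A| e_i, e_i⟩` of a bounded operator, with `|A| = (A* A)^{1/2}`
and `e` a Hilbert basis, as an element of `[0, ∞]`. The value does not depend on the Hilbert
basis, see `traceNorm_eq`. -/
def traceNorm {H : Type*} [NormedAddCommGroup H] [InnerProductSpace ℂ H] [CompleteSpace H]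
    (A : H →L[ℂ] H) : ℝ≥0∞ :=
  ∑' i, ENNReal.ofReal
    (inner ℂ ((exists_hilbertBasis ℂ H).choose_spec.choose i)
      (CFC.abs A ((exists_hilbertBasis ℂ H).choose_spec.choose i))).re

theorem ofReal_norm_sq_eq_tsum {H : Type*} [NormedAddCommGroup H] [InnerProductSpace ℂ H]
    {ι : Type*} (b : HilbertBasis ι ℂ H) (x : H) :
    ENNReal.ofReal (‖x‖ ^ 2) = ∑' j, ENNReal.ofReal (‖inner ℂ (b j) x‖ ^ 2) := by
  have h3 : HasSum (fun j => ‖inner ℂ (b j) x‖ ^ 2) (‖x‖ ^ 2) := by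
    have h4 := Complex.hasSum_re (b.hasSum_inner_mul_inner x x)
    have h6 : (inner ℂ x x : ℂ).re = ‖x‖ ^ 2 := inner_self_eq_norm_sq (𝕜 := ℂ) x
    rw [h6] at h4
    convert h4 using 2 with j
    have h5 := inner_mul_symm_re_eq_norm (𝕜 := ℂ) x (b j)
    rw [norm_mul, norm_inner_symm x (b j), ← sq] at h5
    exact h5.symm
  rw [← h3.tsum_eq, ENNReal.ofReal_tsum_of_nonneg (fun _ => sq_nonneg _) h3.summable]

theorem tsum_ofReal_inner_eq {H : Type*} [NormedAddCommGroup H] [InnerProductSpace ℂ H]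
    [CompleteSpace H] {A : H →L[ℂ] H} (hA : 0 ≤ A) {ι κ : Type*}
    (e : HilbertBasis ι ℂ H) (f : HilbertBasis κ ℂ H) :
    ∑' i, ENNReal.ofReal (inner ℂ (e i) (A (e i))).re =
      ∑' j, ENNReal.ofReal (inner ℂ (f j) (A (f j))).re := by
  set B := CFC.sqrt A with hB
  have hBB : B * B = A := CFC.sqrt_mul_sqrt_self A hA
  have hs : ∀ x y : H, inner ℂ (B x) y = inner ℂ x (B y) := by
    have h0 : IsSelfAdjoint B := (CFC.sqrt_nonneg A).isSelfAdjoint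
    exact fun x y => (ContinuousLinearMap.isSelfAdjoint_iff_isSymmetric.1 h0) x y
  have h1 : ∀ x : H, (inner ℂ x (A x)).re = ‖B x‖ ^ 2 := by
    intro x
    rw [← inner_self_eq_norm_sq (𝕜 := ℂ), hs x (B x), ← hBB]
    rfl
  simp only [h1]
  calc ∑' i, ENNReal.ofReal (‖B (e i)‖ ^ 2)
      = ∑' i, ∑' j, ENNReal.ofReal (‖inner ℂ (f j) (B (e i))‖ ^ 2) := by
        simp only [ofReal_norm_sq_eq_tsum f]
    _ = ∑' j, ∑' i, ENNReal.ofReal (‖inner ℂ (f j) (B (e i))‖ ^ 2) := ENNReal.tsum_comm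
    _ = ∑' j, ∑' i, ENNReal.ofReal (‖inner ℂ (e i) (B (f j))‖ ^ 2) := by
        refine tsum_congr fun j => tsum_congr fun i => ?_
        rw [← hs, norm_inner_symm]
    _ = ∑' j, ENNReal.ofReal (‖B (f j)‖ ^ 2) := by
        simp only [ofReal_norm_sq_eq_tsum e]

theorem traceNorm_eq {H : Type*} [NormedAddCommGroup H] [InnerProductSpace ℂ H]
    [CompleteSpace H] (A : H →L[ℂ] H) {ι : Type*} (e : HilbertBasis ι ℂ H) :
    traceNorm A = ∑' i, ENNReal.ofReal (inner ℂ (e i) (CFC.abs A (e i))).re :=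
  tsum_ofReal_inner_eq (CFC.abs_nonneg A) _ e

/-! ### Space-time spherical random fields and their second-order characteristics -/

section Fields

variable {Ω : Type*} [MeasurableSpace Ω]

/-- A real-valued, zero-mean space-time spherical random field with finite second moments:
at each time it is jointly measurable in space and chance. -/
structure IsField (P : Measure Ω) (T : S2 → ℤ → Ω → ℝ) : Prop where
  measurable : ∀ t, Measurable (fun p : S2 × Ω => T p.1 t p.2)
  memLp : ∀ x t, MemLp (T x t) 2 P
  mean_zero : ∀ x t, ∫ ω, T x t ω ∂P = 0

/-- The field is isotropic in space and stationary in time (in the second-order sense). -/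
structure IsIsotropicStationary (P : Measure Ω) (T : S2 → ℤ → Ω → ℝ) : Prop
    extends IsField P T where
  cov_invariant : ∀ (x y : S2) (g : E3 ≃ₗᵢ[ℝ] E3), IsRotation g → ∀ t s h : ℤ,
    ∫ ω, T x t ω * T y s ω ∂P =
      ∫ ω, T (rotate g x) (t + h) ω * T (rotate g y) (s + h) ω ∂P

/-- The autocovariance kernel `r_t(x, y) = E[T(x, t) T(y, 0)]`. -/
def autocovKernel (P : Measure Ω) (T : S2 → ℤ → Ω → ℝ) (t : ℤ) (x y : S2) : ℝ :=
  ∫ ω, T x t ω * T y 0 ω ∂P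

open Classical in
/-- The autocovariance kernel as an element of `L²(S² × S²; ℂ)` (it is always square-integrable
for an isotropic stationary field; the default value is `0`). -/
def autocovL2 (P : Measure Ω) (T : S2 → ℤ → Ω → ℝ) (t : ℤ) : L2SS :=
  if h : MemLp (fun p : S2 × S2 => ((autocovKernel P T t p.1 p.2 : ℝ) : ℂ)) 2 (surf.prod surf)
  then h.toLp _ else 0

/-- The autocovariance operator at lag `t`, induced by `r_t` through right integration. -/
def autocovOp (P : Measure Ω) (T : S2 → ℤ → Ω → ℝ) (t : ℤ) : L2S →L[ℂ] L2S :=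
  kernelOp (autocovL2 P T t)

/-- All autocovariance kernels are continuous on `S² × S²`. -/
def ContinuousKernels (P : Measure Ω) (T : S2 → ℤ → Ω → ℝ) : Prop :=
  ∀ t, Continuous (fun p : S2 × S2 => autocovKernel P T t p.1 p.2)

/-- Short memory in the `L²` sense: continuous kernels and `∑_t ‖r_t‖₂ < ∞`. -/
def SummableL2 (P : Measure Ω) (T : S2 → ℤ → Ω → ℝ) : Prop :=
  ContinuousKernels P T ∧ Summable (fun t => ‖autocovL2 P T t‖)

/-- Short memory in trace norm: continuous kernels and `∑_t ‖R_t‖_TR < ∞`. -/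
def SummableTrace (P : Measure Ω) (T : S2 → ℤ → Ω → ℝ) : Prop :=
  ContinuousKernels P T ∧ ∑' t, traceNorm (autocovOp P T t) < ∞

/-- The spectral density kernel `f_lam = (2π)⁻¹ ∑_t e^{-i lam t} r_t`, the sum being taken
in `L²(S² × S²; ℂ)`. -/
def spectralKernel (P : Measure Ω) (T : S2 → ℤ → Ω → ℝ) (lam : ℝ) : L2SS :=
  (1 / (2 * Real.pi) : ℂ) • ∑' t : ℤ, Complex.exp (-Complex.I * lam * t) • autocovL2 P T t

/-- The spectral density operator `F_lam = (2π)⁻¹ ∑_t e^{-i lam t} R_t`. The sum is written in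
the operator norm; it is the trace-norm sum whenever `∑_t ‖R_t‖_TR < ∞`, since the operator norm
is bounded by the trace norm. -/
def spectralOp (P : Measure Ω) (T : S2 → ℤ → Ω → ℝ) (lam : ℝ) : L2S →L[ℂ] L2S :=
  (1 / (2 * Real.pi) : ℂ) • ∑' t : ℤ, Complex.exp (-Complex.I * lam * t) • autocovOp P T t

/-- The random harmonic coefficient `a_{l,m}(t) = ∫ T(x, t) conj Y_{l,m}(x) dx`. -/
def coeff (T : S2 → ℤ → Ω → ℝ) (l : ℕ) (m : ℤ) (t : ℤ) (ω : Ω) : ℂ :=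
  ∫ x, (T x t ω : ℂ) * conj (sphHarmonic l m x) ∂surf

/-- The angular autocovariance `C_l(t) = E[a_{l,m}(t) conj a_{l,m}(0)]`. For an isotropic
stationary field with continuous kernels this does not depend on `m`; we take `m = 0`. -/
def angularAutocov (P : Measure Ω) (T : S2 → ℤ → Ω → ℝ) (l : ℕ) (t : ℤ) : ℂ :=
  ∫ ω, coeff T l 0 t ω * conj (coeff T l 0 0 ω) ∂P

/-- The eigenvalue `f_l(lam) = (2π)⁻¹ ∑_t e^{-i lam t} C_l(t)` of the spectral density operator
on the spherical harmonics of degree `l`. -/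
def spectralEigenvalue (P : Measure Ω) (T : S2 → ℤ → Ω → ℝ) (l : ℕ) (lam : ℝ) : ℂ :=
  (1 / (2 * Real.pi) : ℂ) *
    ∑' t : ℤ, Complex.exp (-Complex.I * lam * t) * angularAutocov P T l t

/-- The field is band-limited at `L`: it is expanded in the spherical harmonics up to the
multipole `L`. -/
def BandLimited (P : Measure Ω) (L : ℕ) (T : S2 → ℤ → Ω → ℝ) : Prop :=
  ∀ x t, (fun ω => (T x t ω : ℂ)) =ᵐ[P] fun ω =>
    ∑ l ∈ Finset.range (L + 1), ∑ m ∈ Finset.Icc (-(l : ℤ)) l,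
      coeff T l m t ω * sphHarmonic l m x

/-- `Z` is a spherical white noise with angular power spectrum `C`. -/
structure IsSphericalWhiteNoise (P : Measure Ω) (Z : S2 → ℤ → Ω → ℝ) (C : ℕ → ℝ) : Prop
    extends IsField P Z where
  summable : Summable (fun l : ℕ => (2 * l + 1) / (4 * Real.pi) * C l)
  cov_eq : ∀ (t : ℤ) (x y : S2),
    HasSum (fun l : ℕ => (2 * l + 1) / (4 * Real.pi) * C l * (legendre l).eval (dot x y))
      (∫ ω, Z x t ω * Z y t ω ∂P)
  uncorrelated : ∀ t s : ℤ, t ≠ s → ∀ (l l' : ℕ) (m m' : ℤ), |m| ≤ l → |m'| ≤ l' →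
    ∫ ω, coeff Z l m t ω * conj (coeff Z l' m' s ω) ∂P = 0

/-- `T` is the spherical moving average of order `q` driven by `Z`,
`T(x, t) = Z(x, t) + ∑_{j=1}^q (Θ_j Z(·, t - j))(x)`,
where `Θ_j` is the isotropic kernel operator with the continuous kernel `k (j - 1)`. The equality
holds in `L²(Ω)` for all `(x, t)` and in `L²(S² × Ω)` for all `t`. -/
structure IsSPHMA (P : Measure Ω) (q : ℕ) (k : Fin q → ℝ → ℝ) (Z T : S2 → ℤ → Ω → ℝ) : Prop where
  continuous_kernel : ∀ j, ContinuousOn (k j) (Set.Icc (-1) 1)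
  eq_pointwise : ∀ x t, T x t =ᵐ[P] fun ω =>
    Z x t ω + ∑ j : Fin q, isotropicOp (k j) (fun y => Z y (t - (j + 1 : ℕ)) ω) x
  eq_prod : ∀ t, (fun p : S2 × Ω => T p.1 t p.2) =ᵐ[surf.prod P] fun p =>
    Z p.1 t p.2 + ∑ j : Fin q, isotropicOp (k j) (fun y => Z y (t - (j + 1 : ℕ)) p.2) p.1

/-- `T` is an isotropic stationary, invertible spherical moving average of order `q`,
band-limited at `L`, driven by the white noise `Z` whose angular power spectrum is `sigmaSq l` for
`l ≤ L` and zero for `l > L`. Here `θ l j` is the eigenvalue of `Θ_{j+1}` on the spherical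
harmonics of degree `l`, and invertibility says that no polynomial
`θ_l(z) = 1 + ∑_{j=1}^q θ_{l;j} z^j` has a zero in the closed unit disc. -/
structure IsInvertibleBandLimitedSPHMA (P : Measure Ω) (L q : ℕ) (k : Fin q → ℝ → ℝ)
    (θ : ℕ → Fin q → ℝ) (sigmaSq : ℕ → ℝ) (Z T : S2 → ℤ → Ω → ℝ) : Prop where
  isotropicStationary : IsIsotropicStationary P T
  whiteNoise : IsSphericalWhiteNoise P Z (fun l => if l ≤ L then sigmaSq l else 0)
  bandLimited_noise : BandLimited P L Z
  bandLimited : BandLimited P L T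
  sphma : IsSPHMA P q k Z T
  eigenvalue : ∀ (j : Fin q) (l : ℕ) (m : ℤ), |m| ≤ l → ∀ x : S2,
    isotropicOp (k j) (sphHarmonic l m) x = (θ l j : ℂ) * sphHarmonic l m x
  invertible : ∀ (l : ℕ) (z : ℂ), ‖z‖ ≤ 1 →
    1 + ∑ j : Fin q, (θ l j : ℂ) * z ^ ((j : ℕ) + 1) ≠ 0

end Fields

end SphereTime

end

open MeasureTheory Filter Topology
open scoped ENNReal ComplexConjugate

noncomputable section

namespace SphereTime

/-! ### Integration on the sphere -/

/-! Isotropy diagonalises everything. Rotations act transitively on pairs of points with a given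
inner product, so r_t(x, y) = ρ_t(⟨x, y⟩) (`exists_zonal_autocov`). By `funkHecke` the operator of
r_t multiplies the harmonics of degree l by `fhCoeff (ρ t) l`, which is C_l(t)
(`angularAutocov_eq`), and the spectral density acts on degree l by f_l(λ). What remains is a scalar
approximation in each degree l ≤ L and a bound on the degrees l > L.

Scalar problem. f_l is continuous, even and nonnegative (`exists_spectral_density`); nonnegativity
comes from E|∑ e^{-iλs} a_{l,0}(s)|² ≥ 0 and a Cesàro limit. Being even, f_l + δ is a continuous
function of cos λ, so Weierstrass gives a polynomial g, positive on [-1, 1], with g(cos λ) close to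
f_l. The Fejér–Riesz factorisation `exists_spectral_factor` writes g(cos λ) = A |Θ(e^{-iλ})|² with Θ
real, Θ(0) = 1 and no zero in the closed disc: an invertible moving average. By Parseval ∫ |Θ|² = 2π
∑ Θ_j², so rescaling to the total mass of f_l produces exactly the prescribed σ_l², at a cost of
order δ (`exists_invertible_ma_approx`).

Realisation. `exists_bandLimited_process` drives all degrees l ≤ L by independent standard Gaussians
placed on the real and imaginary parts of the harmonics. The addition theorem `sphKernel_eq` makes
the resulting covariances zonal, and finite sums of Legendre kernels give the operators Θ_j.

Truncation. In (i) the part of a zonal kernel of degree above L tends to 0 in L² by Weierstrass and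
best approximation, and dominated convergence sums this over t. In (ii) the trace norm of a diagonal
operator is the sum of the moduli of its eigenvalues (`traceNorm_diagonal`), so the hypothesis says
that C_l(t) is absolutely summable over (l, m, t) and its tail is small. L is fixed first; the
scalar tolerance is chosen afterwards, small against the finitely many remaining degrees.

The harmonic analysis rests on three facts: orthonormality, from the Legendre equation and
integration by parts; the addition theorem, from rotation invariance of a reproducing kernel; and
completeness, from Stone–Weierstrass applied to exponentials of linear forms. -/

open scoped Pointwise in
theorem surf_measurePreserving_rotate (g : E3 ≃ₗᵢ[ℝ] E3) :
    MeasurePreserving (rotate g) surf surf := by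
  have hc : Continuous (rotate g) :=
    Continuous.subtype_mk (g.continuous.comp continuous_subtype_val) _
  refine ⟨hc.measurable, ?_⟩
  ext s hs
  rw [Measure.map_apply hc.measurable hs, Measure.toSphere_apply' _ (hc.measurable hs),
    Measure.toSphere_apply' _ hs]
  congr 1
  -- Surface measure is defined through the volume of the cone over a set; a linear isometry maps
  -- cones to cones and preserves volume.
  have : Set.Ioo (0 : ℝ) 1 • ((↑) '' (rotate g ⁻¹' s) : Set E3) =
      g ⁻¹' (Set.Ioo (0 : ℝ) 1 • ((↑) '' s : Set E3)) := by
    ext x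
    simp only [Set.mem_smul, Set.mem_image, Set.mem_preimage]
    constructor
    · rintro ⟨r, hr, _, ⟨y, hy, rfl⟩, rfl⟩
      exact ⟨r, hr, _, ⟨_, hy, rfl⟩, by simp [rotate]⟩
    · rintro ⟨r, hr, _, ⟨y, hy, rfl⟩, hx⟩
      have e : rotate g (rotate g.symm y) = y := by ext1; simp [rotate]
      refine ⟨r, hr, _, ⟨rotate g.symm y, by rwa [e], rfl⟩, ?_⟩
      apply g.injective
      rw [← hx]; simp [rotate]
  rw [this]
  exact g.measurePreserving.measure_preimage_equiv (f := g.toMeasurableEquiv) _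

theorem integral_rotate {E : Type*} [NormedAddCommGroup E] [NormedSpace ℝ E]
    (g : E3 ≃ₗᵢ[ℝ] E3) (f : S2 → E) : ∫ x, f (rotate g x) ∂surf = ∫ x, f x ∂surf := by
  have hc : ∀ g : E3 ≃ₗᵢ[ℝ] E3, Continuous (rotate g) := fun g =>
    Continuous.subtype_mk (g.continuous.comp continuous_subtype_val) _
  let e : S2 ≃ₜ S2 := ⟨⟨rotate g, rotate g.symm, fun x => by ext1; simp [rotate],
    fun x => by ext1; simp [rotate]⟩, hc _, hc _⟩
  exact (surf_measurePreserving_rotate g).integral_comp e.measurableEmbedding f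

theorem integral_volumeIoiPow (n : ℕ) (f : ℝ → ℝ) :
    ∫ r : Set.Ioi (0 : ℝ), f r ∂Measure.volumeIoiPow n = ∫ r in Set.Ioi (0 : ℝ), r ^ n * f r := by
  simp only [Measure.volumeIoiPow, ENNReal.ofReal]
  rw [integral_withDensity_eq_integral_smul (by fun_prop),
    integral_subtype_comap measurableSet_Ioi fun a ↦ Real.toNNReal (a ^ n) • f a]
  refine setIntegral_congr_fun measurableSet_Ioi fun x hx => ?_
  simp [NNReal.smul_def, Real.coe_toNNReal _ (pow_nonneg hx.out.le _)]

/-- Polar coordinates. The Gaussian weight is radial, which separates the sphere from the radius,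
and is also a product over Cartesian coordinates; comparing the two evaluations yields integrals
over the sphere. -/
theorem integral_homogeneous_mul_gaussian (n : ℕ) (p : E3 → ℝ)
    (hp : ∀ (r : ℝ) (x : E3), p (r • x) = r ^ n * p x) :
    ∫ x : E3, p x * Real.exp (-‖x‖ ^ 2) =
      (∫ y : S2, p y ∂surf) * ∫ r in Set.Ioi (0 : ℝ), r ^ (n + 2) * Real.exp (-r ^ 2) := by
  calc ∫ x : E3, p x * Real.exp (-‖x‖ ^ 2)
      = ∫ x : ({(0 : E3)}ᶜ : Set E3), p (x : E3) * Real.exp (-‖(x : E3)‖ ^ 2)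
          ∂(Measure.comap Subtype.val volume) := by
        rw [integral_subtype_comap (measurableSet_singleton _).compl
          fun x : E3 => p x * Real.exp (-‖x‖ ^ 2), restrict_compl_singleton]
    _ = ∫ z : S2 × Set.Ioi (0 : ℝ), p z.1 * ((z.2 : ℝ) ^ n * Real.exp (-(z.2 : ℝ) ^ 2))
          ∂(surf.prod (Measure.volumeIoiPow (Module.finrank ℝ E3 - 1))) := by
        rw [← (Measure.measurePreserving_homeomorphUnitSphereProd
          (volume : Measure E3)).integral_comp (Homeomorph.measurableEmbedding _)]
        refine integral_congr_ae (Eventually.of_forall fun x => ?_)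
        have hx : ‖(x : E3)‖ ≠ 0 := norm_ne_zero_iff.2 x.2
        have h1 : p (x : E3) = ‖(x : E3)‖ ^ n * p (‖(x : E3)‖⁻¹ • (x : E3)) := by
          rw [← hp, smul_inv_smul₀ hx]
        simp only [homeomorphUnitSphereProd_apply_fst_coe, homeomorphUnitSphereProd_apply_snd_coe]
        rw [h1]; ring
    _ = _ := by
        rw [integral_prod_mul (fun y : S2 => p y)
          (fun r : Set.Ioi (0 : ℝ) => (r : ℝ) ^ n * Real.exp (-(r : ℝ) ^ 2)),
          integral_volumeIoiPow _ (fun r => r ^ n * Real.exp (-r ^ 2))]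
        simp only [finrank_euclideanSpace, Fintype.card_fin]
        congr 1
        refine integral_congr_ae (Eventually.of_forall fun x => ?_)
        simp only
        ring

theorem integral_Ioi_pow_mul_gaussian (n : ℕ) :
    ∫ r in Set.Ioi (0 : ℝ), r ^ n * Real.exp (-r ^ 2) = Real.Gamma ((n + 1) / 2) / 2 := by
  have := integral_rpow_mul_exp_neg_rpow (p := 2) (q := n) (by norm_num)
    (by have : (0 : ℝ) ≤ n := n.cast_nonneg
        linarith)
  simp only [Real.rpow_natCast, Real.rpow_ofNat] at this
  rw [this]; ring

theorem integral_pow_mul_gaussian_even (k : ℕ) :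
    ∫ r : ℝ, r ^ (2 * k) * Real.exp (-r ^ 2) = Real.Gamma (k + 1 / 2) := by
  have := integral_comp_abs (f := fun r => r ^ (2 * k) * Real.exp (-r ^ 2))
  simp only [sq_abs, pow_mul] at this ⊢
  rw [this]
  simp only [← pow_mul]
  rw [integral_Ioi_pow_mul_gaussian]
  push_cast
  rw [show (2 * (k : ℝ) + 1) / 2 = k + 1 / 2 by ring]
  ring

theorem integral_coord_pow_mul_gaussian (n : ℕ) :
    ∫ x : E3, (x 2) ^ n * Real.exp (-‖x‖ ^ 2) =
      (∫ r : ℝ, r ^ n * Real.exp (-r ^ 2)) * Real.pi := by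
  rw [← (PiLp.volume_preserving_toLp (Fin 3)).integral_comp
    (MeasurableEquiv.toLp 2 (Fin 3 → ℝ)).measurableEmbedding]
  have h : ∀ x : Fin 3 → ℝ, ((WithLp.toLp 2 x : E3) 2) ^ n *
      Real.exp (-‖(WithLp.toLp 2 x : E3)‖ ^ 2) =
      ∏ i : Fin 3, (fun i r => (if i = 2 then r ^ n else 1) * Real.exp (-r ^ 2) :
        Fin 3 → ℝ → ℝ) i (x i) := by
    intro x
    rw [EuclideanSpace.norm_eq, Real.sq_sqrt (by positivity)]
    simp only [Fin.prod_univ_three, Fin.sum_univ_three, Real.norm_eq_abs, sq_abs, neg_add,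
      Real.exp_add, Fin.isValue, Fin.reduceEq, if_true, if_false]
    ring
  simp only [h]
  rw [integral_fintype_prod_volume_eq_prod (fun (i : Fin 3) (r : ℝ) =>
    (if i = 2 then r ^ n else 1) * Real.exp (-r ^ 2)), Fin.prod_univ_three]
  have hg : ∫ r : ℝ, Real.exp (-r ^ 2) = √Real.pi := by
    simpa using integral_gaussian 1
  simp only [Fin.isValue, Fin.reduceEq, if_true, if_false, one_mul, hg]
  rw [Real.mul_self_sqrt Real.pi_pos.le, mul_comm]

/-- The Gaussian integral of x₂ⁿ is evaluated in Cartesian and in polar coordinates. For even n the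
quotient of Gamma values collapses by Γ(s + 1) = s Γ(s); for odd n both sides vanish by symmetry. -/
theorem integral_surf_coord_pow (n : ℕ) :
    ∫ y : S2, ((y : E3) 2) ^ n ∂surf = 2 * Real.pi * ∫ u in (-1 : ℝ)..1, u ^ n := by
  have h := integral_homogeneous_mul_gaussian n (fun x : E3 => (x 2) ^ n)
    (fun r x => by simp [mul_pow])
  rw [integral_coord_pow_mul_gaussian, integral_Ioi_pow_mul_gaussian] at h
  have hG : 0 < Real.Gamma (((n + 2 : ℕ) + 1 : ℝ) / 2) := Real.Gamma_pos_of_pos (by positivity)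
  rcases Nat.even_or_odd' n with ⟨k, rfl | rfl⟩
  · rw [integral_pow_mul_gaussian_even] at h
    have e : (((2 * k + 2 : ℕ) + 1 : ℝ) / 2) = (k + 1 / 2) + 1 := by push_cast; ring
    have hpos : 0 < Real.Gamma ((k : ℝ) + 1 / 2) := Real.Gamma_pos_of_pos (by positivity)
    rw [e, Real.Gamma_add_one (by positivity)] at h
    rw [integral_pow]
    have h2 : ((-1 : ℝ)) ^ (2 * k + 1) = -1 := by rw [pow_succ, pow_mul]; simp
    rw [h2]
    push_cast
    have h3 : Real.pi = (∫ y : S2, ((y : E3) 2) ^ (2 * k) ∂surf) * ((k + 1 / 2) / 2) := by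
      apply mul_left_cancel₀ hpos.ne'
      rw [h]; ring
    rw [h3]
    field_simp
    ring
  · have h0 : ∫ r : ℝ, r ^ (2 * k + 1) * Real.exp (-r ^ 2) = 0 := by
      have := integral_neg_eq_self (fun r : ℝ => r ^ (2 * k + 1) * Real.exp (-r ^ 2)) volume
      have h2 : ∀ r : ℝ, (-r) ^ (2 * k + 1) * Real.exp (-(-r) ^ 2) =
          -(r ^ (2 * k + 1) * Real.exp (-r ^ 2)) := by
        intro r; rw [neg_sq, Odd.neg_pow ⟨k, rfl⟩]; ring
      simp only [h2, integral_neg] at this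
      linarith
    rw [h0, zero_mul] at h
    have h4 : ∫ y : S2, ((y : E3) 2) ^ (2 * k + 1) ∂surf = 0 := by
      rcases mul_eq_zero.1 h.symm with h | h
      · exact h
      · exact absurd h (by positivity)
    rw [h4, integral_pow]
    have : ((-1 : ℝ)) ^ (2 * k + 1 + 1) = 1 := by
      rw [show 2 * k + 1 + 1 = 2 * (k + 1) by ring, pow_mul]; simp
    rw [this]; simp

theorem continuous_coord (i : Fin 3) : Continuous fun y : S2 => (y : E3) i := by fun_prop

theorem integrable_surf {E : Type*} [NormedAddCommGroup E] {f : S2 → E} (hf : Continuous f) :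
    Integrable f surf :=
  hf.integrable_of_hasCompactSupport (HasCompactSupport.of_compactSpace f)

/-- Archimedes: the third coordinate is uniformly distributed on `[-1, 1]`. -/
theorem integral_surf_polynomial (p : Polynomial ℝ) :
    ∫ y : S2, p.eval ((y : E3) 2) ∂surf = 2 * Real.pi * ∫ u in (-1 : ℝ)..1, p.eval u := by
  induction p using Polynomial.induction_on' with
  | add p q hp hq =>
    simp only [Polynomial.eval_add]
    have hi : ∀ p : Polynomial ℝ, Integrable (fun y : S2 => p.eval ((y : E3) 2)) surf :=
      fun p => integrable_surf (p.continuous.comp (continuous_coord 2))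
    rw [integral_add (hi p) (hi q), hp, hq,
      intervalIntegral.integral_add (p.continuous.intervalIntegrable _ _)
      (q.continuous.intervalIntegrable _ _)]
    ring
  | monomial n a =>
    simp only [Polynomial.eval_monomial]
    rw [integral_const_mul, integral_surf_coord_pow, intervalIntegral.integral_const_mul]
    ring

theorem surf_real_univ : surf.real Set.univ = 4 * Real.pi := by
  have := integral_surf_polynomial 1
  simp only [Polynomial.eval_one, integral_const, smul_eq_mul, mul_one,
    intervalIntegral.integral_const] at this
  rw [this]; ring

/-! ### Legendre polynomials -/

section Legendre
open Polynomial

/-- The derivative of order `m` of the Legendre polynomial of degree `l`. -/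
abbrev legendreDeriv (l m : ℕ) : ℝ[X] := derivative^[m] (legendre l)

theorem legendreDeriv_succ (l m : ℕ) :
    legendreDeriv l (m + 1) = derivative (legendreDeriv l m) :=
  Function.iterate_succ_apply' _ _ _

theorem legendreDeriv_eq (l m : ℕ) : legendreDeriv l m =
    C (1 / (2 ^ l * (l.factorial : ℝ))) * derivative^[l + m] ((X ^ 2 - 1 : ℝ[X]) ^ l) := by
  rw [legendreDeriv, legendre, iterate_derivative_C_mul, ← Function.iterate_add_apply, add_comm]

/-- The power w = (X² - 1)^l satisfies (X² - 1) w' = 2 l X w; this is that identity differentiated n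
+ 1 times. At n = l + m it is the Legendre equation for the m-th derivative of P_l. -/
theorem rodrigues_ode (l n : ℕ) :
    (X ^ 2 - 1) * derivative^[n + 2] ((X ^ 2 - 1 : ℝ[X]) ^ l) +
      C (2 * ((n : ℝ) + 1 - l)) * X * derivative^[n + 1] ((X ^ 2 - 1 : ℝ[X]) ^ l) +
      C (((n : ℝ) + 1) * (n - 2 * l)) * derivative^[n] ((X ^ 2 - 1 : ℝ[X]) ^ l) = 0 := by
  induction n with
  | zero =>
    have h1 : (X ^ 2 - 1) * derivative ((X ^ 2 - 1 : ℝ[X]) ^ l) =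
        C (2 * (l : ℝ)) * X * (X ^ 2 - 1 : ℝ[X]) ^ l := by
      rcases l with _ | l
      · simp
      · rw [derivative_pow]
        simp only [derivative_sub, derivative_X_pow, derivative_one, Nat.cast_ofNat,
          Nat.add_sub_cancel, C_mul, map_ofNat]
        simp
        ring
    have h2 := congrArg derivative h1
    simp only [derivative_mul, derivative_C, derivative_X, derivative_sub, derivative_X_pow,
      derivative_one] at h2
    simp only [Function.iterate_zero, Function.iterate_succ, Function.comp, id]
    simp only [C_mul, C_sub, C_add, map_ofNat, map_natCast, map_one, Nat.cast_zero,
      map_zero] at h2 ⊢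
    norm_num at h2 ⊢
    linear_combination h2
  | succ n ih =>
    have h := congrArg derivative ih
    simp only [derivative_add, derivative_mul, derivative_C, derivative_X, derivative_sub,
      derivative_X_pow, derivative_one, derivative_zero] at h
    simp only [← Function.iterate_succ_apply' (f := derivative)] at h
    simp only [C_mul, C_sub, C_add, map_ofNat, map_natCast, map_one, Nat.cast_succ] at h ⊢
    norm_num at h ⊢
    linear_combination h

/-- Sturm–Liouville form of the equation, suited to integration by parts. -/
theorem legendreDeriv_ode (l m : ℕ) :
    derivative ((1 - X ^ 2) ^ (m + 1) * legendreDeriv l (m + 1)) =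
      - C (((l : ℝ) + m + 1) * (l - m)) * ((1 - X ^ 2) ^ m * legendreDeriv l m) := by
  have h := rodrigues_ode l (l + m)
  have e : ∀ j, legendreDeriv l j = _ := legendreDeriv_eq l
  rw [derivative_mul, ← legendreDeriv_succ, derivative_pow, e, e, e, ← add_assoc, ← add_assoc]
  generalize C (1 / (2 ^ l * (l.factorial : ℝ))) = c
  generalize derivative^[l + m + 2] ((X ^ 2 - 1 : ℝ[X]) ^ l) = w2 at h ⊢
  generalize derivative^[l + m + 1] ((X ^ 2 - 1 : ℝ[X]) ^ l) = w1 at h ⊢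
  generalize derivative^[l + m] ((X ^ 2 - 1 : ℝ[X]) ^ l) = w0 at h ⊢
  simp only [C_mul, C_sub, C_add, map_ofNat, map_natCast, map_one, Nat.cast_add, derivative_sub,
    derivative_X_pow, derivative_one, Nat.add_sub_cancel] at h ⊢
  norm_num at h ⊢
  linear_combination (-c * (1 - X ^ 2) ^ m) * h

/-- The integral of a polynomial over `[-1, 1]`. -/
def polyInt : ℝ[X] →ₗ[ℝ] ℝ where
  toFun p := ∫ u in (-1 : ℝ)..1, p.eval u
  map_add' p q := by
    simp only [eval_add]
    exact intervalIntegral.integral_add (p.continuous.intervalIntegrable _ _)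
      (q.continuous.intervalIntegrable _ _)
  map_smul' c p := by
    simp only [eval_smul, smul_eq_mul, RingHom.id_apply]
    exact intervalIntegral.integral_const_mul _ _

theorem polyInt_apply (p : ℝ[X]) : polyInt p = ∫ u in (-1 : ℝ)..1, p.eval u := rfl

theorem polyInt_C_mul (c : ℝ) (p : ℝ[X]) : polyInt (C c * p) = c * polyInt p := by
  rw [← smul_eq_C_mul, map_smul, smul_eq_mul]

theorem polyInt_derivative (p : ℝ[X]) : polyInt (derivative p) = p.eval 1 - p.eval (-1) :=
  intervalIntegral.integral_eq_sub_of_hasDerivAt (fun x _ => p.hasDerivAt x)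
    ((derivative p).continuous.intervalIntegrable _ _)

/-- Integration by parts with the Sturm–Liouville form; the boundary terms vanish because of the
factor 1 - X². It reduces every order m to m = 0. -/
theorem polyInt_legendreDeriv_succ (l k m : ℕ) :
    polyInt ((1 - X ^ 2) ^ (m + 1) * legendreDeriv l (m + 1) * legendreDeriv k (m + 1)) =
      ((l : ℝ) + m + 1) * (l - m) *
        polyInt ((1 - X ^ 2) ^ m * legendreDeriv l m * legendreDeriv k m) := by
  have h := polyInt_derivative ((1 - X ^ 2) ^ (m + 1) * legendreDeriv l (m + 1) *
    legendreDeriv k m)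
  rw [derivative_mul, legendreDeriv_ode, ← legendreDeriv_succ, map_add] at h
  have e : -C (((l : ℝ) + m + 1) * (l - m)) * ((1 - X ^ 2) ^ m * legendreDeriv l m) *
      legendreDeriv k m = C (-(((l : ℝ) + m + 1) * (l - m))) *
        ((1 - X ^ 2) ^ m * legendreDeriv l m * legendreDeriv k m) := by
    rw [C_neg]; ring
  rw [e, polyInt_C_mul] at h
  simp only [eval_mul, eval_pow, eval_sub, eval_one, eval_X] at h
  norm_num at h
  linarith

/-- The left side of the preceding recursion at m = 0 is symmetric in l and k, so the two
eigenvalues l(l + 1) and k(k + 1) give the same product; their difference (l - k)(l + k + 1) is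
nonzero. -/
theorem polyInt_legendre_of_ne {l k : ℕ} (h : l ≠ k) :
    polyInt (legendre l * legendre k) = 0 := by
  have h1 := polyInt_legendreDeriv_succ l k 0
  have h2 := polyInt_legendreDeriv_succ k l 0
  have e1 : (1 - X ^ 2 : ℝ[X]) ^ (0 + 1) * legendreDeriv k (0 + 1) * legendreDeriv l (0 + 1) =
    (1 - X ^ 2) ^ (0 + 1) * legendreDeriv l (0 + 1) * legendreDeriv k (0 + 1) := by ring
  have e2 : ∀ l k : ℕ, (1 - X ^ 2 : ℝ[X]) ^ 0 * legendreDeriv l 0 * legendreDeriv k 0 =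
    legendre l * legendre k := by intro l k; simp [legendreDeriv]
  rw [e1] at h2
  rw [h2, e2, e2, mul_comm (legendre k)] at h1
  have h3 : ((l : ℝ) - k) * ((l : ℝ) + k + 1) * polyInt (legendre l * legendre k) = 0 := by
    push_cast at h1; linear_combination -h1
  have h4 : (l : ℝ) - k ≠ 0 := sub_ne_zero.2 (by exact_mod_cast h)
  have h5 : (l : ℝ) + k + 1 ≠ 0 := by positivity
  simpa [h4, h5] using h3

theorem polyInt_legendreDeriv_of_ne {l k : ℕ} (h : l ≠ k) (m : ℕ) :
    polyInt ((1 - X ^ 2) ^ m * legendreDeriv l m * legendreDeriv k m) = 0 := by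
  induction m with
  | zero => simpa [legendreDeriv] using polyInt_legendre_of_ne h
  | succ m ih => rw [polyInt_legendreDeriv_succ, ih, mul_zero]

theorem polyInt_legendreDeriv_self {l m : ℕ} (h : m ≤ l) :
    polyInt ((1 - X ^ 2) ^ m * legendreDeriv l m * legendreDeriv l m) =
      ((l + m).factorial : ℝ) / ((l - m).factorial : ℝ) * polyInt (legendre l * legendre l) := by
  induction m with
  | zero =>
    have : ((l.factorial : ℕ) : ℝ) ≠ 0 := by positivity
    simp [legendreDeriv, this]
  | succ m ih =>
    rw [polyInt_legendreDeriv_succ, ih (by omega)]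
    obtain ⟨j, rfl⟩ : ∃ j, l = j + m + 1 := ⟨l - (m + 1), by omega⟩
    rw [show j + m + 1 - m = j + 1 by omega, show j + m + 1 - (m + 1) = j by omega,
      show j + m + 1 + (m + 1) = (j + m + 1 + m) + 1 by omega, Nat.factorial_succ j,
      Nat.factorial_succ (j + m + 1 + m)]
    push_cast
    field_simp
    ring

theorem iterate_derivative_eq_C {p : ℝ[X]} {n : ℕ} (h : p.natDegree ≤ n) :
    derivative^[n] p = C ((n.factorial : ℝ) * p.coeff n) := by
  ext k
  rw [coeff_iterate_derivative, coeff_C]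
  rcases k with _ | k
  · simp [Nat.descFactorial_self]
  · rw [coeff_eq_zero_of_natDegree_lt (by omega)]; simp

theorem natDegree_rodrigues (l : ℕ) : ((X ^ 2 - 1 : ℝ[X]) ^ l).natDegree = 2 * l := by
  rw [natDegree_pow, mul_comm]
  congr 1
  rw [show (1 : ℝ[X]) = C 1 from rfl]
  exact natDegree_X_pow_sub_C

theorem coeff_rodrigues (l : ℕ) : ((X ^ 2 - 1 : ℝ[X]) ^ l).coeff (2 * l) = 1 := by
  rw [← natDegree_rodrigues]
  exact (Monic.pow
    (by rw [show (1 : ℝ[X]) = C 1 from rfl]; exact monic_X_pow_sub_C 1 two_ne_zero) l)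

theorem natDegree_legendreDeriv_le (l m : ℕ) : (legendreDeriv l m).natDegree ≤ l - m := by
  rw [legendreDeriv_eq]
  refine (natDegree_C_mul_le _ _).trans ((natDegree_iterate_derivative _ _).trans ?_)
  rw [natDegree_rodrigues]; omega

theorem coeff_legendreDeriv_ne_zero {l m : ℕ} (h : m ≤ l) :
    (legendreDeriv l m).coeff (l - m) ≠ 0 := by
  rw [legendreDeriv_eq, coeff_C_mul, coeff_iterate_derivative,
    show l - m + (l + m) = 2 * l by omega, coeff_rodrigues]
  have : 0 < (2 * l).descFactorial (l + m) := Nat.descFactorial_pos.2 (by omega)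
  simp only [nsmul_eq_mul, mul_one]
  positivity

/-- The derivative of X (1 - X²)^(l+1) has integral 0, which gives a two-term recursion in l. -/
theorem polyInt_one_sub_sq_pow (l : ℕ) :
    polyInt ((1 - X ^ 2) ^ l) * ((2 * l + 1).factorial : ℝ) =
      2 * 4 ^ l * (l.factorial : ℝ) ^ 2 := by
  induction l with
  | zero => simp [polyInt_apply]; norm_num
  | succ l ih =>
    have h := polyInt_derivative (X * (1 - X ^ 2) ^ (l + 1))
    have e : derivative (X * (1 - X ^ 2 : ℝ[X]) ^ (l + 1)) =
        C (2 * (l : ℝ) + 3) * (1 - X ^ 2) ^ (l + 1) - C (2 * ((l : ℝ) + 1)) * (1 - X ^ 2) ^ l := by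
      rw [derivative_mul, derivative_pow]
      simp only [C_mul, C_add, map_ofNat, map_natCast, map_one, derivative_sub, derivative_X,
        derivative_X_pow, derivative_one, Nat.add_sub_cancel, Nat.cast_succ]
      norm_num
      ring
    rw [e, map_sub, polyInt_C_mul, polyInt_C_mul] at h
    simp only [eval_mul, eval_pow, eval_sub, eval_one, eval_X] at h
    norm_num at h
    rw [show 2 * (l + 1) + 1 = (2 * l + 1 + 1) + 1 by ring, Nat.factorial_succ,
      Nat.factorial_succ (2 * l + 1), Nat.factorial_succ l]
    push_cast
    have h2 : (2 * (l : ℝ) + 3) * polyInt ((1 - X ^ 2) ^ (l + 1)) =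
      2 * ((l : ℝ) + 1) * polyInt ((1 - X ^ 2) ^ l) := by linarith
    linear_combination (2 * (l : ℝ) + 2) * ((2 * l + 1).factorial : ℝ) * h2 +
      4 * ((l : ℝ) + 1) ^ 2 * ih

/-- The order recursion is run up to m = l, where the derivative of P_l is a constant and only ∫ (1
- u²)^l is left to evaluate. -/
theorem polyInt_legendre_self (l : ℕ) :
    polyInt (legendre l * legendre l) = 2 / (2 * l + 1) := by
  have h := polyInt_legendreDeriv_self (le_refl l)
  have e : legendreDeriv l l =
      C (1 / (2 ^ l * (l.factorial : ℝ)) * ((2 * l).factorial : ℝ)) := by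
    rw [legendreDeriv_eq, iterate_derivative_eq_C (by rw [natDegree_rodrigues]; omega),
      ← two_mul, coeff_rodrigues, mul_one, ← C_mul]
  have e2 : ∀ c : ℝ, (1 - X ^ 2 : ℝ[X]) ^ l * C c * C c = C (c * c) * (1 - X ^ 2) ^ l := by
    intro c; rw [C_mul]; ring
  rw [e, e2, polyInt_C_mul, ← two_mul, Nat.sub_self, Nat.factorial_zero, Nat.cast_one, div_one] at h
  have hB := polyInt_one_sub_sq_pow l
  rw [Nat.factorial_succ] at hB
  push_cast at hB
  have f1 : ((2 * l).factorial : ℝ) ≠ 0 := by positivity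
  have f2 : (l.factorial : ℝ) ≠ 0 := by positivity
  apply mul_left_cancel₀ f1
  rw [← h]
  have hB' : polyInt ((1 - X ^ 2) ^ l) = 2 * 4 ^ l * (l.factorial : ℝ) ^ 2 /
      ((2 * l + 1) * ((2 * l).factorial : ℝ)) := by
    rw [eq_div_iff (by positivity)]; exact hB
  rw [hB']
  have h4 : (4 : ℝ) ^ l = 2 ^ l * 2 ^ l := by rw [← mul_pow]; norm_num
  rw [h4]
  field_simp

/-- Since (X² - 1)^l = (X - 1)^l (X + 1)^l, the l-th derivative at 1 is l! 2^l. -/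
theorem legendre_eval_one (l : ℕ) : (legendre l).eval 1 = 1 := by
  have h := aeval_iterate_derivative_self (A := ℝ) ((X ^ 2 - 1 : ℝ[X]) ^ l) l 1
    (p' := (X + 1) ^ l) (by
      rw [← mul_pow, Polynomial.map_pow]; congr 1; simp; ring)
  simp only [coe_aeval_eq_eval, eval_pow, eval_add, eval_X, eval_one, nsmul_eq_mul] at h
  rw [legendre, eval_mul, eval_C, h]
  norm_num
  field_simp

/-- Polynomials of degree at most `n - m` are combinations of the derivatives of order `m` of the
Legendre polynomials of degree at most `n`. -/
theorem mem_span_legendreDeriv (m d : ℕ) (p : ℝ[X]) (hp : p.natDegree ≤ d) :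
    p ∈ Submodule.span ℝ ((fun l => legendreDeriv l m) '' Set.Icc m (m + d)) := by
  induction d generalizing p with
  | zero =>
    have h0 := natDegree_legendreDeriv_le m m
    have h1 := coeff_legendreDeriv_ne_zero (le_refl m)
    rw [Nat.sub_self] at h0 h1
    rw [eq_C_of_natDegree_le_zero hp]
    have : C (p.coeff 0) = (p.coeff 0 / (legendreDeriv m m).coeff 0) • legendreDeriv m m := by
      conv_rhs => rw [eq_C_of_natDegree_le_zero h0]
      rw [smul_C, smul_eq_mul, coeff_C_zero, div_mul_cancel₀ _ h1]
    rw [this]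
    exact Submodule.smul_mem _ _ (Submodule.subset_span ⟨m, by simp, rfl⟩)
  | succ d ih =>
    set q := legendreDeriv (m + (d + 1)) m with hq
    have h1 : q.coeff (d + 1) ≠ 0 := by
      have := coeff_legendreDeriv_ne_zero (show m ≤ m + (d + 1) by omega)
      rwa [show m + (d + 1) - m = d + 1 by omega] at this
    have h2 : q.natDegree ≤ d + 1 := by
      have := natDegree_legendreDeriv_le (m + (d + 1)) m
      rwa [show m + (d + 1) - m = d + 1 by omega] at this
    have h3 : (p - (p.coeff (d + 1) / q.coeff (d + 1)) • q).natDegree ≤ d := by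
      rw [natDegree_le_iff_coeff_eq_zero]
      intro N hN
      rcases Nat.lt_or_ge (d + 1) N with h | h
      · rw [coeff_sub, coeff_smul, coeff_eq_zero_of_natDegree_lt (by omega),
          coeff_eq_zero_of_natDegree_lt (h2.trans_lt h)]; simp
      · obtain rfl : N = d + 1 := by omega
        rw [coeff_sub, coeff_smul, smul_eq_mul, div_mul_cancel₀ _ h1, sub_self]
    rw [← sub_add_cancel p ((p.coeff (d + 1) / q.coeff (d + 1)) • q)]
    refine Submodule.add_mem _ (Submodule.span_mono (Set.image_mono (Set.Icc_subset_Icc_right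
      (by omega))) (ih _ h3)) (Submodule.smul_mem _ _ (Submodule.subset_span ⟨_, ?_, rfl⟩))
    simp

end Legendre

/-! ### Orthonormality of the spherical harmonics -/

/-- The complex coordinate `x₀ + i x₁`. -/
def zeta (x : S2) : ℂ := ((x : E3) 0 : ℂ) + Complex.I * ((x : E3) 1 : ℂ)

/-- The azimuthal factor of `Y_{l,m}`, namely `(x₀ + i x₁) ^ m` for `m ≥ 0` and
`(x₀ - i x₁) ^ (-m)` for `m < 0`. -/
def azim (m : ℤ) (x : S2) : ℂ :=
  if 0 ≤ m then zeta x ^ m.natAbs else conj (zeta x) ^ m.natAbs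

/-- The normalising constant of `Y_{l,m}`. -/
def harmConst (l : ℕ) (m : ℤ) : ℝ :=
  (if 0 ≤ m then (-1) ^ m.natAbs else 1) * Real.sqrt ((2 * l + 1) / (4 * Real.pi) *
      (((l - m.natAbs).factorial : ℝ) / ((l + m.natAbs).factorial : ℝ)))

theorem sphHarmonic_eq (l : ℕ) (m : ℤ) (x : S2) : sphHarmonic l m x =
    (harmConst l m : ℂ) * azim m x *
      (((legendreDeriv l m.natAbs).eval ((x : E3) 2) : ℝ) : ℂ) := by
  have h1 : ((-1 : ℂ) ^ m.natAbs) * (-1) ^ m.natAbs = 1 := by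
    rw [← mul_pow]; norm_num
  unfold sphHarmonic harmConst azim sphHarmonicNat
  split_ifs with h
  · simp only [zeta, Complex.ofReal_mul, Complex.ofReal_pow, Complex.ofReal_neg,
      Complex.ofReal_one]
  · simp only [zeta, map_mul, map_pow, map_neg, map_one, Complex.conj_ofReal, one_mul]
    rw [← mul_assoc, ← mul_assoc, ← mul_assoc, h1, one_mul]

theorem continuous_zeta : Continuous zeta := by unfold zeta; fun_prop

theorem continuous_azim (m : ℤ) : Continuous (azim m) := by
  unfold azim
  split_ifs
  · exact continuous_zeta.pow _
  · exact (Complex.continuous_conj.comp continuous_zeta).pow _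

theorem continuous_sphHarmonic (l : ℕ) (m : ℤ) : Continuous (sphHarmonic l m) := by
  rw [show sphHarmonic l m = _ from funext (sphHarmonic_eq l m)]
  exact (continuous_const.mul (continuous_azim m)).mul
    (Complex.continuous_ofReal.comp ((Polynomial.continuous _).comp (continuous_coord 2)))

theorem harmConst_sq {l : ℕ} {m : ℤ} : harmConst l m ^ 2 =
    (2 * l + 1) / (4 * Real.pi) *
      (((l - m.natAbs).factorial : ℝ) / ((l + m.natAbs).factorial : ℝ)) := by
  unfold harmConst
  rw [mul_pow, Real.sq_sqrt (by positivity)]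
  split_ifs
  · rw [← pow_mul, mul_comm m.natAbs, pow_mul]; norm_num
  · norm_num

theorem harmConst_ne_zero (l : ℕ) (m : ℤ) : harmConst l m ≠ 0 := by
  intro h
  have := harmConst_sq (l := l) (m := m)
  rw [h] at this
  have h2 : (0 : ℝ) < (2 * l + 1) / (4 * Real.pi) *
      (((l - m.natAbs).factorial : ℝ) / ((l + m.natAbs).factorial : ℝ)) := by positivity
  rw [← this] at h2
  norm_num at h2

theorem sum_coord_sq (x : S2) :
    ((x : E3) 0) ^ 2 + ((x : E3) 1) ^ 2 + ((x : E3) 2) ^ 2 = 1 := by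
  have h : ‖(x : E3)‖ = 1 := norm_eq_of_mem_sphere x
  have h2 := EuclideanSpace.norm_sq_eq (x : E3)
  rw [h] at h2
  simpa [Fin.sum_univ_three] using h2.symm

theorem zeta_mul_conj (x : S2) : zeta x * conj (zeta x) = 1 - (((x : E3) 2 : ℝ) : ℂ) ^ 2 := by
  have h := sum_coord_sq x
  have h2 : (((x : E3) 0 : ℂ)) ^ 2 + ((x : E3) 1 : ℂ) ^ 2 + ((x : E3) 2 : ℂ) ^ 2 = 1 := by
    rw [← Complex.ofReal_pow, ← Complex.ofReal_pow, ← Complex.ofReal_pow, ← Complex.ofReal_add,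
      ← Complex.ofReal_add, h, Complex.ofReal_one]
  simp only [zeta, map_add, map_mul, Complex.conj_ofReal, Complex.conj_I]
  linear_combination h2 - ((x : E3) 1 : ℂ) ^ 2 * Complex.I_sq

theorem azim_mul_conj (m : ℤ) (x : S2) :
    azim m x * conj (azim m x) = (1 - (((x : E3) 2 : ℝ) : ℂ) ^ 2) ^ m.natAbs := by
  rw [← zeta_mul_conj, mul_pow]
  unfold azim
  split_ifs
  · rw [map_pow]
  · rw [map_pow, Complex.conj_conj, mul_comm]

/-- The rotation by the angle `φ` about the third axis. -/
def rotZ (φ : ℝ) : E3 ≃ₗᵢ[ℝ] E3 where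
  toFun x := !₂[Real.cos φ * x 0 - Real.sin φ * x 1, Real.sin φ * x 0 + Real.cos φ * x 1, x 2]
  invFun x := !₂[Real.cos φ * x 0 + Real.sin φ * x 1, -Real.sin φ * x 0 + Real.cos φ * x 1, x 2]
  map_add' x y := by
    ext i; fin_cases i <;> simp <;> ring
  map_smul' c x := by
    ext i; fin_cases i <;> simp <;> ring
  left_inv x := by
    have h := Real.sin_sq_add_cos_sq φ
    ext i; fin_cases i
    · simp; linear_combination (x 0) * h
    · simp; linear_combination (x 1) * h
    · simp
  right_inv x := by
    have h := Real.sin_sq_add_cos_sq φ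
    ext i; fin_cases i
    · simp; linear_combination (x 0) * h
    · simp; linear_combination (x 1) * h
    · simp
  norm_map' x := by
    have h := Real.sin_sq_add_cos_sq φ
    simp only [LinearEquiv.coe_mk, LinearMap.coe_mk, AddHom.coe_mk, EuclideanSpace.norm_eq,
      Fin.sum_univ_three, Real.norm_eq_abs, sq_abs]
    congr 1
    simp
    linear_combination ((x 0) ^ 2 + (x 1) ^ 2) * h

theorem zeta_rotZ (φ : ℝ) (x : S2) :
    zeta (rotate (rotZ φ) x) = Complex.exp (φ * Complex.I) * zeta x := by
  simp [zeta, rotate, rotZ, Complex.exp_mul_I]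
  linear_combination (-(Complex.sin φ) * ((x : E3) 1 : ℂ)) * Complex.I_sq

theorem azim_rotZ (φ : ℝ) (m : ℤ) (x : S2) :
    azim m (rotate (rotZ φ) x) = Complex.exp (m * φ * Complex.I) * azim m x := by
  unfold azim
  rw [zeta_rotZ]
  split_ifs with h
  · rw [mul_pow, ← Complex.exp_nat_mul, ← mul_assoc]
    congr 3
    rw [← Int.cast_natCast (R := ℂ), Int.natCast_natAbs, abs_of_nonneg h]
  · rw [map_mul, mul_pow, ← Complex.exp_conj, ← Complex.exp_nat_mul, map_mul, Complex.conj_I,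
      Complex.conj_ofReal]
    congr 2
    rw [← Int.cast_natCast (R := ℂ), Int.natCast_natAbs, abs_of_neg (not_le.1 h)]
    push_cast; ring

theorem sphHarmonic_rotZ (φ : ℝ) (l : ℕ) (m : ℤ) (x : S2) :
    sphHarmonic l m (rotate (rotZ φ) x) = Complex.exp (m * φ * Complex.I) * sphHarmonic l m x := by
  have h2 : ((rotate (rotZ φ) x : S2) : E3) 2 = (x : E3) 2 := by simp [rotate, rotZ]
  rw [sphHarmonic_eq, sphHarmonic_eq, azim_rotZ, h2]
  ring

/-- Rotation about the third axis by the angle π / (m - m') multiplies the integrand by e^{iπ} = -1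
and preserves the integral. -/
theorem integral_sphHarmonic_mul_conj_of_ne (l l' : ℕ) {m m' : ℤ} (h : m ≠ m') :
    ∫ x, sphHarmonic l m x * conj (sphHarmonic l' m' x) ∂surf = 0 := by
  have hmm : ((m : ℂ) - m') ≠ 0 := sub_ne_zero.2 (by exact_mod_cast h)
  have h1 := integral_rotate (rotZ (Real.pi / (m - m')))
    (fun x => sphHarmonic l m x * conj (sphHarmonic l' m' x))
  have h2 : ∀ x, sphHarmonic l m (rotate (rotZ (Real.pi / (m - m'))) x) *
      conj (sphHarmonic l' m' (rotate (rotZ (Real.pi / (m - m'))) x)) =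
      (-1 : ℂ) * (sphHarmonic l m x * conj (sphHarmonic l' m' x)) := by
    intro x
    rw [sphHarmonic_rotZ, sphHarmonic_rotZ, map_mul, ← Complex.exp_conj, mul_mul_mul_comm,
      ← Complex.exp_add, ← Complex.exp_pi_mul_I]
    congr 2
    simp only [map_mul, Complex.conj_I, Complex.conj_ofReal, map_intCast]
    push_cast
    field_simp
    ring
  simp only [h2] at h1
  rw [integral_const_mul] at h1
  linear_combination (-1 / 2 : ℂ) * h1

/-- For equal m the azimuthal factors combine to (1 - x₂²)^|m|, so the integrand is a polynomial in
x₂ and Archimedes' formula applies. -/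
theorem integral_sphHarmonic_mul_conj_same (l l' : ℕ) (m : ℤ) :
    ∫ x, sphHarmonic l m x * conj (sphHarmonic l' m x) ∂surf =
      ((harmConst l m * harmConst l' m * (2 * Real.pi * polyInt ((1 - Polynomial.X ^ 2) ^ m.natAbs *
        legendreDeriv l m.natAbs * legendreDeriv l' m.natAbs)) : ℝ) : ℂ) := by
  have h : ∀ x : S2, sphHarmonic l m x * conj (sphHarmonic l' m x) =
      ((harmConst l m * harmConst l' m * ((1 - Polynomial.X ^ 2) ^ m.natAbs *
        legendreDeriv l m.natAbs * legendreDeriv l' m.natAbs).eval ((x : E3) 2) : ℝ) : ℂ) := by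
    intro x
    rw [sphHarmonic_eq, sphHarmonic_eq]
    have := azim_mul_conj m x
    simp only [map_mul, Complex.conj_ofReal, Polynomial.eval_mul, Polynomial.eval_pow,
      Polynomial.eval_sub, Polynomial.eval_one, Polynomial.eval_X, Complex.ofReal_mul,
      Complex.ofReal_pow, Complex.ofReal_sub, Complex.ofReal_one]
    rw [← this]; ring
  simp only [h]
  rw [integral_complex_ofReal, integral_const_mul, integral_surf_polynomial]
  rfl

theorem integral_sphHarmonic_mul_conj {l l' : ℕ} {m m' : ℤ} (hm : |m| ≤ l) :
    ∫ x, sphHarmonic l m x * conj (sphHarmonic l' m' x) ∂surf =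
      if l = l' ∧ m = m' then 1 else 0 := by
  by_cases h : m = m'
  swap
  · rw [integral_sphHarmonic_mul_conj_of_ne l l' h, if_neg (fun h' => h h'.2)]
  subst h
  rw [integral_sphHarmonic_mul_conj_same]
  by_cases hl : l = l'
  swap
  · rw [polyInt_legendreDeriv_of_ne hl, if_neg (fun h' => hl h'.1)]; simp
  subst hl
  rw [polyInt_legendreDeriv_self (by rw [Int.abs_eq_natAbs] at hm; omega), polyInt_legendre_self,
    ← sq, harmConst_sq,
    if_pos ⟨rfl, rfl⟩, ← Complex.ofReal_one]
  congr 1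
  have h1 : (((l - m.natAbs).factorial : ℕ) : ℝ) ≠ 0 := by positivity
  have h2 : (((l + m.natAbs).factorial : ℕ) : ℝ) ≠ 0 := by positivity
  field_simp
  ring

/-! ### Rotation invariance of the space of spherical harmonics of degree at most `d` -/

theorem conj_azim (m : ℤ) (x : S2) : conj (azim m x) = azim (-m) x := by
  unfold azim
  rcases lt_trichotomy m 0 with h | rfl | h
  · rw [if_neg (by omega), if_pos (by omega), map_pow, Complex.conj_conj, Int.natAbs_neg]
  · simp
  · rw [if_pos (by omega), if_neg (by omega), map_pow, Int.natAbs_neg]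

theorem zeta_mul_azim_of_nonneg {m : ℤ} (h : 0 ≤ m) (x : S2) :
    zeta x * azim m x = azim (m + 1) x := by
  unfold azim
  rw [if_pos h, if_pos (by omega), show (m + 1).natAbs = m.natAbs + 1 by omega, pow_succ']

theorem zeta_mul_azim_of_neg {m : ℤ} (h : m < 0) (x : S2) :
    zeta x * azim m x = azim (m + 1) x * (1 - (((x : E3) 2 : ℝ) : ℂ) ^ 2) := by
  rw [← zeta_mul_conj]
  unfold azim
  rw [if_neg (by omega), show m.natAbs = (m + 1).natAbs + 1 by omega, pow_succ']
  split_ifs with h0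
  · obtain rfl : m = -1 := by omega
    simp
  · ring

/-- The span of the constants and the linear functions on the sphere. -/
def affineFun : Submodule ℂ (S2 → ℂ) :=
  Submodule.span ℂ (insert 1 (Set.range fun (i : Fin 3) (x : S2) => (((x : E3) i : ℝ) : ℂ)))

theorem one_mem_affineFun : (1 : S2 → ℂ) ∈ affineFun :=
  Submodule.subset_span (Set.mem_insert _ _)

theorem coord_mem_affineFun (i : Fin 3) : (fun x : S2 => (((x : E3) i : ℝ) : ℂ)) ∈ affineFun :=
  Submodule.subset_span (Set.mem_insert_of_mem _ ⟨i, rfl⟩)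

/-- Composition with a rotation, as an algebra homomorphism. -/
def compRotate (g : E3 ≃ₗᵢ[ℝ] E3) : (S2 → ℂ) →ₐ[ℂ] (S2 → ℂ) where
  toFun f x := f (rotate g x)
  map_one' := rfl
  map_mul' _ _ := rfl
  map_zero' := rfl
  map_add' _ _ := rfl
  commutes' _ := rfl

theorem map_compRotate_affineFun_le (g : E3 ≃ₗᵢ[ℝ] E3) :
    affineFun.map (compRotate g).toLinearMap ≤ affineFun := by
  rw [affineFun, Submodule.map_span_le]
  rintro f (rfl | ⟨i, rfl⟩)
  · exact one_mem_affineFun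
  · have h : (compRotate g).toLinearMap (fun x : S2 => (((x : E3) i : ℝ) : ℂ)) =
        ∑ j : Fin 3, (((g (EuclideanSpace.single j 1)) i : ℝ) : ℂ) •
          (fun x : S2 => (((x : E3) j : ℝ) : ℂ)) := by
      ext x
      have hx : (x : E3) = ∑ j, (x : E3) j • EuclideanSpace.single j (1 : ℝ) := by
        ext k; fin_cases k <;> simp [Fin.sum_univ_three]
      have h1 : (g (x : E3)) i = ∑ j, (x : E3) j * (g (EuclideanSpace.single j 1)) i := by
        conv_lhs => rw [hx]
        simp [Fin.sum_univ_three]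
      change (((g (x : E3)) i : ℝ) : ℂ) = _
      rw [h1]
      simp [Fin.sum_univ_three]
      ring
    rw [h]
    exact Submodule.sum_mem _ fun j _ => Submodule.smul_mem _ _ (coord_mem_affineFun j)

theorem comp_rotate_mem_affineFun_pow (g : E3 ≃ₗᵢ[ℝ] E3) {d : ℕ} {f : S2 → ℂ}
    (hf : f ∈ affineFun ^ d) : (fun x => f (rotate g x)) ∈ affineFun ^ d := by
  have h : (affineFun ^ d).map (compRotate g).toLinearMap ≤ affineFun ^ d := by
    rw [Submodule.map_pow]
    exact pow_le_pow_left' (map_compRotate_affineFun_le g) d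
  exact h ⟨f, hf, rfl⟩

/-- The span of the functions `azim m * p(x₂)` with `|m| + deg p ≤ d`. -/
def azimSpan (d : ℕ) : Submodule ℂ (S2 → ℂ) :=
  Submodule.span ℂ {f | ∃ (m : ℤ) (p : Polynomial ℝ), m.natAbs + p.natDegree ≤ d ∧
    f = fun x => azim m x * ((p.eval ((x : E3) 2) : ℝ) : ℂ)}

theorem azim_mul_mem {d : ℕ} (m : ℤ) (p : Polynomial ℝ) (h : m.natAbs + p.natDegree ≤ d) :
    (fun x : S2 => azim m x * ((p.eval ((x : E3) 2) : ℝ) : ℂ)) ∈ azimSpan d :=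
  Submodule.subset_span ⟨m, p, h, rfl⟩

theorem natDegree_mul_one_sub_sq_le (p : Polynomial ℝ) :
    (p * (1 - Polynomial.X ^ 2)).natDegree ≤ p.natDegree + 2 := by
  refine Polynomial.natDegree_mul_le.trans (Nat.add_le_add_left ?_ _)
  refine (Polynomial.natDegree_sub_le _ _).trans ?_
  simp

theorem zeta_mul_mem {d : ℕ} (m : ℤ) (p : Polynomial ℝ) (h : m.natAbs + p.natDegree ≤ d) :
    (fun x : S2 => zeta x * (azim m x * ((p.eval ((x : E3) 2) : ℝ) : ℂ))) ∈ azimSpan (d + 1) := by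
  by_cases hm : 0 ≤ m
  · simp only [← mul_assoc, zeta_mul_azim_of_nonneg hm]
    exact azim_mul_mem _ _ (by omega)
  · have := azim_mul_mem (d := d + 1) (m + 1) (p * (1 - Polynomial.X ^ 2)) (by
      have := natDegree_mul_one_sub_sq_le p
      omega)
    convert this using 2 with x
    rw [← mul_assoc, zeta_mul_azim_of_neg (not_le.1 hm)]
    simp
    ring

theorem conj_zeta_mul_mem {d : ℕ} (m : ℤ) (p : Polynomial ℝ) (h : m.natAbs + p.natDegree ≤ d) :
    (fun x : S2 => conj (zeta x) * (azim m x * ((p.eval ((x : E3) 2) : ℝ) : ℂ))) ∈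
      azimSpan (d + 1) := by
  have key : ∀ x, conj (zeta x) * azim m x = conj (zeta x * azim (-m) x) := by
    intro x; rw [map_mul, conj_azim, neg_neg]
  by_cases hm : 0 ≤ -m
  · simp only [← mul_assoc, key, zeta_mul_azim_of_nonneg hm, conj_azim]
    exact azim_mul_mem _ _ (by omega)
  · have := azim_mul_mem (d := d + 1) (m - 1) (p * (1 - Polynomial.X ^ 2)) (by
      have := natDegree_mul_one_sub_sq_le p
      omega)
    convert this using 2 with x
    rw [← mul_assoc, key, zeta_mul_azim_of_neg (not_le.1 hm), map_mul, conj_azim,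
      show -(-m + 1) = m - 1 by ring]
    simp
    ring

/-- The coordinates x₀ and x₁ are combinations of ζ and its conjugate. These shift the azimuthal
index by one; when |m| decreases, the identity |ζ|² = 1 - x₂² converts the cancelled pair into a
polynomial in x₂ of degree 2, so the total degree grows by at most 1. -/
theorem affineFun_mul_azimSpan_le (d : ℕ) : affineFun * azimSpan d ≤ azimSpan (d + 1) := by
  rw [affineFun, azimSpan, Submodule.span_mul_span, Submodule.span_le]
  rintro _ ⟨f, hf, _, ⟨m, p, h, rfl⟩, rfl⟩
  rw [SetLike.mem_coe]
  have h1 := zeta_mul_mem m p h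
  have h2 := conj_zeta_mul_mem m p h
  rcases hf with rfl | ⟨i, rfl⟩
  · simp only [one_mul]
    exact azim_mul_mem _ _ (by omega)
  · fin_cases i
    · convert Submodule.smul_mem _ (1 / 2 : ℂ) (Submodule.add_mem _ h1 h2) using 1
      ext x
      simp [zeta]
      ring
    · convert Submodule.smul_mem _ (-Complex.I / 2 : ℂ) (Submodule.sub_mem _ h1 h2) using 1
      ext x
      simp [zeta]
      linear_combination (((x : E3) 1 : ℂ) * azim m x *
        ((p.eval ((x : E3) 2) : ℝ) : ℂ)) * Complex.I_sq
    · have := azim_mul_mem (d := d + 1) m (p * Polynomial.X)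
        (by
          have := Polynomial.natDegree_mul_le (p := p) (q := Polynomial.X)
          rw [Polynomial.natDegree_X] at this
          omega)
      convert this using 1
      ext x
      simp
      ring

theorem affineFun_pow_le_azimSpan (d : ℕ) : affineFun ^ d ≤ azimSpan d := by
  induction d with
  | zero =>
    rw [pow_zero, Submodule.one_eq_span, Submodule.span_le, Set.singleton_subset_iff,
      SetLike.mem_coe]
    convert azim_mul_mem (d := 0) 0 1 (by simp) using 1
    ext x; simp [azim]
  | succ d ih =>
    rw [pow_succ']
    exact (mul_le_mul_right ih affineFun).trans (affineFun_mul_azimSpan_le d)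

/-- The span of the spherical harmonics of degree at most `d`. -/
def sphSpan (d : ℕ) : Submodule ℂ (S2 → ℂ) :=
  Submodule.span ℂ {f | ∃ (l : ℕ) (m : ℤ), l ≤ d ∧ |m| ≤ l ∧ f = sphHarmonic l m}

theorem sphHarmonic_mem {d l : ℕ} {m : ℤ} (hl : l ≤ d) (hm : |m| ≤ l) :
    sphHarmonic l m ∈ sphSpan d := Submodule.subset_span ⟨l, m, hl, hm, rfl⟩

/-- For fixed m, a polynomial of degree at most d - |m| is a combination of the m-th derivatives of
the Legendre polynomials of degrees |m| to d. -/
theorem azimSpan_le_sphSpan (d : ℕ) : azimSpan d ≤ sphSpan d := by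
  rw [azimSpan, Submodule.span_le]
  rintro _ ⟨m, p, h, rfl⟩
  rw [SetLike.mem_coe]
  have hp := mem_span_legendreDeriv m.natAbs (d - m.natAbs) p (by omega)
  have hd : m.natAbs ≤ d := by omega
  clear h
  induction hp using Submodule.span_induction with
  | mem p hp =>
    obtain ⟨l, hl, rfl⟩ := hp
    have hl1 := hl.1
    have hl2 := hl.2
    have := Submodule.smul_mem _ ((harmConst l m : ℂ)⁻¹) (sphHarmonic_mem (d := d) (l := l) (m := m)
      (by omega) (by rw [Int.abs_eq_natAbs]; omega))
    convert this using 1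
    ext x
    have hc : (harmConst l m : ℂ) ≠ 0 := by exact_mod_cast harmConst_ne_zero l m
    simp only [Pi.smul_apply, smul_eq_mul]
    rw [sphHarmonic_eq, mul_assoc, inv_mul_cancel_left₀ hc]
  | zero =>
    convert Submodule.zero_mem (sphSpan d) using 1
    ext x; simp
  | add p q _ _ hp hq =>
    convert Submodule.add_mem _ hp hq using 1
    ext x; simp; ring
  | smul c p _ hp =>
    convert Submodule.smul_mem _ (c : ℂ) hp using 1
    ext x; simp; ring

theorem zeta_mem_affineFun : zeta ∈ affineFun :=
  Submodule.add_mem _ (coord_mem_affineFun 0)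
    (Submodule.smul_mem _ Complex.I (coord_mem_affineFun 1))

theorem conj_zeta_mem_affineFun : (fun x => conj (zeta x)) ∈ affineFun := by
  convert Submodule.sub_mem _ (coord_mem_affineFun 0)
    (Submodule.smul_mem _ Complex.I (coord_mem_affineFun 1)) using 1
  ext x
  simp [zeta]
  ring

theorem affineFun_pow_mono {a b : ℕ} (h : a ≤ b) : affineFun ^ a ≤ affineFun ^ b :=
  pow_le_pow_right' (Submodule.one_le.2 one_mem_affineFun) h

theorem azim_mem_affineFun_pow (m : ℤ) : azim m ∈ affineFun ^ m.natAbs := by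
  by_cases h : 0 ≤ m
  · have := Submodule.pow_mem_pow affineFun zeta_mem_affineFun m.natAbs
    convert this using 1
    ext x; simp [azim, h]
  · have := Submodule.pow_mem_pow affineFun conj_zeta_mem_affineFun m.natAbs
    convert this using 1
    ext x; simp [azim, h]

theorem polynomial_mem_affineFun_pow (p : Polynomial ℝ) {d : ℕ} (hp : p.natDegree ≤ d) :
    (fun x : S2 => ((p.eval ((x : E3) 2) : ℝ) : ℂ)) ∈ affineFun ^ d := by
  have h : (fun x : S2 => ((p.eval ((x : E3) 2) : ℝ) : ℂ)) =
      ∑ i ∈ Finset.range (d + 1), ((p.coeff i : ℝ) : ℂ) •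
        (fun x : S2 => (((x : E3) 2 : ℝ) : ℂ)) ^ i := by
    ext x
    rw [Polynomial.eval_eq_sum_range' (Nat.lt_succ_of_le hp)]
    simp
  rw [h]
  refine Submodule.sum_mem _ fun i hi => Submodule.smul_mem _ _ ?_
  exact affineFun_pow_mono (Finset.mem_range_succ_iff.1 hi)
    (Submodule.pow_mem_pow _ (coord_mem_affineFun 2) i)

theorem sphHarmonic_mem_affineFun_pow {l d : ℕ} {m : ℤ} (hm : |m| ≤ l) (hl : l ≤ d) :
    sphHarmonic l m ∈ affineFun ^ d := by
  rw [Int.abs_eq_natAbs] at hm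
  have h1 := Submodule.mul_mem_mul (azim_mem_affineFun_pow m)
    (polynomial_mem_affineFun_pow _ (natDegree_legendreDeriv_le l m.natAbs))
  rw [← pow_add, show m.natAbs + (l - m.natAbs) = l by omega] at h1
  convert Submodule.smul_mem _ (harmConst l m : ℂ) (affineFun_pow_mono hl h1) using 1
  ext x
  simp [sphHarmonic_eq, mul_assoc]

theorem sphSpan_le_affineFun_pow (d : ℕ) : sphSpan d ≤ affineFun ^ d := by
  rw [sphSpan, Submodule.span_le]
  rintro _ ⟨l, m, hl, hm, rfl⟩
  exact sphHarmonic_mem_affineFun_pow hm hl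

/-- Harmonics of degree at most d span the restrictions of polynomials of degree at most d, that is
`affineFun ^ d`, and this description does not refer to an axis. -/
theorem comp_rotate_mem_sphSpan (g : E3 ≃ₗᵢ[ℝ] E3) {d : ℕ} {f : S2 → ℂ}
    (hf : f ∈ sphSpan d) : (fun x => f (rotate g x)) ∈ sphSpan d :=
  azimSpan_le_sphSpan d (affineFun_pow_le_azimSpan d
    (comp_rotate_mem_affineFun_pow g (sphSpan_le_affineFun_pow d hf)))

theorem continuous_of_mem_sphSpan {d : ℕ} {f : S2 → ℂ} (hf : f ∈ sphSpan d) : Continuous f := by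
  induction hf using Submodule.span_induction with
  | mem f hf => obtain ⟨l, m, -, -, rfl⟩ := hf; exact continuous_sphHarmonic l m
  | zero => exact continuous_zero
  | add f g _ _ hf hg => exact hf.add hg
  | smul c f _ hf => exact hf.const_smul c

/-! ### The addition theorem -/

/-- The reproducing kernel of the spherical harmonics of degree `l`. -/
def sphKernel (l : ℕ) (x y : S2) : ℂ :=
  ∑ m ∈ Finset.Icc (-(l : ℤ)) l, sphHarmonic l m x * conj (sphHarmonic l m y)

/-- The reproducing kernel of the spherical harmonics of degree at most `d`. -/
def sphKernelSum (d : ℕ) (x y : S2) : ℂ := ∑ l ∈ Finset.range (d + 1), sphKernel l x y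

theorem conj_sphKernelSum (d : ℕ) (x y : S2) :
    conj (sphKernelSum d x y) = sphKernelSum d y x := by
  simp only [sphKernelSum, sphKernel, map_sum, map_mul, Complex.conj_conj]
  exact Finset.sum_congr rfl fun l _ => Finset.sum_congr rfl fun m _ => mul_comm _ _

theorem sphKernelSum_mem (d : ℕ) (y : S2) : (fun x => sphKernelSum d x y) ∈ sphSpan d := by
  have : (fun x => sphKernelSum d x y) = ∑ l ∈ Finset.range (d + 1),
      ∑ m ∈ Finset.Icc (-(l : ℤ)) l, conj (sphHarmonic l m y) • sphHarmonic l m := by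
    ext x
    simp only [sphKernelSum, sphKernel, Finset.sum_apply, Pi.smul_apply, smul_eq_mul]
    exact Finset.sum_congr rfl fun l _ => Finset.sum_congr rfl fun m _ => mul_comm _ _
  rw [this]
  refine Submodule.sum_mem _ fun l hl => Submodule.sum_mem _ fun m hm =>
    Submodule.smul_mem _ _ (sphHarmonic_mem (Finset.mem_range_succ_iff.1 hl) ?_)
  rw [Finset.mem_Icc] at hm
  exact abs_le.2 hm

theorem expansion_of_mem_sphSpan {d : ℕ} {f : S2 → ℂ} (hf : f ∈ sphSpan d) (x : S2) :
    ∑ l ∈ Finset.range (d + 1), ∑ m ∈ Finset.Icc (-(l : ℤ)) l,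
      (∫ y, f y * conj (sphHarmonic l m y) ∂surf) * sphHarmonic l m x = f x := by
  induction hf using Submodule.span_induction with
  | mem f hf =>
    obtain ⟨l', m', hl, hm, rfl⟩ := hf
    have h : ∀ l : ℕ, ∀ m : ℤ, (∫ y, sphHarmonic l' m' y * conj (sphHarmonic l m y) ∂surf) *
        sphHarmonic l m x =
        if l' = l then (if m' = m then sphHarmonic l' m' x else 0) else 0 := by
      intro l m
      rw [integral_sphHarmonic_mul_conj hm]
      by_cases h1 : l' = l <;> by_cases h2 : m' = m <;> simp [h1, h2]
    simp only [h]
    have h2 : ∀ l : ℕ, ∑ m ∈ Finset.Icc (-(l : ℤ)) l,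
        (if l' = l then (if m' = m then sphHarmonic l' m' x else 0) else 0) =
        if l' = l then sphHarmonic l' m' x else 0 := by
      intro l
      split_ifs with h
      · subst h
        rw [Finset.sum_ite_eq, if_pos (Finset.mem_Icc.2 (abs_le.1 hm))]
      · simp
    simp only [h2]
    rw [Finset.sum_ite_eq, if_pos (Finset.mem_range_succ_iff.2 hl)]
  | zero => simp
  | add f g hf' hg' hf hg =>
    have hi : ∀ f ∈ sphSpan d, ∀ l m,
        Integrable (fun y => f y * conj (sphHarmonic l m y)) surf := fun f hf l m =>
      integrable_surf ((continuous_of_mem_sphSpan hf).mul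
        (Complex.continuous_conj.comp (continuous_sphHarmonic l m)))
    have h : ∀ (l : ℕ) (m : ℤ), (∫ y, (f + g) y * conj (sphHarmonic l m y) ∂surf) =
        (∫ y, f y * conj (sphHarmonic l m y) ∂surf) +
          ∫ y, g y * conj (sphHarmonic l m y) ∂surf := by
      intro l m
      rw [← integral_add (hi f hf' l m) (hi g hg' l m)]
      simp only [Pi.add_apply, add_mul]
    simp only [h]
    simp only [add_mul, Finset.sum_add_distrib, hf, hg, Pi.add_apply]
  | smul c f _ hf =>
    have h : ∀ (l : ℕ) (m : ℤ), (∫ y, (c • f) y * conj (sphHarmonic l m y) ∂surf) =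
        c * ∫ y, f y * conj (sphHarmonic l m y) ∂surf := by
      intro l m
      rw [← integral_const_mul]
      simp only [Pi.smul_apply, smul_eq_mul, mul_assoc]
    simp only [h]
    simp only [mul_assoc, ← Finset.mul_sum, hf, Pi.smul_apply, smul_eq_mul]

theorem integral_sphKernelSum_mul {d : ℕ} {f : S2 → ℂ} (hf : f ∈ sphSpan d) (x : S2) :
    ∫ y, sphKernelSum d x y * f y ∂surf = f x := by
  rw [← expansion_of_mem_sphSpan hf x]
  simp only [sphKernelSum, sphKernel, Finset.sum_mul]
  have hc := continuous_of_mem_sphSpan hf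
  have hi : ∀ (l : ℕ) (m : ℤ), Integrable
      (fun y => sphHarmonic l m x * conj (sphHarmonic l m y) * f y) surf := fun l m =>
    integrable_surf ((continuous_const.mul
      (Complex.continuous_conj.comp (continuous_sphHarmonic l m))).mul hc)
  rw [integral_finsetSum _ fun l _ => integrable_finsetSum _ fun m _ => hi l m]
  refine Finset.sum_congr rfl fun l _ => ?_
  rw [integral_finsetSum _ fun m _ => hi l m]
  refine Finset.sum_congr rfl fun m _ => ?_
  rw [← integral_mul_const]
  refine integral_congr_ae (Eventually.of_forall fun y => ?_)
  simp only; ring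

theorem rotate_symm_rotate (g : E3 ≃ₗᵢ[ℝ] E3) (x : S2) : rotate g.symm (rotate g x) = x := by
  ext1; simp [rotate]

/-- The reproducing kernel of an invariant space is invariant: K(gx, gy) = ∫ K(x, z) K(gz, gy) dz by
reproduction at x. After the substitution z ↦ g⁻¹z this is the conjugate of the reproduction formula
for K(y, x). -/
theorem sphKernelSum_rotate (d : ℕ) (g : E3 ≃ₗᵢ[ℝ] E3) (x y : S2) :
    sphKernelSum d (rotate g x) (rotate g y) = sphKernelSum d x y := by
  have h1 := integral_sphKernelSum_mul
    (comp_rotate_mem_sphSpan g (sphKernelSum_mem d (rotate g y))) x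
  have h2 := integral_sphKernelSum_mul
    (comp_rotate_mem_sphSpan g.symm (sphKernelSum_mem d x)) (rotate g y)
  have h3 := integral_rotate g (fun z => sphKernelSum d x (rotate g.symm z) *
    sphKernelSum d z (rotate g y))
  simp only [rotate_symm_rotate] at h2 h3
  rw [h1, ← conj_sphKernelSum d y x] at *
  rw [h3, ← h2, ← integral_conj]
  refine integral_congr_ae (Eventually.of_forall fun z => ?_)
  simp only [map_mul, conj_sphKernelSum]
  ring

/-- Invariance of a single degree is the difference of two consecutive cumulative kernels. -/
theorem sphKernel_rotate (l : ℕ) (g : E3 ≃ₗᵢ[ℝ] E3) (x y : S2) :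
    sphKernel l (rotate g x) (rotate g y) = sphKernel l x y := by
  rcases l with _ | l
  · simpa [sphKernelSum] using sphKernelSum_rotate 0 g x y
  · have h1 := sphKernelSum_rotate (l + 1) g x y
    have h2 := sphKernelSum_rotate l g x y
    rw [sphKernelSum, Finset.sum_range_succ, ← sphKernelSum, h2, sphKernelSum,
      sphKernelSum, Finset.sum_range_succ _ (l + 1)] at h1
    exact add_left_cancel h1

/-- The north pole. -/
def north : S2 := ⟨EuclideanSpace.single 2 1, by simp⟩

theorem dot_north (x : S2) : dot x north = (x : E3) 2 := by
  simp [dot, north, EuclideanSpace.inner_single_right]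

theorem dot_rotate (g : E3 ≃ₗᵢ[ℝ] E3) (x y : S2) : dot (rotate g x) (rotate g y) = dot x y :=
  g.inner_map_map _ _

theorem dot_comm (x y : S2) : dot x y = dot y x := real_inner_comm _ _

/-- Reflection in the plane bisecting x and y. Its determinant does not matter, because surface
measure and the harmonic kernels are invariant under all linear isometries. -/
theorem exists_rotate_eq (x y : S2) : ∃ g : E3 ≃ₗᵢ[ℝ] E3, rotate g x = y := by
  refine ⟨(ℝ ∙ ((x : E3) - y))ᗮ.reflection, ?_⟩
  ext1
  exact Submodule.reflection_sub (by simp)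

theorem sphKernel_north (l : ℕ) (x : S2) : sphKernel l x north =
    (((2 * l + 1) / (4 * Real.pi) * (legendre l).eval ((x : E3) 2) : ℝ) : ℂ) := by
  have h0 : ∀ m : ℤ, m ≠ 0 → sphHarmonic l m north = 0 := by
    intro m hm
    have hz : zeta north = 0 := by simp [zeta, north]
    rw [sphHarmonic_eq]
    have : azim m north = 0 := by
      unfold azim
      rw [hz]
      simp [hm]
    rw [this]; simp
  rw [sphKernel, Finset.sum_eq_single_of_mem 0 (by simp)
    (fun m _ hm => by rw [h0 m hm]; simp), sphHarmonic_eq, sphHarmonic_eq]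
  have hn : (north : E3) 2 = 1 := by simp [north]
  have hc := harmConst_sq (l := l) (m := 0)
  have hf : ((l.factorial : ℕ) : ℝ) ≠ 0 := by positivity
  simp only [Int.natAbs_zero, Nat.sub_zero, Nat.add_zero, div_self hf, mul_one] at hc
  rw [← hc, hn]
  simp [azim, legendreDeriv, legendre_eval_one]
  ring

/-- The addition theorem. Moving y to the north pole leaves only the term m = 0, since ζ vanishes
there. -/
theorem sphKernel_eq (l : ℕ) (x y : S2) : sphKernel l x y =
    (((2 * l + 1) / (4 * Real.pi) * (legendre l).eval (dot x y) : ℝ) : ℂ) := by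
  obtain ⟨g, hg⟩ := exists_rotate_eq y north
  rw [← sphKernel_rotate l g, hg, sphKernel_north, ← dot_north, ← hg, dot_rotate]

/-! ### The Funk–Hecke formula -/

theorem continuous_dot : Continuous fun p : S2 × S2 => dot p.1 p.2 := by
  unfold dot; fun_prop

theorem continuous_dot_right (x : S2) : Continuous fun y : S2 => dot x y :=
  continuous_dot.comp (Continuous.prodMk_right x)

theorem dot_mem_Icc (x y : S2) : dot x y ∈ Set.Icc (-1 : ℝ) 1 := by
  have h := abs_real_inner_le_norm (x : E3) y
  rw [norm_eq_of_mem_sphere, norm_eq_of_mem_sphere, mul_one] at h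
  exact abs_le.1 h

theorem integral_dot_eq {E : Type*} [NormedAddCommGroup E] [NormedSpace ℝ E] (f : ℝ → E)
    (x : S2) : ∫ y, f (dot x y) ∂surf = ∫ y : S2, f ((y : E3) 2) ∂surf := by
  obtain ⟨g, hg⟩ := exists_rotate_eq x north
  rw [← integral_rotate g fun y : S2 => f ((y : E3) 2)]
  refine integral_congr_ae (Eventually.of_forall fun y => ?_)
  simp only
  rw [← dot_north, ← hg, dot_rotate, dot_comm]

/-- The eigenvalue of the isotropic kernel operator with kernel `ρ` on the spherical harmonics of
degree `l`, see `funkHecke`. -/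
def fhCoeff (ρ : ℝ → ℝ) (l : ℕ) : ℝ :=
  ∫ y : S2, ρ ((y : E3) 2) * (legendre l).eval ((y : E3) 2) ∂surf

/-- The polynomial whose isotropic kernel is the reproducing kernel of degree `l`. -/
def kernelPoly (l : ℕ) : Polynomial ℝ := Polynomial.C ((2 * l + 1) / (4 * Real.pi)) * legendre l

theorem sphKernel_eq_kernelPoly (l : ℕ) (x y : S2) :
    sphKernel l x y = (((kernelPoly l).eval (dot x y) : ℝ) : ℂ) := by
  rw [sphKernel_eq, kernelPoly, Polynomial.eval_mul, Polynomial.eval_C]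

theorem natDegree_kernelPoly_le (l : ℕ) : (kernelPoly l).natDegree ≤ l :=
  (Polynomial.natDegree_C_mul_le _ _).trans (natDegree_legendreDeriv_le l 0)

theorem mem_span_kernelPoly {p : Polynomial ℝ} {d : ℕ} (hp : p.natDegree ≤ d) :
    p ∈ Submodule.span ℝ (kernelPoly '' Set.Icc 0 d) := by
  have h := mem_span_legendreDeriv 0 d p hp
  refine Submodule.span_le.2 ?_ h
  rintro _ ⟨l, hl, rfl⟩
  have hc : ((2 * l + 1) / (4 * Real.pi) : ℝ) ≠ 0 := by positivity
  have : legendreDeriv l 0 = ((2 * l + 1) / (4 * Real.pi) : ℝ)⁻¹ • kernelPoly l := by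
    rw [kernelPoly, Polynomial.smul_eq_C_mul, ← mul_assoc, ← Polynomial.C_mul,
      inv_mul_cancel₀ hc, Polynomial.C_1, one_mul, legendreDeriv, Function.iterate_zero, id]
  rw [SetLike.mem_coe]
  simp only [this]
  exact Submodule.smul_mem _ _ (Submodule.subset_span ⟨l, by simpa using hl, rfl⟩)

theorem fhCoeff_kernelPoly (k l : ℕ) :
    fhCoeff (fun u => (kernelPoly k).eval u) l = if k = l then 1 else 0 := by
  have h : ∀ u : ℝ, (kernelPoly k).eval u * (legendre l).eval u =
      (2 * k + 1) / (4 * Real.pi) * (legendre k * legendre l).eval u := by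
    intro u
    rw [kernelPoly, Polynomial.eval_mul, Polynomial.eval_C, Polynomial.eval_mul]; ring
  simp only [fhCoeff, h]
  rw [integral_const_mul, integral_surf_polynomial, ← polyInt_apply]
  split_ifs with hkl
  · subst hkl
    rw [polyInt_legendre_self]
    field_simp
    norm_num
  · rw [polyInt_legendre_of_ne hkl]; simp

/-- By the addition theorem this isotropic operator is the orthogonal projection onto degree k. -/
theorem isotropicOp_kernelPoly {k l : ℕ} {m : ℤ} (hm : |m| ≤ l) (x : S2) :
    isotropicOp (fun u => (kernelPoly k).eval u) (sphHarmonic l m) x =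
      if k = l then sphHarmonic l m x else 0 := by
  have hi : ∀ m', Integrable (fun y => sphHarmonic k m' x * conj (sphHarmonic k m' y) *
      sphHarmonic l m y) surf := fun m' => integrable_surf ((continuous_const.mul
      (Complex.continuous_conj.comp (continuous_sphHarmonic k m'))).mul
      (continuous_sphHarmonic l m))
  simp only [isotropicOp, Complex.real_smul, ← sphKernel_eq_kernelPoly]
  simp only [sphKernel, Finset.sum_mul]
  rw [integral_finsetSum _ fun m' _ => hi m']
  have h : ∀ m', ∫ y, sphHarmonic k m' x * conj (sphHarmonic k m' y) *
      sphHarmonic l m y ∂surf = if m' = m then (if k = l then sphHarmonic l m x else 0) else 0 := by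
    intro m'
    have e : ∀ y, sphHarmonic k m' x * conj (sphHarmonic k m' y) * sphHarmonic l m y =
      sphHarmonic k m' x * (sphHarmonic l m y * conj (sphHarmonic k m' y)) := fun y => by ring
    simp only [e]
    rw [integral_const_mul, integral_sphHarmonic_mul_conj hm]
    by_cases h1 : k = l
    · subst h1
      by_cases h2 : m' = m
      · simp [h2]
      · simp [h2, Ne.symm h2]
    · simp [h1, Ne.symm h1]
  simp only [h]
  rw [Finset.sum_ite_eq']
  by_cases h1 : k = l
  · subst h1; rw [if_pos (Finset.mem_Icc.2 (abs_le.1 hm))]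
  · simp [h1]

theorem continuous_isotropic_mul {E : Type*} [NormedAddCommGroup E] [NormedSpace ℝ E] {ρ : ℝ → ℝ}
    (hρ : Continuous ρ) {f : S2 → E} (hf : Continuous f) (x : S2) :
    Continuous fun y => ρ (dot x y) • f y :=
  (hρ.comp (continuous_dot_right x)).smul hf

theorem fhCoeff_add {ρ σ : ℝ → ℝ} (hρ : Continuous ρ) (hσ : Continuous σ) (l : ℕ) :
    fhCoeff (fun u => ρ u + σ u) l = fhCoeff ρ l + fhCoeff σ l := by
  have hi : ∀ ρ : ℝ → ℝ, Continuous ρ → Integrable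
      (fun y : S2 => ρ ((y : E3) 2) * (legendre l).eval ((y : E3) 2)) surf := fun ρ hρ =>
    integrable_surf ((hρ.comp (continuous_coord 2)).mul
      ((legendre l).continuous.comp (continuous_coord 2)))
  simp only [fhCoeff, add_mul]
  exact integral_add (hi ρ hρ) (hi σ hσ)

theorem fhCoeff_const_mul (c : ℝ) (ρ : ℝ → ℝ) (l : ℕ) :
    fhCoeff (fun u => c * ρ u) l = c * fhCoeff ρ l := by
  simp only [fhCoeff, mul_assoc, integral_const_mul]

theorem isotropicOp_add {E : Type*} [NormedAddCommGroup E] [NormedSpace ℝ E] {ρ σ : ℝ → ℝ}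
    (hρ : Continuous ρ) (hσ : Continuous σ) {f : S2 → E} (hf : Continuous f) (x : S2) :
    isotropicOp (fun u => ρ u + σ u) f x = isotropicOp ρ f x + isotropicOp σ f x := by
  simp only [isotropicOp, add_smul]
  exact integral_add (integrable_surf (continuous_isotropic_mul hρ hf x))
    (integrable_surf (continuous_isotropic_mul hσ hf x))

theorem isotropicOp_const_mul {E : Type*} [NormedAddCommGroup E] [NormedSpace ℝ E] (c : ℝ)
    (ρ : ℝ → ℝ) (f : S2 → E) (x : S2) :
    isotropicOp (fun u => c * ρ u) f x = c • isotropicOp ρ f x := by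
  simp only [isotropicOp, mul_smul, integral_smul]

/-- Both sides are linear in p, so it suffices to test the projection kernels, which span the
polynomials. -/
theorem funkHecke_polynomial (p : Polynomial ℝ) {l : ℕ} {m : ℤ} (hm : |m| ≤ l) (x : S2) :
    isotropicOp (fun u => p.eval u) (sphHarmonic l m) x =
      (fhCoeff (fun u => p.eval u) l : ℂ) * sphHarmonic l m x := by
  have hp := mem_span_kernelPoly (le_refl p.natDegree)
  generalize p.natDegree = d at hp
  induction hp using Submodule.span_induction with
  | mem p hp =>
    obtain ⟨k, -, rfl⟩ := hp
    rw [isotropicOp_kernelPoly hm, fhCoeff_kernelPoly]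
    split_ifs <;> simp
  | zero => simp [isotropicOp, fhCoeff]
  | add p q _ _ hp hq =>
    simp only [Polynomial.eval_add]
    rw [isotropicOp_add p.continuous q.continuous (continuous_sphHarmonic l m),
      fhCoeff_add p.continuous q.continuous, hp, hq]
    push_cast; ring
  | smul c p _ hp =>
    simp only [Polynomial.eval_smul, smul_eq_mul]
    rw [isotropicOp_const_mul, fhCoeff_const_mul, hp, Complex.real_smul]
    push_cast; ring

/-- Two continuous linear functionals of the kernel that agree on polynomials agree. -/
theorem eq_of_polynomial_approx {ρ : ℝ → ℝ} (hρ : Continuous ρ) {E : Type*}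
    [NormedAddCommGroup E] {F : (ℝ → ℝ) → E} {C : ℝ} (hC : ∀ (p : Polynomial ℝ) (ε : ℝ),
      (∀ u ∈ Set.Icc (-1 : ℝ) 1, |p.eval u - ρ u| ≤ ε) → ‖F ρ - F (fun u => p.eval u)‖ ≤ C * ε)
    (h : ∀ p : Polynomial ℝ, F (fun u => p.eval u) = 0) : F ρ = 0 := by
  have hC' : ∀ ε > 0, ‖F ρ‖ ≤ C * ε := by
    intro ε hε
    obtain ⟨p, hp⟩ := exists_polynomial_near_of_continuousOn (-1) 1 ρ hρ.continuousOn ε hε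
    have := hC p ε fun u hu => (hp u hu).le
    rwa [h p, sub_zero] at this
  have hlim : Tendsto (fun ε : ℝ => C * ε) (𝓝[>] 0) (𝓝 0) := by
    have : Tendsto (fun ε : ℝ => C * ε) (𝓝 0) (𝓝 (C * 0)) := tendsto_id.const_mul C
    rw [mul_zero] at this
    exact this.mono_left nhdsWithin_le_nhds
  have := ge_of_tendsto hlim (by filter_upwards [self_mem_nhdsWithin] with ε hε using hC' ε hε)
  exact norm_le_zero_iff.1 this

theorem norm_isotropic_sub_le {ρ σ : ℝ → ℝ} (hρ : Continuous ρ) (hσ : Continuous σ)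
    {E : Type*} [NormedAddCommGroup E] [NormedSpace ℝ E] {f : S2 → E}
    (hf : Integrable f surf) (x : S2) {ε : ℝ}
    (h : ∀ u ∈ Set.Icc (-1 : ℝ) 1, |σ u - ρ u| ≤ ε) :
    ‖isotropicOp ρ f x - isotropicOp σ f x‖ ≤ ε * ∫ y, ‖f y‖ ∂surf := by
  have hi : ∀ ρ : ℝ → ℝ, Continuous ρ → Integrable (fun y => ρ (dot x y) • f y) surf := by
    intro ρ hρ
    obtain ⟨M, hM⟩ := isCompact_Icc.exists_bound_of_continuousOn
      (hρ.continuousOn (s := Set.Icc (-1 : ℝ) 1))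
    exact hf.bdd_smul M ((hρ.comp (continuous_dot_right x)).aestronglyMeasurable)
      (Eventually.of_forall fun y => hM _ (dot_mem_Icc x y))
  rw [isotropicOp, isotropicOp, ← integral_sub (hi ρ hρ) (hi σ hσ), ← integral_const_mul]
  refine norm_integral_le_of_norm_le (hf.norm.const_mul ε) (Eventually.of_forall fun y => ?_)
  rw [← sub_smul, norm_smul, Real.norm_eq_abs, abs_sub_comm]
  gcongr
  exact h _ (dot_mem_Icc x y)

theorem fhCoeff_eq_isotropicOp (ρ : ℝ → ℝ) (l : ℕ) :
    fhCoeff ρ l = isotropicOp ρ (fun y : S2 => (legendre l).eval ((y : E3) 2)) north := by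
  simp only [fhCoeff, isotropicOp, smul_eq_mul, dot_comm north, dot_north]

/-- The Funk–Hecke formula. -/
theorem funkHecke {ρ : ℝ → ℝ} (hρ : Continuous ρ) {l : ℕ} {m : ℤ} (hm : |m| ≤ l) (x : S2) :
    isotropicOp ρ (sphHarmonic l m) x = (fhCoeff ρ l : ℂ) * sphHarmonic l m x := by
  rw [← sub_eq_zero]
  have hl : Continuous fun y : S2 => (legendre l).eval ((y : E3) 2) :=
    (legendre l).continuous.comp (continuous_coord 2)
  -- Both sides are Lipschitz in the kernel for the uniform norm on [-1, 1]; the constant C adds the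
  -- two Lipschitz constants.
  refine eq_of_polynomial_approx hρ
    (F := fun ρ => isotropicOp ρ (sphHarmonic l m) x - (fhCoeff ρ l : ℂ) * sphHarmonic l m x)
    (C := ∫ y, ‖sphHarmonic l m y‖ ∂surf + (∫ y : S2, ‖(legendre l).eval ((y : E3) 2)‖ ∂surf) *
      ‖sphHarmonic l m x‖) (fun p ε hp => ?_)
    (fun p => by rw [funkHecke_polynomial p hm, sub_self])
  have h1 := norm_isotropic_sub_le hρ p.continuous
    (integrable_surf (continuous_sphHarmonic l m)) x hp
  have h2 := norm_isotropic_sub_le hρ p.continuous (integrable_surf hl) north hp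
  rw [← fhCoeff_eq_isotropicOp, ← fhCoeff_eq_isotropicOp] at h2
  rw [sub_sub_sub_comm, ← sub_mul, ← Complex.ofReal_sub]
  refine (norm_sub_le _ _).trans ?_
  rw [norm_mul, Complex.norm_real, add_mul, mul_right_comm]
  gcongr
  · rwa [mul_comm]
  · rwa [mul_comm]

/-! ### The spherical harmonics form a Hilbert basis -/

theorem memLp_of_continuous {f : S2 → ℂ} (hf : Continuous f) : MemLp f 2 surf :=
  hf.memLp_of_hasCompactSupport (HasCompactSupport.of_compactSpace f)

/-- The indices of the spherical harmonics. -/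
abbrev HarmIdx : Type := {p : ℕ × ℤ // |p.2| ≤ p.1}

/-- The spherical harmonics as elements of `L²(S²; ℂ)`. -/
def harmL2 (i : HarmIdx) : L2S :=
  (memLp_of_continuous (continuous_sphHarmonic i.1.1 i.1.2)).toLp _

theorem coeFn_harmL2 (i : HarmIdx) : harmL2 i =ᵐ[surf] sphHarmonic i.1.1 i.1.2 :=
  MemLp.coeFn_toLp _

theorem orthonormal_harmL2 : Orthonormal ℂ harmL2 := by
  rw [orthonormal_iff_ite]
  intro i j
  rw [L2.inner_def]
  have h : ∫ a, inner ℂ (harmL2 i a) (harmL2 j a) ∂surf =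
      ∫ a, sphHarmonic j.1.1 j.1.2 a * conj (sphHarmonic i.1.1 i.1.2 a) ∂surf := by
    refine integral_congr_ae ?_
    filter_upwards [coeFn_harmL2 i, coeFn_harmL2 j] with a h1 h2
    rw [h1, h2, RCLike.inner_apply]
  rw [h, integral_sphHarmonic_mul_conj j.2]
  have e : (j.1.1 = i.1.1 ∧ j.1.2 = i.1.2) ↔ i = j := by
    rw [Subtype.ext_iff, Prod.ext_iff, eq_comm, @eq_comm _ j.1.2]
  simp only [e]

/-- For a polynomial kernel the addition theorem expands the integral into finitely many harmonic
coefficients of f, all zero; uniform approximation handles continuous kernels. -/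
theorem integral_isotropic_eq_zero_of_orthogonal {f : S2 → ℂ} (hf : Integrable f surf)
    (h : ∀ (l : ℕ) (m : ℤ), |m| ≤ l → ∫ y, conj (sphHarmonic l m y) * f y ∂surf = 0)
    {ρ : ℝ → ℝ} (hρ : Continuous ρ) (x : S2) : isotropicOp ρ f x = 0 := by
  refine eq_of_polynomial_approx hρ (F := fun ρ => isotropicOp ρ f x) (C := ∫ y, ‖f y‖ ∂surf)
    (fun p ε hp => by
      rw [mul_comm]; exact norm_isotropic_sub_le hρ p.continuous hf x hp) fun p => ?_
  have hc : ∀ p : Polynomial ℝ, Integrable (fun y => p.eval (dot x y) • f y) surf := by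
    intro p
    obtain ⟨M, hM⟩ := isCompact_Icc.exists_bound_of_continuousOn
      (p.continuous.continuousOn (s := Set.Icc (-1 : ℝ) 1))
    exact hf.bdd_smul M ((p.continuous.comp (continuous_dot_right x)).aestronglyMeasurable)
      (Eventually.of_forall fun y => hM _ (dot_mem_Icc x y))
  have hY : ∀ (l : ℕ) (m : ℤ), Integrable (fun y => conj (sphHarmonic l m y) * f y) surf := by
    intro l m
    have hcY := Complex.continuous_conj.comp (continuous_sphHarmonic l m)
    obtain ⟨M, hM⟩ := isCompact_univ.exists_bound_of_continuousOn hcY.continuousOn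
    exact hf.bdd_mul (c := M) hcY.aestronglyMeasurable
      (Eventually.of_forall fun y => hM y (Set.mem_univ y))
  have hp := mem_span_kernelPoly (le_refl p.natDegree)
  generalize p.natDegree = d at hp
  induction hp using Submodule.span_induction with
  | mem p hp =>
    obtain ⟨k, -, rfl⟩ := hp
    simp only [isotropicOp, Complex.real_smul, ← sphKernel_eq_kernelPoly]
    simp only [sphKernel, Finset.sum_mul, mul_assoc]
    rw [integral_finsetSum _ fun m' _ => (hY k m').const_mul _]
    refine Finset.sum_eq_zero fun m hm => ?_
    rw [integral_const_mul, h k m (abs_le.2 (Finset.mem_Icc.1 hm)), mul_zero]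
  | zero => simp [isotropicOp]
  | add p q _ _ hp hq =>
    simp only [isotropicOp, Polynomial.eval_add, add_smul] at hp hq ⊢
    rw [integral_add (hc p) (hc q), hp, hq, add_zero]
  | smul c p _ hp =>
    simp only [Polynomial.eval_smul, smul_eq_mul]
    rw [isotropicOp_const_mul, hp, smul_zero]

/-- The function `y ↦ exp ⟨v, y⟩` on the sphere. -/
def expFun : Multiplicative E3 →* C(S2, ℝ) where
  toFun v := ⟨fun y => Real.exp (inner ℝ v.toAdd (y : E3)), by fun_prop⟩
  map_one' := by ext y; simp
  map_mul' v w := by ext y; simp [inner_add_left, Real.exp_add]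

theorem separatesPoints_expFun :
    (Algebra.adjoin ℝ (Set.range expFun)).SeparatesPoints := by
  intro x y hxy
  refine ⟨_, ⟨expFun (Multiplicative.ofAdd ((x : E3) - y)),
    Algebra.subset_adjoin ⟨_, rfl⟩, rfl⟩, fun h => hxy ?_⟩
  have h2 := Real.exp_injective h
  change inner ℝ ((x : E3) - y) (x : E3) = inner ℝ ((x : E3) - y) (y : E3) at h2
  rw [← sub_eq_zero, ← inner_sub_right] at h2
  exact Subtype.ext (sub_eq_zero.1 (inner_self_eq_zero.1 h2))

/-- The exponentials y ↦ exp ⟨v, y⟩ are zonal about the axis of v, so they integrate to zero against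
f. They are closed under products, so their span is an algebra; it separates points, and
Stone–Weierstrass applies. -/
theorem integral_continuous_mul_eq_zero_of_orthogonal {f : S2 → ℂ} (hf : Integrable f surf)
    (h : ∀ (l : ℕ) (m : ℤ), |m| ≤ l → ∫ y, conj (sphHarmonic l m y) * f y ∂surf = 0)
    (g : C(S2, ℝ)) : ∫ y, g y • f y ∂surf = 0 := by
  have hi : ∀ g : C(S2, ℝ), Integrable (fun y => g y • f y) surf := fun g =>
    hf.bdd_smul ‖g‖ g.continuous.aestronglyMeasurable
      (Eventually.of_forall fun y => g.norm_coe_le_norm y)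
  have hA : ∀ g ∈ Algebra.adjoin ℝ (Set.range expFun), ∫ y, g y • f y ∂surf = 0 := by
    intro g hg
    have h1 : Submonoid.closure (Set.range expFun) = MonoidHom.mrange expFun := by
      rw [← MonoidHom.coe_mrange, Submonoid.closure_eq]
    rw [← Subalgebra.mem_toSubmodule, Algebra.adjoin_eq_span, h1] at hg
    induction hg using Submodule.span_induction with
    | mem g hg =>
      obtain ⟨v, rfl⟩ := hg
      change ∫ y : S2, Real.exp (inner ℝ v.toAdd (y : E3)) • f y ∂surf = 0
      generalize v.toAdd = w
      -- Writing the exponent vector as a multiple of a unit vector exhibits the exponential as an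
      -- isotropic kernel; for the zero vector any axis will do.
      obtain ⟨r, x, rfl⟩ : ∃ (r : ℝ) (x : S2), w = r • (x : E3) := by
        by_cases hw : w = 0
        · exact ⟨0, north, by simp [hw]⟩
        · exact ⟨‖w‖, ⟨‖w‖⁻¹ • w, by simp [norm_smul, hw]⟩, by simp [smul_smul, hw]⟩
      simp only [inner_smul_left]
      exact integral_isotropic_eq_zero_of_orthogonal hf h
        (ρ := fun u => Real.exp (r * u)) (by fun_prop) x
    | zero => simp
    | add g₁ g₂ _ _ h₁ h₂ =>
      simp only [ContinuousMap.add_apply, add_smul]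
      rw [integral_add (hi g₁) (hi g₂), h₁, h₂, add_zero]
    | smul c g _ hg =>
      simp only [ContinuousMap.smul_apply, smul_eq_mul, mul_smul, integral_smul, hg, smul_zero]
  have hC' : ∀ ε > 0, ‖∫ y, g y • f y ∂surf‖ ≤ ε * ∫ y, ‖f y‖ ∂surf := by
    intro ε hε
    obtain ⟨g', hg'⟩ := ContinuousMap.exists_mem_subalgebra_near_continuousMap_of_separatesPoints
      _ separatesPoints_expFun g ε hε
    rw [← sub_zero (∫ y, g y • f y ∂surf), ← hA g' g'.2, ← integral_sub (hi g) (hi g'),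
      ← integral_const_mul]
    refine norm_integral_le_of_norm_le (hf.norm.const_mul ε) (Eventually.of_forall fun y => ?_)
    rw [← sub_smul, norm_smul]
    gcongr
    have := ((g' : C(S2, ℝ)) - g).norm_coe_le_norm y
    rw [← norm_neg, neg_sub]
    exact this.trans hg'.le
  have hlim : Tendsto (fun ε : ℝ => ε * ∫ y, ‖f y‖ ∂surf) (𝓝[>] 0) (𝓝 0) := by
    have : Tendsto (fun ε : ℝ => ε * ∫ y, ‖f y‖ ∂surf) (𝓝 0) (𝓝 (0 * ∫ y, ‖f y‖ ∂surf)) :=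
      tendsto_id.mul_const _
    rw [zero_mul] at this
    exact this.mono_left nhdsWithin_le_nhds
  have := ge_of_tendsto hlim (by filter_upwards [self_mem_nhdsWithin] with ε hε using hC' ε hε)
  exact norm_le_zero_iff.1 this

theorem orthogonal_span_harmL2 : (Submodule.span ℂ (Set.range harmL2))ᗮ = ⊥ := by
  rw [Submodule.eq_bot_iff]
  intro f hf
  have hfi : Integrable f surf := (Lp.memLp f).integrable (by norm_num)
  have h : ∀ (l : ℕ) (m : ℤ), |m| ≤ l → ∫ y, conj (sphHarmonic l m y) * f y ∂surf = 0 := by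
    intro l m hm
    have := (Submodule.mem_orthogonal _ _).1 hf (harmL2 ⟨(l, m), hm⟩)
      (Submodule.subset_span ⟨_, rfl⟩)
    rw [L2.inner_def] at this
    rw [← this]
    refine integral_congr_ae ?_
    filter_upwards [coeFn_harmL2 ⟨(l, m), hm⟩] with a h1
    rw [h1, RCLike.inner_apply, mul_comm]
  refine (ContinuousMap.toLp_denseRange (p := 2) ℂ ℂ (μ := surf)
    (by norm_num)).eq_zero_of_inner_right (𝕜 := ℂ) ?_
  intro g
  rw [L2.inner_def]
  have hre := integral_continuous_mul_eq_zero_of_orthogonal hfi h ⟨fun y => (g y).re, by fun_prop⟩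
  have him := integral_continuous_mul_eq_zero_of_orthogonal hfi h ⟨fun y => (g y).im, by fun_prop⟩
  have hi : ∀ g : C(S2, ℝ), Integrable (fun y => g y • f y) surf := fun g =>
    hfi.bdd_smul ‖g‖ g.continuous.aestronglyMeasurable
      (Eventually.of_forall fun y => g.norm_coe_le_norm y)
  have e : ∫ a, inner ℂ (ContinuousMap.toLp 2 surf ℂ g a) (f a) ∂surf =
      ∫ a, ((g a).re • f a - Complex.I * ((g a).im • f a)) ∂surf := by
    refine integral_congr_ae ?_
    filter_upwards [ContinuousMap.coeFn_toLp (p := 2) (𝕜 := ℂ) surf g] with a h1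
    rw [h1, RCLike.inner_apply, Complex.real_smul, Complex.real_smul]
    conv_lhs => rw [← Complex.re_add_im (g a)]
    simp only [map_add, map_mul, Complex.conj_ofReal, Complex.conj_I]
    ring
  have hi1 := hi ⟨fun y => (g y).re, by fun_prop⟩
  have hi2 := hi ⟨fun y => (g y).im, by fun_prop⟩
  simp only [ContinuousMap.coe_mk] at hre him hi1 hi2
  rw [e, integral_sub hi1 (hi2.const_mul _), integral_const_mul]
  rw [hre, him]; simp

/-- The Hilbert basis of the spherical harmonics. -/
def sphBasis : HilbertBasis HarmIdx ℂ L2S :=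
  HilbertBasis.mkOfOrthogonalEqBot orthonormal_harmL2 orthogonal_span_harmL2

theorem sphBasis_apply (i : HarmIdx) : sphBasis i = harmL2 i := by
  rw [sphBasis, HilbertBasis.coe_mkOfOrthogonalEqBot]

/-! ### Operators that are diagonal in a Hilbert basis -/

section Diagonal

theorem hilbertBasis_ext {H : Type*} [NormedAddCommGroup H] [InnerProductSpace ℂ H]
    {ι : Type*} (b : HilbertBasis ι ℂ H) {x y : H} (h : ∀ i, inner ℂ (b i) x = inner ℂ (b i) y) :
    x = y := by
  apply b.repr.injective
  ext i
  rw [b.repr_apply_apply, b.repr_apply_apply, h]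

variable {H : Type*} [NormedAddCommGroup H] [InnerProductSpace ℂ H] [CompleteSpace H]
  {ι : Type*} (b : HilbertBasis ι ℂ H) {A : H →L[ℂ] H} {d : ι → ℂ}

/-- The adjoint is diagonal in the same basis with conjugate entries. -/
theorem inner_diagonal (h : ∀ i, A (b i) = d i • b i) (i : ι) (x : H) :
    inner ℂ (b i) (A x) = d i * inner ℂ (b i) x := by
  have h1 : ContinuousLinearMap.adjoint A (b i) = conj (d i) • b i := by
    refine hilbertBasis_ext b fun j => ?_
    rw [ContinuousLinearMap.adjoint_inner_right, h, inner_smul_left, inner_smul_right]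
    by_cases hij : j = i
    · rw [hij]
    · rw [b.orthonormal.2 hij]; simp
  rw [← ContinuousLinearMap.adjoint_inner_left, h1, inner_smul_left, Complex.conj_conj]

theorem opNorm_diagonal_le (h : ∀ i, A (b i) = d i • b i) {M : ℝ} (hM : 0 ≤ M)
    (hd : ∀ i, ‖d i‖ ≤ M) : ‖A‖ ≤ M := by
  refine A.opNorm_le_bound hM fun x => ?_
  have h1 : ENNReal.ofReal (‖A x‖ ^ 2) ≤ ENNReal.ofReal ((M * ‖x‖) ^ 2) := by
    rw [mul_pow, ENNReal.ofReal_mul (sq_nonneg M), ofReal_norm_sq_eq_tsum b,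
      ofReal_norm_sq_eq_tsum b, ← ENNReal.tsum_mul_left]
    refine ENNReal.tsum_le_tsum fun i => ?_
    rw [← ENNReal.ofReal_mul (sq_nonneg M), inner_diagonal b h, norm_mul, mul_pow]
    gcongr
    exact hd i
  rw [ENNReal.ofReal_le_ofReal_iff (by positivity)] at h1
  exact (sq_le_sq₀ (norm_nonneg _) (by positivity)).1 h1

/-- With w = Sv - cv one has Sw = -cw, and positivity of S forces w = 0 when c > 0; for c = 0, ‖Sv‖²
= ⟨v, S²v⟩ = 0. Thus eigenvectors of A*A are eigenvectors of |A|. -/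
theorem eq_smul_of_sq_eq_smul {S : H →L[ℂ] H} (hS : 0 ≤ S) {v : H} {c : ℝ} (hc : 0 ≤ c)
    (h : S (S v) = ((c ^ 2 : ℝ) : ℂ) • v) : S v = (c : ℂ) • v := by
  have hsym : ∀ x y : H, inner ℂ (S x) y = inner ℂ x (S y) := fun x y =>
    (ContinuousLinearMap.isSelfAdjoint_iff_isSymmetric.1 hS.isSelfAdjoint) x y
  rcases hc.eq_or_lt with rfl | hc
  · have h2 : inner ℂ (S v) (S v) = (0 : ℂ) := by
      rw [hsym, h]; simp
    rw [inner_self_eq_zero.1 h2]; simp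
  · set w := S v - (c : ℂ) • v with hw
    have h1 : S w = -((c : ℂ) • w) := by
      rw [hw, map_sub, map_smul, h, smul_sub, smul_smul]
      push_cast
      rw [sq]; abel
    have h2 := (ContinuousLinearMap.nonneg_iff_isPositive S).1 hS |>.2 w
    rw [ContinuousLinearMap.reApplyInnerSelf_apply, h1, inner_neg_left, inner_smul_left,
      Complex.conj_ofReal, inner_self_eq_norm_sq_to_K] at h2
    have h3 : (0 : ℝ) ≤ -(c * ‖w‖ ^ 2) := by
      have e : (-((c : ℂ) * ((‖w‖ : ℝ) : ℂ) ^ 2)) = ((-(c * ‖w‖ ^ 2) : ℝ) : ℂ) := by push_cast; ring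
      have h4 : (0 : ℝ) ≤ (-((c : ℂ) * ((‖w‖ : ℝ) : ℂ) ^ 2)).re := h2
      rwa [e, Complex.ofReal_re] at h4
    have h4 : ‖w‖ ^ 2 = 0 := by
      have : 0 ≤ ‖w‖ ^ 2 := sq_nonneg _
      nlinarith
    have h5 : w = 0 := by simpa using h4
    exact sub_eq_zero.1 (hw ▸ h5)

theorem traceNorm_diagonal (h : ∀ i, A (b i) = d i • b i) :
    traceNorm A = ∑' i, ENNReal.ofReal ‖d i‖ := by
  rw [traceNorm_eq A b]
  refine tsum_congr fun i => ?_
  have h1 : CFC.abs A (CFC.abs A (b i)) = ((‖d i‖ ^ 2 : ℝ) : ℂ) • b i := by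
    have h2 : CFC.abs A (CFC.abs A (b i)) = (CFC.abs A * CFC.abs A) (b i) := rfl
    rw [h2, CFC.abs_mul_abs]
    change ContinuousLinearMap.adjoint A (A (b i)) = _
    refine hilbertBasis_ext b fun j => ?_
    rw [ContinuousLinearMap.adjoint_inner_right, h, h, inner_smul_left, inner_smul_right,
      inner_smul_right]
    by_cases hij : j = i
    · subst hij
      rw [← mul_assoc, mul_comm (conj (d j)), Complex.mul_conj, Complex.normSq_eq_norm_sq]
    · rw [b.orthonormal.2 hij]; simp
  rw [eq_smul_of_sq_eq_smul (CFC.abs_nonneg A) (norm_nonneg _) h1, inner_smul_right,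
    inner_self_eq_norm_sq_to_K, b.orthonormal.1]
  simp

end Diagonal

/-! ### Spectral factorisation of positive cosine polynomials -/

section Factor
open Polynomial

/-- The solutions r ± s, with s² = r² - 1, have product 1, so one of them lies inside the unit disc
unless both are on the circle. In that case they are conjugate and r is their common real part, a
point of [-1, 1]. -/
theorem exists_joukowski {r : ℂ} (hr : ∀ u ∈ Set.Icc (-1 : ℝ) 1, (u : ℂ) ≠ r) :
    ∃ w : ℂ, w ≠ 0 ∧ ‖w‖ < 1 ∧ w + w⁻¹ = 2 * r := by
  obtain ⟨s, hs⟩ := IsAlgClosed.exists_pow_nat_eq (r ^ 2 - 1) two_pos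
  have hprod : (r + s) * (r - s) = 1 := by linear_combination -hs
  have h1 : r + s ≠ 0 := left_ne_zero_of_mul_eq_one hprod
  have h2 : r - s ≠ 0 := right_ne_zero_of_mul_eq_one hprod
  have h3 : (r + s)⁻¹ = r - s := inv_eq_of_mul_eq_one_right hprod
  have h4 : (r - s)⁻¹ = r + s := inv_eq_of_mul_eq_one_left hprod
  rcases lt_trichotomy ‖r + s‖ 1 with h | h | h
  · exact ⟨r + s, h1, h, by rw [h3]; ring⟩
  · exfalso
    have h5 : conj (r + s) = r - s := by
      rw [← h3, Complex.inv_def, Complex.normSq_eq_norm_sq, h]; simp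
    refine hr (r + s).re ⟨?_, ?_⟩ ?_
    · have := Complex.abs_re_le_norm (r + s)
      rw [h] at this; exact (abs_le.1 this).1
    · have := Complex.abs_re_le_norm (r + s)
      rw [h] at this; exact (abs_le.1 this).2
    · have h6 := Complex.add_conj (r + s)
      rw [h5] at h6
      push_cast at h6
      linear_combination (-1 / 2 : ℂ) * h6
  · refine ⟨r - s, h2, ?_, by rw [h4]; ring⟩
    have h5 : ‖r + s‖ * ‖r - s‖ = 1 := by rw [← norm_mul, hprod, norm_one]
    have := norm_nonneg (r - s)
    nlinarith

/-- The other possibility is w w' = 1, impossible inside the disc. Uniqueness makes the choice of w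
commute with conjugation, which is what gives the spectral factor real coefficients. -/
theorem joukowski_unique {w w' : ℂ} (h0 : w ≠ 0) (h0' : w' ≠ 0) (h : ‖w‖ < 1) (h' : ‖w'‖ < 1)
    (he : w + w⁻¹ = w' + w'⁻¹) : w = w' := by
  have h1 : (w - w') * (w * w' - 1) = 0 := by
    field_simp at he
    linear_combination he
  rcases mul_eq_zero.1 h1 with h2 | h2
  · exact sub_eq_zero.1 h2
  · exfalso
    have h3 : ‖w‖ * ‖w'‖ = 1 := by rw [← norm_mul, sub_eq_zero.1 h2, norm_one]
    have := norm_nonneg w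
    have := norm_nonneg w'
    nlinarith

theorem conj_aeval (p : ℝ[X]) (z : ℂ) : conj (aeval z p) = aeval (conj z) p := by
  have := aeval_algHom_apply (Complex.conjAe : ℂ →ₐ[ℝ] ℂ) z p
  exact this.symm

theorem exists_real_of_map_conj_eq {q : ℂ[X]} (h : q.map (starRingEnd ℂ) = q) :
    ∃ p : ℝ[X], p.map Complex.ofRealHom = q := by
  have : q ∈ Polynomial.lifts Complex.ofRealHom := by
    rw [lifts_iff_coeff_lifts]
    intro n
    have h1 : conj (q.coeff n) = q.coeff n := by
      conv_rhs => rw [← h]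
      rw [coeff_map]
    obtain ⟨r, hr⟩ := Complex.conj_eq_iff_real.1 h1
    exact ⟨r, hr.symm⟩
  exact (mem_lifts _).1 this

/-- Fejér–Riesz. With e = e^{-iλ} and w + w⁻¹ = 2r, each linear factor of g splits as cos λ - r =
-(2w)⁻¹ (1 - w e)(1 - w ē). Taking |w| < 1 for every root puts the zeros 1/w of Θ outside the closed
disc. -/
theorem exists_spectral_factor (g : ℝ[X]) (hg : ∀ u ∈ Set.Icc (-1 : ℝ) 1, 0 < g.eval u) :
    ∃ (A : ℝ) (Θ : ℝ[X]), 0 < A ∧ Θ.coeff 0 = 1 ∧ (∀ z : ℂ, ‖z‖ ≤ 1 → aeval z Θ ≠ 0) ∧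
      ∀ lam : ℝ, g.eval (Real.cos lam) =
        A * ‖aeval (Complex.exp (-Complex.I * lam)) Θ‖ ^ 2 := by
  set G : ℂ[X] := g.map Complex.ofRealHom with hG
  have hg0 : g ≠ 0 := by
    rintro rfl
    have := hg 1 (by norm_num)
    simp at this
  have hG0 : G ≠ 0 := (Polynomial.map_ne_zero_iff Complex.ofRealHom.injective).2 hg0
  have hsplit : G.Splits := IsAlgClosed.splits G
  have hroot : ∀ r ∈ G.roots, ∀ u ∈ Set.Icc (-1 : ℝ) 1, (u : ℂ) ≠ r := by
    rintro r hr u hu rfl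
    have h1 := (mem_roots hG0).1 hr
    rw [IsRoot, hG, eval_map, ← Complex.ofRealHom_eq_coe, eval₂_at_apply] at h1
    have h2 : g.eval u = 0 := by simpa using h1
    exact (hg u hu).ne' h2
  have hex : ∀ r : ℂ, ∃ w : ℂ, r ∈ G.roots → w ≠ 0 ∧ ‖w‖ < 1 ∧ w + w⁻¹ = 2 * r := by
    intro r
    by_cases hr : r ∈ G.roots
    · obtain ⟨w, hw⟩ := exists_joukowski (hroot r hr)
      exact ⟨w, fun _ => hw⟩
    · exact ⟨0, fun h => absurd h hr⟩
  choose w hw using hex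
  -- The coefficients of g are real, so its roots, counted with multiplicity, are stable under
  -- conjugation; hence so are the coefficients of the product below.
  have hconjroots : G.roots.map (starRingEnd ℂ) = G.roots := by
    have h1 : G.map (starRingEnd ℂ) = G := by
      rw [hG, Polynomial.map_map]
      congr 1
      ext x; simp
    rw [← hsplit.roots_map, h1]
  have hwconj : ∀ r ∈ G.roots, conj (w r) = w (conj r) := by
    intro r hr
    have hr' : conj r ∈ G.roots := by
      rw [← hconjroots]; exact Multiset.mem_map_of_mem _ hr
    obtain ⟨a1, a2, a3⟩ := hw r hr
    obtain ⟨b1, b2, b3⟩ := hw _ hr'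
    refine joukowski_unique (by simpa using a1) b1 (by simpa using a2) b2 ?_
    rw [b3, ← map_inv₀, ← map_add, a3, map_mul, map_ofNat]
  set Q : ℂ[X] := (G.roots.map fun r => 1 - C (w r) * X).prod with hQ
  have hQconj : Q.map (starRingEnd ℂ) = Q := by
    rw [hQ, Polynomial.map_multiset_prod, Multiset.map_map]
    conv_rhs => rw [← hconjroots, Multiset.map_map]
    congr 1
    refine Multiset.map_congr rfl fun r hr => ?_
    simp [hwconj r hr]
  obtain ⟨Θ, hΘ⟩ := exists_real_of_map_conj_eq hQconj
  have haeval : ∀ z : ℂ, aeval z Θ = (G.roots.map fun r => 1 - w r * z).prod := by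
    intro z
    rw [aeval_def, ← eval_map]
    change eval z (Θ.map Complex.ofRealHom) = _
    rw [hΘ, hQ, eval_multiset_prod, Multiset.map_map]
    congr 1
    refine Multiset.map_congr rfl fun r _ => ?_
    simp
  have hzero : ∀ z : ℂ, ‖z‖ ≤ 1 → aeval z Θ ≠ 0 := by
    intro z hz h0
    rw [haeval, Multiset.prod_eq_zero_iff, Multiset.mem_map] at h0
    obtain ⟨r, hr, hr0⟩ := h0
    have h1 : ‖w r * z‖ = 1 := by rw [← sub_eq_zero.1 hr0, norm_one]
    rw [norm_mul] at h1
    have := (hw r hr).2.1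
    have := norm_nonneg z
    have := norm_nonneg (w r)
    nlinarith
  set B : ℂ := G.leadingCoeff * (G.roots.map fun r => -(2 * w r)⁻¹).prod with hB
  have hfac : ∀ lam : ℝ, ((g.eval (Real.cos lam) : ℝ) : ℂ) =
      B * ((‖aeval (Complex.exp (-Complex.I * lam)) Θ‖ ^ 2 : ℝ) : ℂ) := by
    intro lam
    set e := Complex.exp (-Complex.I * lam) with he
    have hconje : conj e = Complex.exp (Complex.I * lam) := by
      rw [he, ← Complex.exp_conj]; simp
    have hee : e * conj e = 1 := by
      rw [hconje, he, ← Complex.exp_add]; simp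
    have hcos : (2 : ℂ) * Complex.cos lam = e + conj e := by
      rw [Complex.two_cos, hconje, he, add_comm]
      congr 2 <;> ring
    have h1 : ((g.eval (Real.cos lam) : ℝ) : ℂ) = G.eval ((Real.cos lam : ℝ) : ℂ) := by
      rw [hG, eval_map, ← Complex.ofRealHom_eq_coe, ← Complex.ofRealHom_eq_coe, eval₂_at_apply]
    rw [h1, Complex.ofReal_pow, ← Complex.mul_conj', conj_aeval, haeval, haeval, hB, mul_assoc,
      ← Multiset.prod_map_mul, ← Multiset.prod_map_mul]
    conv_lhs => rw [hsplit.eq_prod_roots]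
    rw [eval_mul, eval_C, eval_multiset_prod, Multiset.map_map]
    congr 2
    refine Multiset.map_congr rfl fun r hr => ?_
    obtain ⟨a1, a2, a3⟩ := hw r hr
    simp only [Function.comp, eval_sub, eval_X, eval_C, Complex.ofReal_cos]
    field_simp at a3 ⊢
    linear_combination (w r) * hcos + a3 + (w r) ^ 2 * hee
  have h1pos : 0 < ‖aeval (Complex.exp (-Complex.I * (0 : ℝ))) Θ‖ ^ 2 := by
    have := hzero (Complex.exp (-Complex.I * (0 : ℝ))) (by simp)
    positivity
  -- The constant is a priori complex; the factorisation at λ = 0 identifies it as a quotient of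
  -- positive numbers.
  have hBreal : B = ((g.eval 1 / ‖aeval (Complex.exp (-Complex.I * (0 : ℝ))) Θ‖ ^ 2 : ℝ) : ℂ) := by
    have h2 := hfac 0
    rw [Real.cos_zero] at h2
    rw [Complex.ofReal_div, h2, mul_div_cancel_right₀]
    exact_mod_cast h1pos.ne'
  refine ⟨_, Θ, div_pos (hg 1 (by norm_num)) h1pos, ?_, hzero, fun lam => ?_⟩
  · have h2 := haeval 0
    simp only [mul_zero, sub_zero, Multiset.map_const', Multiset.prod_replicate, one_pow] at h2
    rw [aeval_def, eval₂_at_zero] at h2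
    exact Complex.ofReal_injective (by simpa using h2)
  · have h2 := hfac lam
    rw [hBreal] at h2
    exact_mod_cast h2

theorem integral_exp_int (n : ℤ) :
    ∫ lam in (-Real.pi)..Real.pi, Complex.exp (-Complex.I * lam * n) =
      if n = 0 then 2 * (Real.pi : ℂ) else 0 := by
  split_ifs with h
  · subst h
    simp
    ring
  · have hc : (-Complex.I * n) ≠ 0 := by simp [h]
    have h1 := integral_exp_mul_complex (a := -Real.pi) (b := Real.pi) hc
    have h2 : ∀ lam : ℝ, -Complex.I * lam * n = -Complex.I * n * lam := fun lam => by ring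
    simp only [h2, h1]
    rw [div_eq_zero_iff]
    left
    rw [sub_eq_zero, Complex.exp_eq_exp_iff_exists_int]
    exact ⟨-n, by push_cast; ring⟩

theorem aeval_exp_norm_sq (Θ : ℝ[X]) {N : ℕ} (hN : Θ.natDegree < N) (lam : ℝ) :
    ((‖aeval (Complex.exp (-Complex.I * lam)) Θ‖ ^ 2 : ℝ) : ℂ) =
      ∑ i ∈ Finset.range N, ∑ j ∈ Finset.range N,
        ((Θ.coeff i * Θ.coeff j : ℝ) : ℂ) *
          Complex.exp (-Complex.I * lam * (((i : ℤ) - j : ℤ) : ℂ)) := by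
  rw [Complex.ofReal_pow, ← Complex.mul_conj', conj_aeval, aeval_eq_sum_range' hN,
    aeval_eq_sum_range' hN, Finset.sum_mul_sum]
  refine Finset.sum_congr rfl fun i _ => Finset.sum_congr rfl fun j _ => ?_
  rw [← Complex.exp_conj, ← Complex.exp_nat_mul, ← Complex.exp_nat_mul, Complex.real_smul,
    Complex.real_smul, mul_mul_mul_comm, ← Complex.exp_add, ← Complex.ofReal_mul]
  congr 2
  simp
  ring

/-- Parseval; the source of the factor (1 + ∑ ϑ²)⁻¹ in the noise variance. -/
theorem integral_aeval_exp_norm_sq (Θ : ℝ[X]) {N : ℕ} (hN : Θ.natDegree < N) :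
    ∫ lam in (-Real.pi)..Real.pi, ‖aeval (Complex.exp (-Complex.I * lam)) Θ‖ ^ 2 =
      2 * Real.pi * ∑ i ∈ Finset.range N, Θ.coeff i ^ 2 := by
  apply Complex.ofReal_injective
  rw [← intervalIntegral.integral_ofReal]
  simp only [aeval_exp_norm_sq Θ hN]
  have hi : ∀ i j : ℕ, IntervalIntegrable (fun lam : ℝ => ((Θ.coeff i * Θ.coeff j : ℝ) : ℂ) *
      Complex.exp (-Complex.I * lam * (((i : ℤ) - j : ℤ) : ℂ))) volume (-Real.pi) Real.pi :=
    fun i j => Continuous.intervalIntegrable (by fun_prop) _ _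
  rw [intervalIntegral.integral_finsetSum fun i _ =>
    Continuous.intervalIntegrable (by fun_prop) _ _]
  rw [Complex.ofReal_mul, Complex.ofReal_sum, Finset.mul_sum]
  refine Finset.sum_congr rfl fun i h => ?_
  rw [intervalIntegral.integral_finsetSum fun j _ => hi i j]
  simp only [intervalIntegral.integral_const_mul, integral_exp_int]
  rw [Finset.sum_eq_single_of_mem i h]
  · simp; ring
  · intro j _ hj
    rw [if_neg (by omega), mul_zero]

/-- A nonnegative continuous even function is approximated on `[-π, π]` by spectral densities of
invertible moving averages with the same total mass. -/
theorem exists_invertible_ma_approx {F : ℝ → ℝ} (hF : Continuous F) (heven : ∀ x, F (-x) = F x)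
    (hpos : ∀ x, 0 ≤ F x) {η : ℝ} (hη : 0 < η) :
    ∃ Θ : ℝ[X], Θ.coeff 0 = 1 ∧ (∀ z : ℂ, ‖z‖ ≤ 1 → aeval z Θ ≠ 0) ∧
      ∀ N, Θ.natDegree < N → ∀ lam ∈ Set.Icc (-Real.pi) Real.pi,
        |(∑ i ∈ Finset.range N, Θ.coeff i ^ 2)⁻¹ * (∫ x in (-Real.pi)..Real.pi, F x) /
          (2 * Real.pi) * ‖aeval (Complex.exp (-Complex.I * lam)) Θ‖ ^ 2 - F lam| ≤ η := by
  have hpi := Real.pi_pos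
  set I := ∫ x in (-Real.pi)..Real.pi, F x with hI
  have hle : -Real.pi ≤ Real.pi := by linarith
  have hI0 : 0 ≤ I := intervalIntegral.integral_nonneg hle fun x _ => hpos x
  rcases hI0.eq_or_lt with h0 | h0
  -- Zero total mass: F vanishes on [-π, π] and the noise variance is 0, so the trivial polynomial
  -- serves. This case is separate because the mass I is a divisor below.
  · refine ⟨1, by simp, fun z _ => by simp, fun N _ lam hlam => ?_⟩
    have hz : F lam = 0 := by
      have h1 : Set.EqOn F 0 (Set.Icc (-Real.pi) Real.pi) := by
        by_contra hne
        have : ∃ c ∈ Set.Icc (-Real.pi) Real.pi, 0 < F c := by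
          simp only [Set.EqOn, not_forall] at hne
          obtain ⟨c, hc, hc2⟩ := hne
          exact ⟨c, hc, lt_of_le_of_ne (hpos c) (Ne.symm hc2)⟩
        have := intervalIntegral.integral_pos (by linarith : -Real.pi < Real.pi)
          hF.continuousOn (fun x _ => hpos x) this
        linarith
      exact h1 hlam
    rw [← h0, hz]
    simpa using hη.le
  · obtain ⟨M, hM⟩ := isCompact_Icc.exists_bound_of_continuousOn
      (hF.continuousOn (s := Set.Icc (-Real.pi) Real.pi))
    have hM0 : 0 ≤ M := (norm_nonneg _).trans (hM 0 ⟨by linarith, hpi.le⟩)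
    -- K collects the two errors per unit of δ: 3/2 from g - F, and 3πM/I from matching the masses.
    set K := 3 / 2 + 3 * Real.pi * M / I with hK
    have hKpos : 0 < K := by positivity
    set δ := η / K with hδ
    have hδpos : 0 < δ := by positivity
    -- The shift by δ with accuracy δ/2 keeps g above F + δ/2, hence strictly positive on [-1, 1]
    -- and of mass at least I.
    obtain ⟨g, hg⟩ := exists_polynomial_near_of_continuousOn (-1) 1
      (fun u => F (Real.arccos u) + δ)
      ((hF.comp Real.continuous_arccos).add continuous_const).continuousOn (δ / 2) (by positivity)
    have hgpos : ∀ u ∈ Set.Icc (-1 : ℝ) 1, 0 < g.eval u := by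
      intro u hu
      have h1 := (abs_lt.1 (hg u hu)).1
      have h2 := hpos (Real.arccos u)
      linarith
    have hgF : ∀ lam ∈ Set.Icc (-Real.pi) Real.pi, F lam ≤ g.eval (Real.cos lam) ∧
        g.eval (Real.cos lam) - F lam ≤ 3 / 2 * δ := by
      intro lam hlam
      have h1 := abs_lt.1 (hg (Real.cos lam) (Real.cos_mem_Icc lam))
      have h2 : F (Real.arccos (Real.cos lam)) = F lam := by
        rcases le_total 0 lam with h | h
        · rw [Real.arccos_cos h hlam.2]
        · rw [← Real.cos_neg, Real.arccos_cos (by linarith) (by linarith [hlam.1]), heven]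
      rw [h2] at h1
      constructor <;> linarith [h1.1, h1.2]
    obtain ⟨A, Θ, hA, hc0, hz, hfac⟩ := exists_spectral_factor g hgpos
    refine ⟨Θ, hc0, hz, fun N hN lam hlam => ?_⟩
    set S := ∑ i ∈ Finset.range N, Θ.coeff i ^ 2 with hS
    set J := ∫ x in (-Real.pi)..Real.pi, g.eval (Real.cos x) with hJ
    have hJS : J = A * (2 * Real.pi * S) := by
      rw [hJ, hS, ← integral_aeval_exp_norm_sq Θ hN, ← intervalIntegral.integral_const_mul]
      simp only [hfac]
    have hgi : IntervalIntegrable (fun x => g.eval (Real.cos x)) volume (-Real.pi) Real.pi :=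
      (g.continuous.comp Real.continuous_cos).intervalIntegrable _ _
    have hFi : IntervalIntegrable F volume (-Real.pi) Real.pi := hF.intervalIntegrable _ _
    have hJI : I ≤ J := intervalIntegral.integral_mono_on hle hFi hgi fun x hx => (hgF x hx).1
    have hJI2 : J - I ≤ 3 * Real.pi * δ := by
      rw [hJ, hI, ← intervalIntegral.integral_sub hgi hFi]
      have := intervalIntegral.integral_mono_on hle (hgi.sub hFi)
        (intervalIntegrable_const (c := 3 / 2 * δ)) fun x hx => (hgF x hx).2
      refine this.trans_eq ?_
      rw [intervalIntegral.integral_const, smul_eq_mul]; ring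
    have hJpos : 0 < J := h0.trans_le hJI
    have hSpos : S ≠ 0 := by
      rintro h; rw [h] at hJS; simp at hJS; linarith
    -- The prescribed variance amounts to rescaling g by I/J so that its mass becomes that of F.
    have e1 : S⁻¹ * I / (2 * Real.pi) * ‖aeval (Complex.exp (-Complex.I * lam)) Θ‖ ^ 2 =
        I / J * g.eval (Real.cos lam) := by
      rw [hfac, hJS]; field_simp
    rw [e1]
    have e2 : I / J * g.eval (Real.cos lam) - F lam =
        (I * (g.eval (Real.cos lam) - F lam) - (J - I) * F lam) / J := by
      field_simp; ring
    obtain ⟨hg1, hg2⟩ := hgF lam hlam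
    have hFM : F lam ≤ M := (le_abs_self _).trans (hM lam hlam)
    have b1 : I * (g.eval (Real.cos lam) - F lam) ≤ I * (3 / 2 * δ) := by gcongr
    have b2 : (J - I) * F lam ≤ 3 * Real.pi * δ * M :=
      mul_le_mul hJI2 hFM (hpos _) (by positivity)
    have b3 : 0 ≤ I * (g.eval (Real.cos lam) - F lam) := mul_nonneg hI0 (by linarith)
    have b4 : 0 ≤ (J - I) * F lam := mul_nonneg (by linarith) (hpos _)
    have b5 : I * (3 / 2 * δ) + 3 * Real.pi * δ * M = η * I := by
      have : δ * K = η := div_mul_cancel₀ _ hKpos.ne'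
      rw [← this, hK]; field_simp
    have b6 : 0 ≤ 3 * Real.pi * δ * M := by positivity
    have b7 : 0 ≤ I * (3 / 2 * δ) := by positivity
    have b8 : η * I ≤ η * J := by gcongr
    rw [e2, abs_div, abs_of_pos hJpos, div_le_iff₀ hJpos, abs_le]
    constructor <;> linarith

end Factor

/-! ### Construction of band-limited moving averages -/

section White

open ProbabilityTheory in
-- Independent standard Gaussians; only measurability and the first two moments are recorded.
theorem exists_white_family (κ : Type) [DecidableEq κ] :
    ∃ (Ω : Type) (_ : MeasurableSpace Ω) (P : Measure Ω) (X : κ → Ω → ℝ),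
      IsProbabilityMeasure P ∧ (∀ a, Measurable (X a)) ∧ (∀ a, MemLp (X a) 2 P) ∧
      (∀ a, ∫ ω, X a ω ∂P = 0) ∧ ∀ a b, ∫ ω, X a ω * X b ω ∂P = if a = b then 1 else 0 := by
  obtain ⟨Ω, mΩ, P, X, hX, hlaw, hind, hP⟩ := exists_iid κ (gaussianReal 0 1)
  have hmean : ∀ a, ∫ ω, X a ω ∂P = 0 := fun a => by
    rw [(hlaw a).integral_eq, integral_id_gaussianReal]
  refine ⟨Ω, mΩ, P, X, hP, hX, fun a => ?_, hmean, fun a b => ?_⟩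
  · have h := memLp_id_gaussianReal' (μ := 0) (v := 1) 2 (by norm_num)
    rw [← (hlaw a).map_eq] at h
    exact (memLp_map_measure_iff (by fun_prop) (hX a).aemeasurable).1 h
  · split_ifs with h
    · subst h
      have h1 := variance_of_integral_eq_zero (hX a).aemeasurable (hmean a)
      rw [(hlaw a).variance_eq, variance_id_gaussianReal] at h1
      simp only [← sq]
      exact h1.symm
    · rw [(hind.indepFun h).integral_fun_mul_eq_mul_integral (hX a).aestronglyMeasurable
        (hX b).aestronglyMeasurable, hmean, zero_mul]

end White

/-! ### Real and imaginary parts of the spherical harmonics -/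

section Real

/-- The real and the imaginary part of `Y_{l,m}`. -/
def realHarm (l : ℕ) (m : ℤ) (b : Bool) (x : S2) : ℝ :=
  if b then (sphHarmonic l m x).re else (sphHarmonic l m x).im

theorem continuous_realHarm (l : ℕ) (m : ℤ) (b : Bool) : Continuous (realHarm l m b) := by
  have h := continuous_sphHarmonic l m
  unfold realHarm
  cases b
  · simp only [Bool.false_eq_true, if_false]
    exact Complex.continuous_im.comp h
  · simp only [if_true]
    exact Complex.continuous_re.comp h

theorem conj_sphHarmonic (l : ℕ) (m : ℤ) (x : S2) :
    conj (sphHarmonic l m x) = (-1) ^ m.natAbs * sphHarmonic l (-m) x := by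
  have h1 : ((-1 : ℂ) ^ m.natAbs) * (-1) ^ m.natAbs = 1 := by
    rw [← mul_pow]; norm_num
  unfold sphHarmonic
  rcases lt_trichotomy m 0 with h | rfl | h
  · rw [if_neg (by omega), if_pos (by omega), Int.natAbs_neg]
    simp
  · simp only [le_refl, if_true, neg_zero, Int.natAbs_zero, pow_zero, one_mul]
    simp [sphHarmonicNat]
  · rw [if_pos (by omega), if_neg (by omega), Int.natAbs_neg, ← mul_assoc, h1, one_mul]

theorem realHarm_mem_sphSpan {l d : ℕ} {m : ℤ} (hl : l ≤ d) (hm : |m| ≤ l) (b : Bool) :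
    (fun x => (realHarm l m b x : ℂ)) ∈ sphSpan d := by
  have h1 := sphHarmonic_mem hl hm
  have h2 : (fun x => conj (sphHarmonic l m x)) ∈ sphSpan d := by
    simp only [conj_sphHarmonic]
    exact Submodule.smul_mem _ _ (sphHarmonic_mem (m := -m) hl (by rwa [abs_neg]))
  cases b
  · convert Submodule.smul_mem _ (-Complex.I / 2) (Submodule.sub_mem _ h1 h2) using 1
    ext x
    simp only [realHarm, Bool.false_eq_true, if_false, Pi.smul_apply, Pi.sub_apply, smul_eq_mul,
      Complex.sub_conj]
    push_cast
    linear_combination ((sphHarmonic l m x).im : ℂ) * Complex.I_sq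
  · convert Submodule.smul_mem _ (1 / 2 : ℂ) (Submodule.add_mem _ h1 h2) using 1
    ext x
    simp only [realHarm, if_true, Pi.smul_apply, Pi.add_apply, smul_eq_mul, Complex.add_conj]
    push_cast
    ring

/-- The real part of the addition theorem. All m are kept with both parts; the family is redundant,
but for a real field only this covariance identity is needed, not a basis. -/
theorem sum_realHarm_mul (l : ℕ) (x y : S2) :
    ∑ m ∈ Finset.Icc (-(l : ℤ)) l, ∑ b : Bool, realHarm l m b x * realHarm l m b y =
      (kernelPoly l).eval (dot x y) := by
  have h := congrArg Complex.re (sphKernel_eq_kernelPoly l x y)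
  rw [Complex.ofReal_re, sphKernel, Complex.re_sum] at h
  rw [← h]
  refine Finset.sum_congr rfl fun m _ => ?_
  simp [realHarm, Complex.mul_re]

theorem isotropicOp_realHarm {ρ : ℝ → ℝ} (hρ : Continuous ρ) {c : ℝ} {l : ℕ} {m : ℤ}
    (h : ∀ x, isotropicOp ρ (sphHarmonic l m) x = (c : ℂ) * sphHarmonic l m x) (b : Bool)
    (x : S2) : isotropicOp ρ (realHarm l m b) x = c * realHarm l m b x := by
  have hi := integrable_surf (continuous_isotropic_mul hρ (continuous_sphHarmonic l m) x)
  cases b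
  · have h2 := congrArg Complex.im (h x)
    rw [isotropicOp, ← RCLike.im_eq_complex_im, ← integral_im hi] at h2
    simpa [isotropicOp, realHarm] using h2
  · have h2 := congrArg Complex.re (h x)
    rw [isotropicOp, ← RCLike.re_eq_complex_re, ← integral_re hi] at h2
    simpa [isotropicOp, realHarm] using h2

end Real

/-! ### Moving averages over finitely many spatial modes -/

section MovingAverage

variable {Ω : Type*} {ι : Type*} [Fintype ι]

/-- The field `∑_i B_i(x) ∑_{j < q} a_{i,j} X_{i, t - j}`. -/
def maField (q : ℕ) (a : ι → ℕ → ℝ) (B : ι → S2 → ℝ) (X : ι × ℤ → Ω → ℝ) :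
    S2 → ℤ → Ω → ℝ :=
  fun x t ω => ∑ i, ∑ j ∈ Finset.range q, a i j * B i x * X (i, t - j) ω

variable {q : ℕ} {a : ι → ℕ → ℝ} {B : ι → S2 → ℝ} {X : ι × ℤ → Ω → ℝ}

theorem maField_mem_sphSpan {d : ℕ} (hB : ∀ i, (fun x => (B i x : ℂ)) ∈ sphSpan d) (t : ℤ)
    (ω : Ω) : (fun x => (maField q a B X x t ω : ℂ)) ∈ sphSpan d := by
  have : (fun x => (maField q a B X x t ω : ℂ)) =
      ∑ i, ∑ j ∈ Finset.range q, ((a i j * X (i, t - j) ω : ℝ) : ℂ) • fun x => (B i x : ℂ) := by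
    ext x
    simp only [maField, Finset.sum_apply, Pi.smul_apply, smul_eq_mul]
    push_cast
    exact Finset.sum_congr rfl fun i _ => Finset.sum_congr rfl fun j _ => by ring
  rw [this]
  exact Submodule.sum_mem _ fun i _ => Submodule.sum_mem _ fun j _ =>
    Submodule.smul_mem _ _ (hB i)

variable [MeasurableSpace Ω] {P : Measure Ω}

theorem isField_maField (hB : ∀ i, Continuous (B i)) (hX : ∀ a, Measurable (X a))
    (hX2 : ∀ a, MemLp (X a) 2 P) (hmean : ∀ a, ∫ ω, X a ω ∂P = 0) [IsFiniteMeasure P] :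
    IsField P (maField q a B X) where
  measurable t := by
    refine Finset.measurable_sum _ fun i _ => Finset.measurable_sum _ fun j _ => ?_
    exact (((hB i).measurable.comp measurable_fst).const_mul _).mul ((hX _).comp measurable_snd)
  memLp x t := memLp_finsetSum _ fun i _ => memLp_finsetSum _ fun j _ => (hX2 _).const_mul _
  mean_zero x t := by
    have hi : ∀ a, Integrable (X a) P := fun a => (hX2 a).integrable (by norm_num)
    simp only [maField]
    rw [integral_finsetSum _ fun i _ => integrable_finsetSum _ fun j _ => (hi _).const_mul _]
    refine Finset.sum_eq_zero fun i _ => ?_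
    rw [integral_finsetSum _ fun j _ => (hi _).const_mul _]
    refine Finset.sum_eq_zero fun j _ => ?_
    rw [integral_const_mul, hmean, mul_zero]

/-- White noise kills all cross terms except equal modes at equal times t - j = s - k, so the
covariance depends on t - s only. -/
theorem integral_maField_mul [DecidableEq ι] (hX2 : ∀ a, MemLp (X a) 2 P)
    (hcov : ∀ a b, ∫ ω, X a ω * X b ω ∂P = if a = b then 1 else 0) (x y : S2) (t s : ℤ) :
    ∫ ω, maField q a B X x t ω * maField q a B X y s ω ∂P =
      ∑ i, B i x * B i y * ∑ j ∈ Finset.range q, ∑ k ∈ Finset.range q,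
        a i j * a i k * if t - s = (j : ℤ) - k then 1 else 0 := by
  have hi : ∀ a b, Integrable (fun ω => X a ω * X b ω) P := fun a b =>
    (hX2 a).integrable_mul (hX2 b)
  have e : ∀ ω, maField q a B X x t ω * maField q a B X y s ω =
      ∑ i, ∑ j ∈ Finset.range q, ∑ i', ∑ k ∈ Finset.range q,
        (a i j * B i x * (a i' k * B i' y)) * (X (i, t - j) ω * X (i', s - k) ω) := by
    intro ω
    rw [maField, maField, Finset.sum_mul]
    refine Finset.sum_congr rfl fun i _ => ?_
    rw [Finset.sum_mul]
    refine Finset.sum_congr rfl fun j _ => ?_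
    rw [Finset.mul_sum]
    refine Finset.sum_congr rfl fun i' _ => ?_
    rw [Finset.mul_sum]
    exact Finset.sum_congr rfl fun k _ => by ring
  simp only [e]
  rw [integral_finsetSum _ fun i _ => integrable_finsetSum _ fun j _ =>
    integrable_finsetSum _ fun i' _ => integrable_finsetSum _ fun k _ => (hi _ _).const_mul _]
  refine Finset.sum_congr rfl fun i _ => ?_
  rw [integral_finsetSum _ fun j _ =>
    integrable_finsetSum _ fun i' _ => integrable_finsetSum _ fun k _ => (hi _ _).const_mul _,
    Finset.mul_sum]
  refine Finset.sum_congr rfl fun j _ => ?_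
  rw [integral_finsetSum _ fun i' _ => integrable_finsetSum _ fun k _ => (hi _ _).const_mul _,
    Finset.sum_eq_single i]
  · rw [integral_finsetSum _ fun k _ => (hi _ _).const_mul _, Finset.mul_sum]
    refine Finset.sum_congr rfl fun k _ => ?_
    rw [integral_const_mul, hcov]
    have : ((i, t - (j : ℤ)) = (i, s - (k : ℤ))) ↔ t - s = (j : ℤ) - k := by
      simp only [Prod.mk.injEq, true_and]
      constructor <;> intro h <;> linarith
    simp only [this]
    ring
  · intro i' _ hne
    rw [integral_finsetSum _ fun k _ => (hi _ _).const_mul _]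
    refine Finset.sum_eq_zero fun k _ => ?_
    rw [integral_const_mul, hcov, if_neg (fun h => hne (Prod.ext_iff.1 h).1.symm), mul_zero]
  · intro h; exact absurd (Finset.mem_univ i) h

theorem bandLimited_maField {d : ℕ} (hB : ∀ i, (fun x => (B i x : ℂ)) ∈ sphSpan d) :
    BandLimited P d (maField q a B X) := fun x t => Eventually.of_forall fun ω =>
  (expansion_of_mem_sphSpan (maField_mem_sphSpan hB t ω) x).symm

theorem integral_coeff_maField_one [DecidableEq ι] (hB : ∀ i, Continuous (B i))
    (hX2 : ∀ a, MemLp (X a) 2 P)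
    (hcov : ∀ a b, ∫ ω, X a ω * X b ω ∂P = if a = b then 1 else 0) {t s : ℤ} (hts : t ≠ s)
    (l l' : ℕ) (m m' : ℤ) :
    ∫ ω, coeff (maField 1 a B X) l m t ω * conj (coeff (maField 1 a B X) l' m' s ω) ∂P = 0 := by
  have hc : ∀ (l : ℕ) (m t : ℤ) (ω : Ω), coeff (maField 1 a B X) l m t ω =
      ∑ i, ((X (i, t) ω : ℝ) : ℂ) *
        ((a i 0 : ℂ) * ∫ x, (B i x : ℂ) * conj (sphHarmonic l m x) ∂surf) := by
    intro l m t ω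
    have hi : ∀ i, Integrable (fun x => (B i x : ℂ) * conj (sphHarmonic l m x)) surf := fun i =>
      integrable_surf ((Complex.continuous_ofReal.comp (hB i)).mul
        (Complex.continuous_conj.comp (continuous_sphHarmonic l m)))
    simp only [coeff, maField, Finset.sum_range_one, Complex.ofReal_sum, Finset.sum_mul,
      ← integral_const_mul]
    rw [← integral_finsetSum _ fun i _ => ((hi i).const_mul _).const_mul _]
    refine integral_congr_ae (Eventually.of_forall fun x => ?_)
    refine Finset.sum_congr rfl fun i _ => ?_
    push_cast
    simp only [sub_zero]
    ring
  have hi : ∀ a b, Integrable (fun ω => X a ω * X b ω) P := fun a b =>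
    (hX2 a).integrable_mul (hX2 b)
  simp only [hc, map_sum, map_mul, Complex.conj_ofReal, Finset.sum_mul_sum]
  have e : ∀ (u v : ℝ) (z w : ℂ), (u : ℂ) * z * ((v : ℂ) * w) = z * w * ((u * v : ℝ) : ℂ) := by
    intro u v z w; push_cast; ring
  simp only [e]
  rw [integral_finsetSum _ fun i _ => integrable_finsetSum _ fun j _ =>
    ((hi _ _).ofReal).const_mul _]
  refine Finset.sum_eq_zero fun i _ => ?_
  rw [integral_finsetSum _ fun j _ => ((hi _ _).ofReal).const_mul _]
  refine Finset.sum_eq_zero fun j _ => ?_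
  rw [integral_const_mul, integral_complex_ofReal, hcov, if_neg (fun h => hts (Prod.ext_iff.1 h).2)]
  simp

end MovingAverage

/-! ### The band-limited process with prescribed transfer polynomials -/

section Field
open Polynomial

/-- The indices of the real spherical harmonics of degree at most `L`. -/
abbrev RealIdx (L : ℕ) : Type :=
  ↥((Finset.range (L + 1)).sigma fun l => Finset.Icc (-(l : ℤ)) l) × Bool

/-- The degree of the spherical harmonic with index `i`. -/
def RealIdx.deg {L : ℕ} (i : RealIdx L) : ℕ := i.1.1.1

/-- The real spherical harmonic with index `i`. -/
def RealIdx.harm {L : ℕ} (i : RealIdx L) : S2 → ℝ := realHarm i.1.1.1 i.1.1.2 i.2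

theorem RealIdx.deg_le {L : ℕ} (i : RealIdx L) : i.deg ≤ L :=
  Finset.mem_range_succ_iff.1 (Finset.mem_sigma.1 i.1.2).1

theorem RealIdx.abs_le {L : ℕ} (i : RealIdx L) : |i.1.1.2| ≤ (i.deg : ℤ) :=
  _root_.abs_le.2 (Finset.mem_Icc.1 (Finset.mem_sigma.1 i.1.2).2)

theorem sum_harm_mul_harm (L : ℕ) (c : ℕ → ℝ) (x y : S2) :
    ∑ i : RealIdx L, i.harm x * i.harm y * c i.deg =
      ∑ l ∈ Finset.range (L + 1), c l * (kernelPoly l).eval (dot x y) := by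
  rw [Fintype.sum_prod_type]
  have h := Finset.sum_coe_sort ((Finset.range (L + 1)).sigma fun l => Finset.Icc (-(l : ℤ)) l)
    (fun p => ∑ b : Bool, realHarm p.1 p.2 b x * realHarm p.1 p.2 b y * c p.1)
  refine Eq.trans h ?_
  rw [Finset.sum_sigma]
  refine Finset.sum_congr rfl fun l _ => ?_
  rw [← sum_realHarm_mul, Finset.mul_sum]
  refine Finset.sum_congr rfl fun m _ => ?_
  rw [Finset.mul_sum]
  exact Finset.sum_congr rfl fun b _ => mul_comm _ _

/-- The isotropic kernel acting on the spherical harmonics of degree `l ≤ L` by `c l`. -/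
def multiplierKernel (L : ℕ) (c : ℕ → ℝ) (u : ℝ) : ℝ :=
  ∑ l ∈ Finset.range (L + 1), c l * (kernelPoly l).eval u

theorem continuous_multiplierKernel (L : ℕ) (c : ℕ → ℝ) : Continuous (multiplierKernel L c) :=
  continuous_finsetSum _ fun _ _ => continuous_const.mul (Polynomial.continuous _)

theorem fhCoeff_multiplierKernel (L : ℕ) (c : ℕ → ℝ) (l : ℕ) :
    fhCoeff (multiplierKernel L c) l = if l ≤ L then c l else 0 := by
  have h : ∀ s : Finset ℕ, fhCoeff (fun u => ∑ k ∈ s, c k * (kernelPoly k).eval u) l =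
      ∑ k ∈ s, if l = k then c k else 0 := by
    intro s
    induction s using Finset.induction_on with
    | empty => simp [fhCoeff]
    | insert k s hk ih =>
      simp only [Finset.sum_insert hk]
      rw [fhCoeff_add (by fun_prop) (by fun_prop), ih, fhCoeff_const_mul, fhCoeff_kernelPoly]
      simp [eq_comm]
  unfold multiplierKernel
  rw [h, Finset.sum_ite_eq]
  simp only [Finset.mem_range_succ_iff]

/-- The autocovariance function of the moving average with transfer polynomial `Θ` driven by a
white noise of unit variance. -/
def maCov (q : ℕ) (Θ : ℝ[X]) (t : ℤ) : ℝ :=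
  ∑ j ∈ Finset.range (q + 1), ∑ k ∈ Finset.range (q + 1),
    Θ.coeff j * Θ.coeff k * if t = (j : ℤ) - k then 1 else 0

/-- Noise and process are sums over the same Gaussians; the process carries the coefficients of Θ_l
in degree l. The operator with kernel ∑_l ϑ_{l;j} `kernelPoly l` multiplies degree l by ϑ_{l;j}, so
the moving average equation holds for every outcome, not just almost surely. -/
theorem exists_bandLimited_process (L q : ℕ) (Θ : ℕ → ℝ[X]) (s : ℕ → ℝ) (hs : ∀ l, 0 ≤ s l)
    (h0 : ∀ l, (Θ l).coeff 0 = 1) (hz : ∀ l, ∀ z : ℂ, ‖z‖ ≤ 1 → aeval z (Θ l) ≠ 0)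
    (hdeg : ∀ l ≤ L, (Θ l).natDegree ≤ q) :
    ∃ (Ω : Type) (_ : MeasurableSpace Ω) (P : Measure Ω) (k : Fin q → ℝ → ℝ)
      (θ : ℕ → Fin q → ℝ) (Z T : S2 → ℤ → Ω → ℝ), IsProbabilityMeasure P ∧
      IsInvertibleBandLimitedSPHMA P L q k θ s Z T ∧
      (∀ l ≤ L, ∀ j : Fin q, θ l j = (Θ l).coeff (j + 1)) ∧
      ∀ t x y, autocovKernel P T t x y =
        multiplierKernel L (fun l => s l * maCov q (Θ l) t) (dot x y) := by
  obtain ⟨Ω, mΩ, P, X, hP, hX, hX2, hmean, hcov⟩ := exists_white_family (RealIdx L × ℤ)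
  -- The index j : Fin q stands for lag j + 1. Beyond L the eigenvalues are 0, so the invertibility
  -- polynomial is 1 there.
  set θ : ℕ → Fin q → ℝ := fun l j => if l ≤ L then (Θ l).coeff (j + 1) else 0 with hθ
  set k : Fin q → ℝ → ℝ := fun j => multiplierKernel L (fun l => θ l j) with hk
  set Z : S2 → ℤ → Ω → ℝ :=
    maField 1 (fun (i : RealIdx L) _ => √(s i.deg)) RealIdx.harm X with hZ
  set T : S2 → ℤ → Ω → ℝ := maField (q + 1)
    (fun (i : RealIdx L) j => √(s i.deg) * (Θ i.deg).coeff j) RealIdx.harm X with hT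
  have hB : ∀ i : RealIdx L, Continuous i.harm := fun i => continuous_realHarm _ _ _
  have hBs : ∀ i : RealIdx L, (fun x => (i.harm x : ℂ)) ∈ sphSpan L := fun i =>
    realHarm_mem_sphSpan i.deg_le i.abs_le _
  have hTcov : ∀ x y t u, ∫ ω, T x t ω * T y u ω ∂P =
      multiplierKernel L (fun l => s l * maCov q (Θ l) (t - u)) (dot x y) := by
    intro x y t u
    rw [hT, integral_maField_mul hX2 hcov, multiplierKernel, ← sum_harm_mul_harm]
    refine Finset.sum_congr rfl fun i _ => ?_
    congr 1
    rw [maCov, Finset.mul_sum]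
    refine Finset.sum_congr rfl fun j _ => ?_
    rw [Finset.mul_sum]
    refine Finset.sum_congr rfl fun j' _ => ?_
    conv_rhs => rw [← Real.mul_self_sqrt (hs i.deg)]
    ring
  have hZcov : ∀ x y t, ∫ ω, Z x t ω * Z y t ω ∂P = multiplierKernel L s (dot x y) := by
    intro x y t
    rw [hZ, integral_maField_mul hX2 hcov, multiplierKernel, ← sum_harm_mul_harm]
    refine Finset.sum_congr rfl fun i _ => ?_
    simp [Real.mul_self_sqrt (hs i.deg)]
  have hkeig : ∀ (j : Fin q) (l : ℕ) (m : ℤ), |m| ≤ l → ∀ x : S2,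
      isotropicOp (k j) (sphHarmonic l m) x = (θ l j : ℂ) * sphHarmonic l m x := by
    intro j l m hm x
    rw [funkHecke (continuous_multiplierKernel _ _) hm, fhCoeff_multiplierKernel]
    congr 2
    simp only [hθ]
    split_ifs <;> rfl
  have hop : ∀ (j : Fin q) (t : ℤ) (ω : Ω) (x : S2), isotropicOp (k j) (fun y => Z y t ω) x =
      ∑ i : RealIdx L, √(s i.deg) * (Θ i.deg).coeff (j + 1) * i.harm x * X (i, t) ω := by
    intro j t ω x
    have h1 : ∀ i : RealIdx L, isotropicOp (k j) i.harm x =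
        (Θ i.deg).coeff (j + 1) * i.harm x := by
      intro i
      have := isotropicOp_realHarm (continuous_multiplierKernel _ _)
        (hkeig j i.deg i.1.1.2 i.abs_le) i.2 x
      simp only [hθ, if_pos i.deg_le] at this
      exact this
    have hi : ∀ i : RealIdx L, Integrable (fun y => k j (dot x y) • i.harm y) surf := fun i =>
      integrable_surf (continuous_isotropic_mul (continuous_multiplierKernel _ _) (hB i) x)
    simp only [isotropicOp] at h1 ⊢
    simp only [hZ, maField, Finset.sum_range_one, Nat.cast_zero, sub_zero]
    have e : ∀ y, k j (dot x y) • ∑ i : RealIdx L, √(s i.deg) * i.harm y * X (i, t) ω =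
        ∑ i : RealIdx L, (√(s i.deg) * X (i, t) ω) * (k j (dot x y) • i.harm y) := by
      intro y
      rw [Finset.smul_sum]
      refine Finset.sum_congr rfl fun i _ => ?_
      simp only [smul_eq_mul]; ring
    simp only [e]
    rw [integral_finsetSum _ fun i _ => (hi i).const_mul _]
    refine Finset.sum_congr rfl fun i _ => ?_
    rw [integral_const_mul, h1]; ring
  have hTZ : ∀ x t ω, T x t ω =
      Z x t ω + ∑ j : Fin q, isotropicOp (k j) (fun y => Z y (t - (j + 1 : ℕ)) ω) x := by
    intro x t ω
    simp only [hop]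
    rw [Finset.sum_comm]
    simp only [hT, hZ, maField, Finset.sum_range_one]
    rw [← Finset.sum_add_distrib]
    refine Finset.sum_congr rfl fun i _ => ?_
    -- The lag-zero term has coefficient Θ_l(0) = 1 and is the noise itself.
    rw [Finset.sum_range_succ', add_comm, h0, mul_one, Finset.sum_range]
  refine ⟨Ω, mΩ, P, k, θ, Z, T, hP, ?_, fun l hl j => if_pos hl, fun t x y => ?_⟩
  · refine ⟨⟨isField_maField hB hX hX2 hmean, fun x y g _ t u h => ?_⟩,
      ⟨isField_maField hB hX hX2 hmean, ?_, fun t x y => ?_, fun t u htu l l' m m' _ _ =>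
        integral_coeff_maField_one hB hX2 hcov htu l l' m m'⟩, bandLimited_maField hBs,
      bandLimited_maField hBs, ⟨fun j => (continuous_multiplierKernel _ _).continuousOn,
        fun x t => Eventually.of_forall fun ω => hTZ x t ω,
        fun t => Eventually.of_forall fun p => hTZ p.1 t p.2⟩, hkeig, fun l z hzn => ?_⟩
    · rw [hTcov, hTcov, dot_rotate, add_sub_add_right_eq_sub]
    · refine summable_of_ne_finset_zero (s := Finset.range (L + 1)) fun l hl => ?_
      rw [if_neg (fun h => hl (Finset.mem_range_succ_iff.2 h)), mul_zero]
    · rw [hZcov, multiplierKernel]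
      have : ∀ l ∈ Finset.range (L + 1), s l * (kernelPoly l).eval (dot x y) =
          (2 * l + 1) / (4 * Real.pi) * (if l ≤ L then s l else 0) *
            (legendre l).eval (dot x y) := by
        intro l hl
        rw [if_pos (Finset.mem_range_succ_iff.1 hl), kernelPoly, eval_mul, eval_C]; ring
      rw [Finset.sum_congr rfl this]
      refine hasSum_sum_of_ne_finset_zero fun l hl => ?_
      rw [if_neg (fun h => hl (Finset.mem_range_succ_iff.2 h))]; ring
    · by_cases hl : l ≤ L
      · have h1 := hz l z hzn
        rw [aeval_eq_sum_range' (Nat.lt_succ_of_le (hdeg l hl)), Finset.sum_range_succ', add_comm,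
          h0, Finset.sum_range] at h1
        simpa [hθ, hl] using h1
      · simp [hθ, hl]
  · rw [autocovKernel, hTcov, sub_zero]

end Field

/-! ### Zonal form of the autocovariance -/

/-- After moving x to x', a reflection moves the image y₁ of y to y'. Its mirror plane contains x'
because ⟨x', y₁⟩ = ⟨x', y'⟩, so x' stays fixed. -/
theorem exists_isometry_of_dot_eq {x y x' y' : S2} (h : dot x y = dot x' y') :
    ∃ g : E3 ≃ₗᵢ[ℝ] E3, rotate g x = x' ∧ rotate g y = y' := by
  obtain ⟨g₁, hg₁⟩ := exists_rotate_eq x x'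
  set y₁ := rotate g₁ y with hy₁
  set g₂ := (ℝ ∙ ((y₁ : E3) - y'))ᗮ.reflection
  have h2 : g₂ (y₁ : E3) = y' := Submodule.reflection_sub (by simp)
  have h3 : g₂ (x' : E3) = x' := by
    refine Submodule.reflection_mem_subspace_eq_self ?_
    rw [Submodule.mem_orthogonal_singleton_iff_inner_left, inner_sub_right, sub_eq_zero]
    change dot x' y₁ = dot x' y'
    rw [← h, ← hg₁, dot_rotate]
  refine ⟨g₁.trans g₂, ?_, ?_⟩
  · ext1
    change g₂ ((rotate g₁ x : S2) : E3) = x'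
    rw [hg₁, h3]
  · ext1
    exact h2

/-- Covariance invariance is assumed only under SO(3). In dimension three some plane contains both
x' and y', and reflecting in it corrects a determinant of -1 without moving them. -/
theorem exists_isRotation_of_dot_eq {x y x' y' : S2} (h : dot x y = dot x' y') :
    ∃ g : E3 ≃ₗᵢ[ℝ] E3, IsRotation g ∧ rotate g x = x' ∧ rotate g y = y' := by
  obtain ⟨g, hgx, hgy⟩ := exists_isometry_of_dot_eq h
  have hdet : |LinearMap.det (g.toLinearEquiv : E3 →ₗ[ℝ] E3)| = 1 := by
    rw [← LinearMap.normDet_eq_abs_det]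
    exact g.toLinearIsometry.normDet_eq_one
  rcases (abs_eq zero_le_one).1 hdet with hd | hd
  · exact ⟨g, hd, hgx, hgy⟩
  · obtain ⟨n, hn, hnx, hny⟩ : ∃ n : E3, n ≠ 0 ∧ inner ℝ n (x' : E3) = 0 ∧
        inner ℝ n (y' : E3) = 0 := by
      have h1 : Module.finrank ℝ (Submodule.span ℝ ({(x' : E3), (y' : E3)} : Set E3)) ≤ 2 :=
        (finrank_span_le_card _).trans (by
          rw [Set.toFinset_insert, Set.toFinset_singleton]; exact Finset.card_le_two)
      have h2 := Submodule.finrank_add_finrank_orthogonal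
        (Submodule.span ℝ ({(x' : E3), (y' : E3)} : Set E3))
      rw [finrank_euclideanSpace, Fintype.card_fin] at h2
      have h3 : (Submodule.span ℝ ({(x' : E3), (y' : E3)} : Set E3))ᗮ ≠ ⊥ := by
        intro h; rw [h, finrank_bot] at h2; omega
      obtain ⟨n, hn, hn0⟩ := Submodule.exists_mem_ne_zero_of_ne_bot h3
      rw [Submodule.mem_orthogonal'] at hn
      exact ⟨n, hn0, hn _ (Submodule.subset_span (by simp)),
        hn _ (Submodule.subset_span (by simp))⟩
    set σ := (ℝ ∙ n)ᗮ.reflection with hσ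
    have hfix : ∀ z : S2, inner ℝ n (z : E3) = 0 → rotate σ z = z := by
      intro z hz
      ext1
      refine Submodule.reflection_mem_subspace_eq_self ?_
      rwa [Submodule.mem_orthogonal_singleton_iff_inner_right]
    have hcomp : ∀ z, rotate (g.trans σ) z = rotate σ (rotate g z) := fun z => rfl
    refine ⟨g.trans σ, ?_, by rw [hcomp, hgx, hfix _ hnx], by rw [hcomp, hgy, hfix _ hny]⟩
    have h4 := (ℝ ∙ n)ᗮ.det_reflection
    rw [Submodule.orthogonal_orthogonal, finrank_span_singleton hn, pow_one] at h4
    have h5 : (((g.trans σ).toLinearEquiv : E3 ≃ₗ[ℝ] E3) : E3 →ₗ[ℝ] E3) =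
        ((ℝ ∙ n)ᗮ.reflection.toLinearMap) ∘ₗ (g.toLinearEquiv : E3 →ₗ[ℝ] E3) := rfl
    rw [IsRotation, h5, LinearMap.det_comp, h4, hd]; norm_num

/-- The meridian through the north pole, parametrised by the third coordinate. -/
def meridian (u : Set.Icc (-1 : ℝ) 1) : S2 :=
  ⟨!₂[√(1 - u ^ 2), 0, (u : ℝ)], by
    have h : (u : ℝ) ^ 2 ≤ 1 := (sq_le_one_iff_abs_le_one _).2 (abs_le.2 u.2)
    rw [mem_sphere_zero_iff_norm, EuclideanSpace.norm_eq, Fin.sum_univ_three]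
    simp [Real.sq_sqrt (sub_nonneg.2 h)]⟩

theorem continuous_meridian : Continuous meridian := by
  refine Continuous.subtype_mk ?_ _
  refine (PiLp.continuous_toLp 2 _).comp (continuous_pi fun i => ?_)
  fin_cases i <;> simp <;> fun_prop

theorem dot_meridian_north (u : Set.Icc (-1 : ℝ) 1) : dot (meridian u) north = u := by
  rw [dot_north]; simp [meridian]

/-! ### Covariances of the harmonic coefficients of the given field -/

section Given

theorem coeff_mul_conj_coeff {Ω : Type*} (T : S2 → ℤ → Ω → ℝ) (l : ℕ) (m t s : ℤ) (ω : Ω) :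
    coeff T l m t ω * conj (coeff T l m s ω) =
      ∫ p, ((T p.1 t ω * T p.2 s ω : ℝ) : ℂ) *
        (conj (sphHarmonic l m p.1) * sphHarmonic l m p.2) ∂(surf.prod surf) := by
  rw [coeff, coeff, ← integral_conj, ← integral_prod_mul]
  refine integral_congr_ae (Eventually.of_forall fun p => ?_)
  simp only [map_mul, Complex.conj_conj, Complex.conj_ofReal]
  push_cast; ring


variable {Ω : Type*} [MeasurableSpace Ω] {P : Measure Ω} {T : S2 → ℤ → Ω → ℝ}

theorem isRotation_refl : IsRotation (LinearIsometryEquiv.refl ℝ E3) := LinearMap.det_id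

theorem IsIsotropicStationary.integral_eq_autocovKernel (hT : IsIsotropicStationary P T)
    (t s : ℤ) (x y : S2) : ∫ ω, T x t ω * T y s ω ∂P = autocovKernel P T (t - s) x y := by
  rw [hT.cov_invariant x y _ isRotation_refl t s (-s), add_neg_cancel, ← sub_eq_add_neg]
  rfl

/-- A rotation brings any pair (x, y) to the north pole and the point of the meridian with the same
inner product. Restricting the kernel there gives ρ on [-1, 1], extended to ℝ by constants so that
it is globally continuous. -/
theorem exists_zonal_autocov (hT : IsIsotropicStationary P T) (hc : ContinuousKernels P T) :
    ∃ ρ : ℤ → ℝ → ℝ, (∀ t, Continuous (ρ t)) ∧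
      ∀ t s x y, ∫ ω, T x t ω * T y s ω ∂P = ρ (t - s) (dot x y) := by
  refine ⟨fun t => Set.IccExtend (by norm_num : (-1 : ℝ) ≤ 1)
    (fun u => autocovKernel P T t (meridian u) north), fun t => ?_, fun t s x y => ?_⟩
  · exact ((hc t).comp (continuous_meridian.prodMk continuous_const)).Icc_extend'
  · simp only [hT.integral_eq_autocovKernel, Set.IccExtend_of_mem _ _ (dot_mem_Icc x y)]
    obtain ⟨g, hg, hgx, hgy⟩ := exists_isRotation_of_dot_eq
      (x := x) (y := y) (x' := meridian ⟨dot x y, dot_mem_Icc x y⟩) (y' := north)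
      (by rw [dot_meridian_north])
    have := hT.cov_invariant x y g hg (t - s) 0 0
    rw [hgx, hgy, add_zero, add_zero] at this
    exact this

variable {ρ : ℤ → ℝ → ℝ}

/-- Licence for Fubini: |ab| ≤ a² + b², and E T(x, t)² is the constant ρ₀(1), integrable over the
compact sphere. -/
theorem integrable_mul_mul [IsProbabilityMeasure P] (hT : IsField P T)
    (hρT : ∀ t s x y, ∫ ω, T x t ω * T y s ω ∂P = ρ (t - s) (dot x y)) (t s : ℤ) :
    Integrable (fun p : Ω × (S2 × S2) => T p.2.1 t p.1 * T p.2.2 s p.1)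
      (P.prod (surf.prod surf)) := by
  have hdot : ∀ x : S2, dot x x = 1 := fun x => by
    rw [dot, real_inner_self_eq_norm_sq, norm_eq_of_mem_sphere]; norm_num
  have hm1 : ∀ t, Measurable (fun p : Ω × (S2 × S2) => T p.2.1 t p.1) := fun t =>
    (hT.measurable t).comp ((measurable_fst.comp measurable_snd).prodMk measurable_fst)
  have hm2 : ∀ t, Measurable (fun p : Ω × (S2 × S2) => T p.2.2 t p.1) := fun t =>
    (hT.measurable t).comp ((measurable_snd.comp measurable_snd).prodMk measurable_fst)
  have hsq : ∀ x t, ∫ ω, ‖T x t ω ^ 2‖ ∂P = ρ 0 1 := by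
    intro x t
    have := hρT t t x x
    rw [sub_self, hdot] at this
    rw [← this]
    refine integral_congr_ae (Eventually.of_forall fun ω => ?_)
    simp only [norm_pow, Real.norm_eq_abs, sq_abs]
    exact sq _
  have h1 : Integrable (fun p : Ω × (S2 × S2) => T p.2.1 t p.1 ^ 2) (P.prod (surf.prod surf)) := by
    rw [integrable_prod_iff' ((hm1 t).pow_const 2).aestronglyMeasurable]
    refine ⟨Eventually.of_forall fun q => (hT.memLp q.1 t).integrable_sq, ?_⟩
    simp only [hsq]
    exact integrable_const _
  have h2 : Integrable (fun p : Ω × (S2 × S2) => T p.2.2 s p.1 ^ 2) (P.prod (surf.prod surf)) := by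
    rw [integrable_prod_iff' ((hm2 s).pow_const 2).aestronglyMeasurable]
    refine ⟨Eventually.of_forall fun q => (hT.memLp q.2 s).integrable_sq, ?_⟩
    simp only [hsq]
    exact integrable_const _
  refine (h1.add h2).mono' ((hm1 t).mul (hm2 s)).aestronglyMeasurable
    (Eventually.of_forall fun p => ?_)
  rw [Real.norm_eq_abs, abs_le, Pi.add_apply]
  constructor <;> nlinarith [sq_nonneg (T p.2.1 t p.1 + T p.2.2 s p.1),
    sq_nonneg (T p.2.1 t p.1 - T p.2.2 s p.1), sq_nonneg (T p.2.1 t p.1), sq_nonneg (T p.2.2 s p.1)]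

theorem integrable_coeff_kernel [IsProbabilityMeasure P] (hT : IsField P T)
    (hρT : ∀ t s x y, ∫ ω, T x t ω * T y s ω ∂P = ρ (t - s) (dot x y)) (l : ℕ) (m t s : ℤ) :
    Integrable (fun p : Ω × (S2 × S2) => ((T p.2.1 t p.1 * T p.2.2 s p.1 : ℝ) : ℂ) *
      (conj (sphHarmonic l m p.2.1) * sphHarmonic l m p.2.2)) (P.prod (surf.prod surf)) := by
  have hY : Continuous fun p : S2 × S2 => conj (sphHarmonic l m p.1) * sphHarmonic l m p.2 :=
    (Complex.continuous_conj.comp ((continuous_sphHarmonic l m).comp continuous_fst)).mul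
      ((continuous_sphHarmonic l m).comp continuous_snd)
  obtain ⟨M, hM⟩ := isCompact_univ.exists_bound_of_continuousOn hY.continuousOn
  refine (integrable_mul_mul hT hρT t s).ofReal.mul_bdd (c := M)
    (hY.measurable.comp measurable_snd).aestronglyMeasurable
    (Eventually.of_forall fun p => hM p.2 (Set.mem_univ _))

theorem integrable_coeff_mul_conj_coeff [IsProbabilityMeasure P] (hT : IsField P T)
    (hρT : ∀ t s x y, ∫ ω, T x t ω * T y s ω ∂P = ρ (t - s) (dot x y)) (l : ℕ) (m t s : ℤ) :
    Integrable (fun ω => coeff T l m t ω * conj (coeff T l m s ω)) P := by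
  simp only [coeff_mul_conj_coeff]
  exact (integrable_coeff_kernel hT hρT l m t s).integral_prod_left

/-- Fubini, then Funk–Hecke in y and normalisation in x. The answer does not involve m. -/
theorem integral_coeff_mul_conj_coeff [IsProbabilityMeasure P] (hT : IsField P T)
    (hρ : ∀ t, Continuous (ρ t))
    (hρT : ∀ t s x y, ∫ ω, T x t ω * T y s ω ∂P = ρ (t - s) (dot x y)) {l : ℕ} {m : ℤ}
    (hm : |m| ≤ l) (t s : ℤ) :
    ∫ ω, coeff T l m t ω * conj (coeff T l m s ω) ∂P = (fhCoeff (ρ (t - s)) l : ℂ) := by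
  simp only [coeff_mul_conj_coeff]
  rw [integral_integral_swap (integrable_coeff_kernel hT hρT l m t s)]
  simp only [integral_mul_const, integral_complex_ofReal, hρT]
  have hY := continuous_sphHarmonic l m
  have hcont : Continuous fun p : S2 × S2 => ((ρ (t - s) (dot p.1 p.2) : ℝ) : ℂ) *
      (conj (sphHarmonic l m p.1) * sphHarmonic l m p.2) :=
    (Complex.continuous_ofReal.comp ((hρ _).comp continuous_dot)).mul
      ((Complex.continuous_conj.comp (hY.comp continuous_fst)).mul (hY.comp continuous_snd))
  rw [integral_prod _ (hcont.integrable_of_hasCompactSupport (HasCompactSupport.of_compactSpace _))]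
  have h1 : ∀ x, ∫ y, ((ρ (t - s) (dot x y) : ℝ) : ℂ) *
      (conj (sphHarmonic l m x) * sphHarmonic l m y) ∂surf =
      (fhCoeff (ρ (t - s)) l : ℂ) * (sphHarmonic l m x * conj (sphHarmonic l m x)) := by
    intro x
    have h2 := funkHecke (hρ (t - s)) hm x
    simp only [isotropicOp, Complex.real_smul] at h2
    rw [← mul_assoc, ← h2, mul_comm, ← integral_const_mul]
    refine integral_congr_ae (Eventually.of_forall fun y => ?_)
    simp only; ring
  simp only [h1]
  rw [integral_const_mul, integral_sphHarmonic_mul_conj hm, if_pos ⟨rfl, rfl⟩, mul_one]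

end Given

/-! ### The angular spectral densities -/

/-- A summable sequence with nonnegative Toeplitz sums has a nonnegative sum. -/
theorem tsum_nonneg_of_toeplitz_nonneg {b : ℤ → ℝ} (hb : Summable b)
    (h : ∀ n : ℕ, 0 ≤ ∑ s ∈ Finset.range n, ∑ t ∈ Finset.range n, b ((s : ℤ) - t)) :
    0 ≤ ∑' t, b t := by
  set D : ℕ → ℝ := fun n => ∑ s ∈ Finset.range n, ∑ t ∈ Finset.range n, b ((s : ℤ) - t) with hD
  -- Enlarging the square by one row and one column adds the symmetric partial sum of b. Hence D n /
  -- n, which is nonnegative, is a Cesàro mean of partial sums converging to the total sum.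
  have hstep : ∀ n, D (n + 1) - D n = (∑ j ∈ Finset.range (n + 1), (b j + b (-j))) - b 0 := by
    intro n
    have h1 : ∑ s ∈ Finset.range n, b ((s : ℤ) - n) + b 0 =
        ∑ j ∈ Finset.range (n + 1), b (-(j : ℤ)) := by
      rw [← Finset.sum_range_reflect (fun j : ℕ => b (-(j : ℤ))), Finset.sum_range_succ]
      congr 1
      · refine Finset.sum_congr rfl fun s hs => ?_
        have := Finset.mem_range.1 hs
        congr 1
        rw [show n + 1 - 1 - s = n - s by omega]
        push_cast [this.le]; ring
      · simp
    have h2 : ∑ t ∈ Finset.range (n + 1), b ((n : ℤ) - t) =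
        ∑ j ∈ Finset.range (n + 1), b (j : ℤ) := by
      rw [← Finset.sum_range_reflect (fun j : ℕ => b (j : ℤ))]
      refine Finset.sum_congr rfl fun s hs => ?_
      have := Finset.mem_range.1 hs
      congr 1
      rw [show n + 1 - 1 - s = n - s by omega]
      push_cast [Nat.le_of_lt_succ this]; ring
    rw [Finset.sum_add_distrib, ← h1, ← h2]
    simp only [hD]
    rw [Finset.sum_range_succ]
    simp only [Finset.sum_range_succ _ n]
    rw [Finset.sum_add_distrib]
    ring
  have hlim : Tendsto (fun n => D (n + 1) - D n) atTop (𝓝 (∑' t, b t)) := by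
    simp only [hstep]
    have h1 := ((hb.hasSum.nat_add_neg).tendsto_sum_nat.comp (tendsto_add_atTop_nat 1)).sub_const
      (b 0)
    rw [add_sub_cancel_right] at h1
    exact h1
  have h2 := hlim.cesaro
  refine ge_of_tendsto' h2 fun n => ?_
  rw [Finset.sum_range_sub]
  have h0 : D 0 = 0 := by simp [hD]
  rw [h0, sub_zero]
  exact mul_nonneg (by positivity) (h n)

section Density

variable {Ω : Type*} [MeasurableSpace Ω] {P : Measure Ω} {T : S2 → ℤ → Ω → ℝ} {ρ : ℤ → ℝ → ℝ}

/-- Exchanging the two factors reverses the lag and swaps the points, and a zonal kernel is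
symmetric in its points. -/
theorem fhCoeff_neg (hρT : ∀ t s x y, ∫ ω, T x t ω * T y s ω ∂P = ρ (t - s) (dot x y)) (l : ℕ)
    (t : ℤ) : fhCoeff (ρ (-t)) l = fhCoeff (ρ t) l := by
  unfold fhCoeff
  refine integral_congr_ae (Eventually.of_forall fun y => ?_)
  simp only
  have h1 := hρT 0 t y north
  have h2 := hρT t 0 north y
  simp only [mul_comm (T y 0 _)] at h1
  rw [h1, zero_sub, sub_zero, dot_comm north, dot_north] at h2
  rw [h2]

theorem angularAutocov_eq [IsProbabilityMeasure P] (hT : IsField P T)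
    (hρ : ∀ t, Continuous (ρ t))
    (hρT : ∀ t s x y, ∫ ω, T x t ω * T y s ω ∂P = ρ (t - s) (dot x y)) (l : ℕ) (t : ℤ) :
    angularAutocov P T l t = (fhCoeff (ρ t) l : ℂ) := by
  rw [angularAutocov, integral_coeff_mul_conj_coeff hT hρ hρT (by simp), sub_zero]

/-- The sum is E|∑ e^{-iλs} a_{l,0}(s)|². -/
theorem toeplitz_fhCoeff_nonneg [IsProbabilityMeasure P] (hT : IsField P T)
    (hρ : ∀ t, Continuous (ρ t))
    (hρT : ∀ t s x y, ∫ ω, T x t ω * T y s ω ∂P = ρ (t - s) (dot x y)) (l : ℕ) (lam : ℝ) (n : ℕ) :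
    0 ≤ ∑ s ∈ Finset.range n, ∑ t ∈ Finset.range n,
      Real.cos (lam * (((s : ℤ) - t : ℤ) : ℝ)) * fhCoeff (ρ ((s : ℤ) - t)) l := by
  set e : ℕ → ℂ := fun s => Complex.exp (-Complex.I * lam * s) with he
  have hee : ∀ s t : ℕ, (e s * conj (e t)).re = Real.cos (lam * (((s : ℤ) - t : ℤ) : ℝ)) := by
    intro s t
    rw [he]
    simp only
    rw [← Complex.exp_conj, ← Complex.exp_add]
    have : -Complex.I * lam * s + conj (-Complex.I * lam * t) =
        ((-(lam * (((s : ℤ) - t : ℤ) : ℝ)) : ℝ) : ℂ) * Complex.I := by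
      simp; ring
    rw [this, Complex.exp_ofReal_mul_I_re, Real.cos_neg]
  have hi := integrable_coeff_mul_conj_coeff hT hρT l 0
  have h1 : ∫ ω, (∑ s ∈ Finset.range n, e s * coeff T l 0 s ω) *
      conj (∑ s ∈ Finset.range n, e s * coeff T l 0 s ω) ∂P =
      ∑ s ∈ Finset.range n, ∑ t ∈ Finset.range n,
        (e s * conj (e t)) * (fhCoeff (ρ ((s : ℤ) - t)) l : ℂ) := by
    have h0 : ∀ s t ω, e s * coeff T l 0 s ω * (conj (e t) * conj (coeff T l 0 t ω)) =
        (e s * conj (e t)) * (coeff T l 0 s ω * conj (coeff T l 0 t ω)) := by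
      intros; ring
    simp only [map_sum, map_mul, Finset.sum_mul_sum, h0]
    rw [integral_finsetSum _ fun (s : ℕ) _ => integrable_finsetSum _
      fun (t : ℕ) _ => (hi s t).const_mul _]
    refine Finset.sum_congr rfl fun s _ => ?_
    rw [integral_finsetSum _ fun (t : ℕ) _ => (hi s t).const_mul _]
    refine Finset.sum_congr rfl fun t _ => ?_
    rw [integral_const_mul, integral_coeff_mul_conj_coeff hT hρ hρT (by simp)]
  have h2 := congrArg Complex.re h1
  simp only [Complex.mul_conj, integral_complex_ofReal, Complex.ofReal_re, Complex.re_sum,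
    Complex.re_mul_ofReal, hee] at h2
  rw [← h2]
  exact integral_nonneg fun ω => Complex.normSq_nonneg _

/-- Evenness in the lag turns the Fourier series into a uniformly convergent cosine series: real,
even and continuous, and nonnegative by the Toeplitz criterion. -/
theorem exists_spectral_density [IsProbabilityMeasure P] (hT : IsField P T)
    (hρ : ∀ t, Continuous (ρ t))
    (hρT : ∀ t s x y, ∫ ω, T x t ω * T y s ω ∂P = ρ (t - s) (dot x y)) (l : ℕ)
    (hsum : Summable fun t => fhCoeff (ρ t) l) :
    ∃ F : ℝ → ℝ, Continuous F ∧ (∀ x, F (-x) = F x) ∧ (∀ x, 0 ≤ F x) ∧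
      ∀ lam : ℝ, spectralEigenvalue P T l lam = F lam := by
  have hbd : ∀ (t : ℤ) (lam : ℝ), ‖Real.cos (lam * t) * fhCoeff (ρ t) l‖ ≤ ‖fhCoeff (ρ t) l‖ := by
    intro t lam
    rw [norm_mul]
    exact mul_le_of_le_one_left (norm_nonneg _) (Real.abs_cos_le_one _)
  refine ⟨fun lam => 1 / (2 * Real.pi) * ∑' t : ℤ, Real.cos (lam * t) * fhCoeff (ρ t) l, ?_, ?_, ?_,
    ?_⟩
  · exact continuous_const.mul (continuous_tsum (fun t => by fun_prop) hsum.norm hbd)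
  · intro x; simp only [neg_mul, Real.cos_neg]
  · intro x
    refine mul_nonneg (by positivity) (tsum_nonneg_of_toeplitz_nonneg
      (Summable.of_norm_bounded hsum.norm fun t => hbd t x) fun n => ?_)
    exact toeplitz_fhCoeff_nonneg hT hρ hρT l x n
  · intro lam
    have hs : Summable fun t : ℤ =>
        Complex.exp (-Complex.I * lam * t) * (fhCoeff (ρ t) l : ℂ) := by
      refine Summable.of_norm_bounded hsum.norm fun t => ?_
      rw [norm_mul, Complex.norm_exp, Complex.norm_real]
      simp
    have hconj : conj (∑' t : ℤ, Complex.exp (-Complex.I * lam * t) * (fhCoeff (ρ t) l : ℂ)) =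
        ∑' t : ℤ, Complex.exp (-Complex.I * lam * t) * (fhCoeff (ρ t) l : ℂ) := by
      rw [Complex.conj_tsum]
      refine ((Equiv.neg ℤ).tsum_eq (fun t : ℤ => conj (Complex.exp (-Complex.I * lam * t) *
        (fhCoeff (ρ t) l : ℂ)))).symm.trans (tsum_congr fun t => ?_)
      rw [map_mul, Complex.conj_ofReal, ← Complex.exp_conj, Equiv.neg_apply, fhCoeff_neg hρT]
      congr 2
      simp
    simp only [spectralEigenvalue, angularAutocov_eq hT hρ hρT]
    have hre : ∀ t : ℤ, (Complex.exp (-Complex.I * lam * t) * (fhCoeff (ρ t) l : ℂ)).re =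
        Real.cos (lam * t) * fhCoeff (ρ t) l := by
      intro t
      rw [Complex.re_mul_ofReal, show -Complex.I * lam * t = ((-(lam * t) : ℝ) : ℂ) * Complex.I by
        push_cast; ring, Complex.exp_ofReal_mul_I_re, Real.cos_neg]
    rw [← Complex.conj_eq_iff_re.1 hconj, Complex.re_tsum hs]
    simp only [hre]
    rw [Complex.ofReal_mul]
    norm_num

theorem hasSum_exp_mul_maCov {q : ℕ} {Θ : Polynomial ℝ} (hq : Θ.natDegree ≤ q) (lam : ℝ) :
    HasSum (fun t : ℤ => Complex.exp (-Complex.I * lam * t) * (maCov q Θ t : ℂ))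
      ((‖Polynomial.aeval (Complex.exp (-Complex.I * lam)) Θ‖ ^ 2 : ℝ) : ℂ) := by
  rw [aeval_exp_norm_sq Θ (Nat.lt_succ_of_le hq)]
  have e : ∀ t : ℤ, Complex.exp (-Complex.I * lam * t) * (maCov q Θ t : ℂ) =
      ∑ j ∈ Finset.range (q + 1), ∑ k ∈ Finset.range (q + 1),
        Complex.exp (-Complex.I * lam * t) * ((Θ.coeff j * Θ.coeff k *
          (if t = (j : ℤ) - k then 1 else 0) : ℝ) : ℂ) := by
    intro t
    rw [maCov]
    push_cast
    rw [Finset.mul_sum]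
    refine Finset.sum_congr rfl fun j _ => ?_
    rw [Finset.mul_sum]
  simp only [e]
  refine hasSum_sum fun j _ => hasSum_sum fun k _ => ?_
  convert hasSum_single ((j : ℤ) - k) ?_ using 1
  · simp; ring
  · intro t ht
    simp [ht]

/-- The common core of both parts: scalar approximation in each degree up to L, assembled into one
process. -/
theorem exists_process_approx [IsProbabilityMeasure P] (hT : IsField P T)
    (hρ : ∀ t, Continuous (ρ t))
    (hρT : ∀ t s x y, ∫ ω, T x t ω * T y s ω ∂P = ρ (t - s) (dot x y))
    (hsum : ∀ l, Summable fun t => fhCoeff (ρ t) l) (L : ℕ) {η : ℝ} (hη : 0 < η) :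
    ∃ (Ω' : Type) (_ : MeasurableSpace Ω') (P' : Measure Ω') (q : ℕ) (k : Fin q → ℝ → ℝ)
      (θ : ℕ → Fin q → ℝ) (sigmaSq : ℕ → ℝ) (Z T' : S2 → ℤ → Ω' → ℝ) (c : ℕ → ℤ → ℝ),
      IsProbabilityMeasure P' ∧ IsInvertibleBandLimitedSPHMA P' L q k θ sigmaSq Z T' ∧
      (∀ l ≤ L, (sigmaSq l : ℂ) = (1 + ∑ j : Fin q, (θ l j : ℂ) ^ 2)⁻¹ *
        ∫ lam in (-Real.pi)..Real.pi, spectralEigenvalue P T l lam) ∧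
      (∀ t x y, autocovKernel P' T' t x y = multiplierKernel L (fun l => c l t) (dot x y)) ∧
      (∀ l ≤ L, Summable (c l)) ∧
      ∀ l ≤ L, ∀ lam ∈ Set.Icc (-Real.pi) Real.pi,
        ‖(1 / (2 * Real.pi) : ℂ) * ∑' t : ℤ, Complex.exp (-Complex.I * lam * t) * (c l t : ℂ) -
          spectralEigenvalue P T l lam‖ ≤ η := by
  choose F hF heven hpos hFeq using fun l => exists_spectral_density hT hρ hρT l (hsum l)
  choose Θ h0 hz hΘ using fun l => exists_invertible_ma_approx (hF l) (heven l) (hpos l) hη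
  -- One order serves all degrees; padding with zero coefficients is harmless, since the scalar
  -- estimate is available for every N above the degree.
  set q := (Finset.range (L + 1)).sup fun l => (Θ l).natDegree with hq
  have hdeg : ∀ l ≤ L, (Θ l).natDegree ≤ q := fun l hl =>
    Finset.le_sup (f := fun l => (Θ l).natDegree) (Finset.mem_range_succ_iff.2 hl)
  set s : ℕ → ℝ := fun l => (∑ i ∈ Finset.range (q + 1), (Θ l).coeff i ^ 2)⁻¹ *
    ∫ x in (-Real.pi)..Real.pi, F l x with hs
  have hs0 : ∀ l, 0 ≤ s l := fun l => mul_nonneg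
    (inv_nonneg.2 (Finset.sum_nonneg fun i _ => sq_nonneg _))
    (intervalIntegral.integral_nonneg (by linarith [Real.pi_pos]) fun x _ => hpos l x)
  obtain ⟨Ω', mΩ', P', k, θ, Z, T', hP', hproc, hθ, hcov⟩ :=
    exists_bandLimited_process L q Θ s hs0 h0 hz hdeg
  refine ⟨Ω', mΩ', P', q, k, θ, s, Z, T', fun l t => s l * maCov q (Θ l) t, hP', hproc,
    fun l hl => ?_, hcov, fun l hl => ?_, fun l hl lam hlam => ?_⟩
  · simp only [hFeq, intervalIntegral.integral_ofReal, hs]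
    rw [Finset.sum_range_succ', add_comm, h0, Finset.sum_range]
    simp only [hθ l hl]
    push_cast
    norm_num
  · refine Summable.mul_left _ ?_
    have h1 := (hasSum_exp_mul_maCov (hdeg l hl) 0).summable.norm
    refine Summable.of_norm ?_
    simpa using h1
  · have h1 := (hasSum_exp_mul_maCov (hdeg l hl) lam).mul_left (s l : ℂ)
    have h2 : ∑' t : ℤ, Complex.exp (-Complex.I * lam * t) * ((s l * maCov q (Θ l) t : ℝ) : ℂ) =
        (s l : ℂ) * ((‖Polynomial.aeval (Complex.exp (-Complex.I * lam)) (Θ l)‖ ^ 2 : ℝ) : ℂ) := by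
      rw [← h1.tsum_eq]
      refine tsum_congr fun t => ?_
      push_cast; ring
    rw [h2, hFeq]
    have h3 := hΘ l (q + 1) (Nat.lt_succ_of_le (hdeg l hl)) lam hlam
    rw [← Real.norm_eq_abs, ← Complex.norm_real] at h3
    refine le_trans (le_of_eq ?_) h3
    congr 1
    simp only [hs]
    push_cast
    ring

end Density

/-! ### Zonal kernels in `L²(S² × S²; ℂ)` -/

theorem memLp_zonal (f : C(ℝ, ℝ)) :
    MemLp (fun p : S2 × S2 => ((f (dot p.1 p.2) : ℝ) : ℂ)) 2 (surf.prod surf) :=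
  Continuous.memLp_of_hasCompactSupport
    (Complex.continuous_ofReal.comp (f.continuous.comp continuous_dot))
    (HasCompactSupport.of_compactSpace _)

/-- The square-integrable kernel `(x, y) ↦ f ⟨x, y⟩`. -/
def zonalL2 : C(ℝ, ℝ) →ₗ[ℝ] L2SS where
  toFun f := (memLp_zonal f).toLp _
  map_add' f g := by
    rw [← MemLp.toLp_add]
    refine MemLp.toLp_congr _ _ (Eventually.of_forall fun p => ?_)
    simp
  map_smul' c f := by
    rw [RingHom.id_apply, ← MemLp.toLp_const_smul]
    refine MemLp.toLp_congr _ _ (Eventually.of_forall fun p => ?_)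
    simp

theorem coeFn_zonalL2 (f : C(ℝ, ℝ)) :
    zonalL2 f =ᵐ[surf.prod surf] fun p => ((f (dot p.1 p.2) : ℝ) : ℂ) :=
  (memLp_zonal f).coeFn_toLp

theorem autocovL2_eq_zonalL2 {Ω : Type*} [MeasurableSpace Ω] {P : Measure Ω}
    {T : S2 → ℤ → Ω → ℝ} {t : ℤ} (f : C(ℝ, ℝ))
    (h : ∀ x y, autocovKernel P T t x y = f (dot x y)) : autocovL2 P T t = zonalL2 f := by
  have h1 : (fun p : S2 × S2 => ((autocovKernel P T t p.1 p.2 : ℝ) : ℂ)) =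
      fun p => ((f (dot p.1 p.2) : ℝ) : ℂ) := by
    simp only [h]
  have h2 := memLp_zonal f
  rw [← h1] at h2
  rw [autocovL2, dif_pos h2]
  exact MemLp.toLp_congr _ (memLp_zonal f) (Eventually.of_forall fun p => congrFun h1 p)

theorem kernelOp_zonalL2_sphBasis (f : C(ℝ, ℝ)) (i : HarmIdx) :
    kernelOp (zonalL2 f) (sphBasis i) = (fhCoeff f i.1.1 : ℂ) • sphBasis i := by
  rw [sphBasis_apply]
  have h0 : kernelOp (zonalL2 f) (harmL2 i) =
      (memLp_integralOp (Lp.memLp (zonalL2 f)) (Lp.memLp (harmL2 i))).toLp _ := rfl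
  rw [h0]
  refine Lp.ext ?_
  filter_upwards [MemLp.coeFn_toLp
    (memLp_integralOp (Lp.memLp (zonalL2 f)) (Lp.memLp (harmL2 i))),
    Lp.coeFn_smul (fhCoeff f i.1.1 : ℂ) (harmL2 i), coeFn_harmL2 i,
    Measure.ae_ae_of_ae_prod (coeFn_zonalL2 f)] with x h1 h2 h3 h4
  rw [h1, h2, Pi.smul_apply, h3, smul_eq_mul, ← funkHecke f.continuous i.2, isotropicOp]
  refine integral_congr_ae ?_
  filter_upwards [h4, coeFn_harmL2 i] with y h5 h6
  rw [h5, h6, Complex.real_smul]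

theorem norm_kernelOp_le (K : L2SS) : ‖kernelOp K‖ ≤ ‖K‖ :=
  LinearMap.mkContinuous_norm_le _ (norm_nonneg _) _

/-- An eigenvalue is bounded by the operator norm; this transfers summability over t to each degree.
-/
theorem abs_fhCoeff_le_norm_kernelOp (f : C(ℝ, ℝ)) (l : ℕ) :
    |fhCoeff f l| ≤ ‖kernelOp (zonalL2 f)‖ := by
  set i : HarmIdx := ⟨(l, 0), by simp⟩
  have h1 := (kernelOp (zonalL2 f)).le_opNorm (sphBasis i)
  rw [kernelOp_zonalL2_sphBasis, norm_smul, sphBasis.orthonormal.1 i, mul_one, mul_one,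
    Complex.norm_real] at h1
  exact h1

theorem integral_prod_dot (f : C(ℝ, ℝ)) :
    ∫ p : S2 × S2, f (dot p.1 p.2) ∂(surf.prod surf) =
      4 * Real.pi * ∫ y : S2, f ((y : E3) 2) ∂surf := by
  have hi : Integrable (fun p : S2 × S2 => f (dot p.1 p.2)) (surf.prod surf) :=
    (f.continuous.comp continuous_dot).integrable_of_hasCompactSupport
      (HasCompactSupport.of_compactSpace _)
  rw [integral_prod _ hi]
  simp only [integral_dot_eq f]
  rw [integral_const, surf_real_univ, smul_eq_mul]

theorem norm_zonalL2_sq (f : C(ℝ, ℝ)) :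
    ‖zonalL2 f‖ ^ 2 = 4 * Real.pi * ∫ y : S2, f ((y : E3) 2) ^ 2 ∂surf := by
  have h1 := integral_prod_dot (f ^ 2)
  simp only [ContinuousMap.pow_apply] at h1
  rw [← h1, ← inner_self_eq_norm_sq (𝕜 := ℂ), L2.inner_def, ← integral_re (L2.integrable_inner _ _)]
  refine integral_congr_ae ?_
  filter_upwards [coeFn_zonalL2 f] with p hp
  rw [hp, inner_self_eq_norm_sq, Complex.norm_real, Real.norm_eq_abs, sq_abs]

theorem norm_zonalL2_le {f : C(ℝ, ℝ)} {ε : ℝ} (h : ∀ u ∈ Set.Icc (-1 : ℝ) 1, |f u| ≤ ε) :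
    ‖zonalL2 f‖ ≤ 4 * Real.pi * ε := by
  have hε : 0 ≤ ε := (abs_nonneg (f 0)).trans (h 0 (by norm_num))
  refine (sq_le_sq₀ (norm_nonneg _)
    (mul_nonneg (by positivity : (0 : ℝ) ≤ 4 * Real.pi) hε)).1 ?_
  rw [norm_zonalL2_sq, mul_pow, sq (4 * Real.pi), mul_assoc (4 * Real.pi)]
  refine mul_le_mul_of_nonneg_left ?_ (by positivity)
  have h0 : 4 * Real.pi * ε ^ 2 = ∫ _ : S2, ε ^ 2 ∂surf := by
    rw [integral_const, surf_real_univ, smul_eq_mul]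
  rw [h0]
  refine integral_mono (integrable_surf (by fun_prop)) (integrable_const _) fun y => ?_
  have h1 := h _ (dot_mem_Icc y north)
  rw [dot_north] at h1
  exact sq_le_sq' (abs_le.1 h1).1 (abs_le.1 h1).2

/-! ### Truncation of zonal kernels -/

theorem integral_mul_polynomial_eq_zero {f : C(ℝ, ℝ)} {L : ℕ} (h : ∀ l ≤ L, fhCoeff f l = 0)
    {p : Polynomial ℝ} (hp : p.natDegree ≤ L) :
    ∫ y : S2, f ((y : E3) 2) * p.eval ((y : E3) 2) ∂surf = 0 := by
  have hi : ∀ p : Polynomial ℝ,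
      Integrable (fun y : S2 => f ((y : E3) 2) * p.eval ((y : E3) 2)) surf := fun p =>
    integrable_surf ((f.continuous.comp (continuous_coord 2)).mul
      (p.continuous.comp (continuous_coord 2)))
  have hp' := mem_span_kernelPoly hp
  clear hp
  induction hp' using Submodule.span_induction with
  | mem p hp =>
    obtain ⟨l, hl, rfl⟩ := hp
    have h1 := h l hl.2
    rw [fhCoeff] at h1
    simp only [kernelPoly, Polynomial.eval_mul, Polynomial.eval_C, mul_left_comm (f _)]
    rw [integral_const_mul, h1, mul_zero]
  | zero => simp
  | add p q _ _ h1 h2 =>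
    simp only [Polynomial.eval_add, mul_add]
    rw [integral_add (hi p) (hi q), h1, h2, add_zero]
  | smul c p _ h1 =>
    simp only [Polynomial.eval_smul, smul_eq_mul, mul_left_comm (f _)]
    rw [integral_const_mul, h1, mul_zero]

/-- Pythagoras: f is orthogonal on the sphere to polynomials of degree at most L in x₂. -/
theorem norm_zonalL2_le_norm_add {f : C(ℝ, ℝ)} {L : ℕ} (h : ∀ l ≤ L, fhCoeff f l = 0)
    {p : Polynomial ℝ} (hp : p.natDegree ≤ L) :
    ‖zonalL2 f‖ ≤ ‖zonalL2 (f + p.toContinuousMap)‖ := by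
  refine (sq_le_sq₀ (norm_nonneg _) (norm_nonneg _)).1 ?_
  rw [norm_zonalL2_sq, norm_zonalL2_sq]
  refine mul_le_mul_of_nonneg_left ?_ (by positivity)
  have hf : Continuous fun y : S2 => f ((y : E3) 2) := f.continuous.comp (continuous_coord 2)
  have hpc : Continuous fun y : S2 => p.eval ((y : E3) 2) :=
    p.continuous.comp (continuous_coord 2)
  have e : ∀ y : S2, (f + p.toContinuousMap) ((y : E3) 2) ^ 2 =
      f ((y : E3) 2) ^ 2 + 2 * (f ((y : E3) 2) * p.eval ((y : E3) 2)) +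
        p.eval ((y : E3) 2) ^ 2 := by
    intro y
    simp only [ContinuousMap.add_apply, Polynomial.toContinuousMap_apply]
    ring
  simp only [e]
  rw [integral_add (integrable_surf (by fun_prop)) (integrable_surf (by fun_prop)),
    integral_add (integrable_surf (by fun_prop)) (integrable_surf (by fun_prop)),
    integral_const_mul, integral_mul_polynomial_eq_zero h hp, mul_zero, add_zero]
  exact le_add_of_nonneg_right (integral_nonneg fun y => sq_nonneg _)

/-- The zonal kernel of the orthogonal projection onto the spherical harmonics of degree `l`. -/
def harmKernel (l : ℕ) : L2SS := zonalL2 (kernelPoly l).toContinuousMap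

/-- The projection of a zonal kernel to the degrees at most `L`. -/
def zonalTrunc (L : ℕ) (f : ℝ → ℝ) : L2SS :=
  ∑ l ∈ Finset.range (L + 1), (fhCoeff f l : ℂ) • harmKernel l

theorem zonalL2_multiplierKernel (L : ℕ) (c : ℕ → ℝ) :
    zonalL2 ⟨multiplierKernel L c, continuous_multiplierKernel L c⟩ =
      ∑ l ∈ Finset.range (L + 1), (c l : ℂ) • harmKernel l := by
  have h : (⟨multiplierKernel L c, continuous_multiplierKernel L c⟩ : C(ℝ, ℝ)) =
      ∑ l ∈ Finset.range (L + 1), c l • (kernelPoly l).toContinuousMap := by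
    ext u
    simp [multiplierKernel, ContinuousMap.sum_apply]
  rw [h, map_sum]
  refine Finset.sum_congr rfl fun l _ => ?_
  rw [map_smul, harmKernel]; rfl

/-- Truncation is the best approximation by polynomials of degree at most L. With p = 0 this gives a
bound uniform in L; with p from Weierstrass it gives convergence. -/
theorem norm_zonalL2_sub_zonalTrunc_le (f : C(ℝ, ℝ)) {L : ℕ} {p : Polynomial ℝ}
    (hp : p.natDegree ≤ L) :
    ‖zonalL2 f - zonalTrunc L f‖ ≤ ‖zonalL2 (f - p.toContinuousMap)‖ := by
  set r : Polynomial ℝ := ∑ l ∈ Finset.range (L + 1), Polynomial.C (fhCoeff f l) * kernelPoly l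
    with hr
  have hrdeg : r.natDegree ≤ L := Polynomial.natDegree_sum_le_of_forall_le _ _ fun l hl =>
    (Polynomial.natDegree_C_mul_le _ _).trans ((natDegree_kernelPoly_le l).trans
      (Finset.mem_range_succ_iff.1 hl))
  have hrm : (r.toContinuousMap : C(ℝ, ℝ)) =
      ⟨multiplierKernel L (fhCoeff f), continuous_multiplierKernel L (fhCoeff f)⟩ := by
    ext u
    simp [hr, multiplierKernel, Polynomial.eval_finsetSum]
  rw [zonalTrunc, ← zonalL2_multiplierKernel, ← hrm, ← map_sub]
  have h0 : ∀ l ≤ L, fhCoeff (f - r.toContinuousMap : C(ℝ, ℝ)) l = 0 := by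
    intro l hl
    have h1 : ((f - r.toContinuousMap : C(ℝ, ℝ)) : ℝ → ℝ) = fun u =>
        f u + (-1) * multiplierKernel L (fhCoeff f) u := by
      ext u
      rw [hrm]
      simp [sub_eq_add_neg]
    rw [h1, fhCoeff_add (σ := fun u => -1 * multiplierKernel L (fhCoeff f) u) f.continuous
      (continuous_const.mul (continuous_multiplierKernel L _)),
      fhCoeff_const_mul, fhCoeff_multiplierKernel, if_pos hl]
    ring
  have h2 := norm_zonalL2_le_norm_add h0 (p := r - p)
    ((Polynomial.natDegree_sub_le _ _).trans (max_le hrdeg hp))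
  have h3 : f - r.toContinuousMap + (r - p).toContinuousMap = f - p.toContinuousMap := by
    ext u
    simp
  rwa [h3] at h2

theorem norm_zonalL2_sub_zonalTrunc_le_norm (f : C(ℝ, ℝ)) (L : ℕ) :
    ‖zonalL2 f - zonalTrunc L f‖ ≤ ‖zonalL2 f‖ := by
  have h := norm_zonalL2_sub_zonalTrunc_le f (L := L) (p := 0) (by simp)
  have h0 : f - (0 : Polynomial ℝ).toContinuousMap = f := by
    ext u
    simp
  rwa [h0] at h

theorem tendsto_norm_zonalL2_sub_zonalTrunc (f : C(ℝ, ℝ)) :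
    Tendsto (fun L => ‖zonalL2 f - zonalTrunc L f‖) atTop (𝓝 0) := by
  rw [Metric.tendsto_atTop]
  intro ε hε
  obtain ⟨p, hp⟩ := exists_polynomial_near_of_continuousOn (-1) 1 f f.continuous.continuousOn
    (ε / (8 * Real.pi)) (by positivity)
  refine ⟨p.natDegree, fun L hL => ?_⟩
  rw [Real.dist_eq, sub_zero, abs_norm]
  refine (norm_zonalL2_sub_zonalTrunc_le f hL).trans_lt ?_
  refine (norm_zonalL2_le (ε := ε / (8 * Real.pi)) fun u hu => ?_).trans_lt ?_
  · rw [ContinuousMap.sub_apply, Polynomial.toContinuousMap_apply, abs_sub_comm]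
    exact (hp u hu).le
  · have : 4 * Real.pi * (ε / (8 * Real.pi)) = ε / 2 := by
      field_simp; ring
    rw [this]; linarith

/-! ### Spectral density kernels -/

theorem norm_exp_neg_I_mul (lam : ℝ) (t : ℤ) : ‖Complex.exp (-Complex.I * lam * t)‖ = 1 := by
  rw [Complex.norm_exp]
  simp

theorem hasSum_smul_harmKernel {L : ℕ} {c : ℕ → ℤ → ℝ} (hc : ∀ l ≤ L, Summable (c l))
    (lam : ℝ) :
    HasSum (fun t : ℤ => Complex.exp (-Complex.I * lam * t) •
        ∑ l ∈ Finset.range (L + 1), (c l t : ℂ) • harmKernel l)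
      (∑ l ∈ Finset.range (L + 1),
        (∑' t : ℤ, Complex.exp (-Complex.I * lam * t) * (c l t : ℂ)) • harmKernel l) := by
  simp only [Finset.smul_sum, smul_smul]
  refine hasSum_sum fun l hl => (Summable.hasSum ?_).smul_const _
  refine Summable.of_norm_bounded (hc l (Finset.mem_range_succ_iff.1 hl)).norm fun t => ?_
  rw [norm_mul, norm_exp_neg_I_mul, one_mul, Complex.norm_real]

/-! ### Approximation of the spectral density kernels -/

section Kernels

variable {Ω : Type*} [MeasurableSpace Ω] {P : Measure Ω} {T : S2 → ℤ → Ω → ℝ} {f : ℤ → C(ℝ, ℝ)}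

theorem IsIsotropicStationary.exists_zonal (hT : IsIsotropicStationary P T)
    (hc : ContinuousKernels P T) :
    ∃ f : ℤ → C(ℝ, ℝ), ∀ t s x y, ∫ ω, T x t ω * T y s ω ∂P = f (t - s) (dot x y) := by
  obtain ⟨ρ, hρ, h⟩ := exists_zonal_autocov hT hc
  exact ⟨fun t => ⟨ρ t, hρ t⟩, h⟩

theorem autocovL2_eq (hf : ∀ t s x y, ∫ ω, T x t ω * T y s ω ∂P = f (t - s) (dot x y)) (t : ℤ) :
    autocovL2 P T t = zonalL2 (f t) :=
  autocovL2_eq_zonalL2 (f t) fun x y => by rw [autocovKernel, hf, sub_zero]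

theorem spectralEigenvalue_eq [IsProbabilityMeasure P] (hT : IsField P T)
    (hf : ∀ t s x y, ∫ ω, T x t ω * T y s ω ∂P = f (t - s) (dot x y)) (l : ℕ) (lam : ℝ) :
    spectralEigenvalue P T l lam = (1 / (2 * Real.pi) : ℂ) *
      ∑' t : ℤ, Complex.exp (-Complex.I * lam * t) * (fhCoeff (f t) l : ℂ) := by
  simp only [spectralEigenvalue,
    angularAutocov_eq (ρ := fun t => f t) hT (fun t => (f t).continuous) hf]

theorem tendsto_tsum_norm_zonalL2_sub (hs : Summable fun t => ‖zonalL2 (f t)‖) :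
    Tendsto (fun L : ℕ => ∑' t, ‖zonalL2 (f t) - zonalTrunc L (f t)‖) atTop (𝓝 0) := by
  have h := tendsto_tsum_of_dominated_convergence (𝓕 := atTop)
    (f := fun (L : ℕ) t => ‖zonalL2 (f t) - zonalTrunc L (f t)‖) (g := fun _ => (0 : ℝ)) hs
    (fun t => tendsto_norm_zonalL2_sub_zonalTrunc (f t))
    (Eventually.of_forall fun L t => by
      rw [norm_norm]; exact norm_zonalL2_sub_zonalTrunc_le_norm (f t) L)
  simpa using h

theorem norm_one_div_two_pi : ‖(1 / (2 * Real.pi) : ℂ)‖ ≤ 1 := by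
  have h : (1 / (2 * Real.pi) : ℂ) = ((1 / (2 * Real.pi) : ℝ) : ℂ) := by push_cast; rfl
  rw [h, Complex.norm_real, Real.norm_of_nonneg (by positivity), div_le_one (by positivity)]
  linarith [Real.pi_gt_three]

/-- The difference splits into degrees l ≤ L, governed by the scalar errors, and the truncation
remainders, which occur only for the given field. -/
theorem norm_spectralKernel_sub_le [IsProbabilityMeasure P] (hT : IsField P T)
    (hf : ∀ t s x y, ∫ ω, T x t ω * T y s ω ∂P = f (t - s) (dot x y))
    (hs : Summable fun t => ‖zonalL2 (f t)‖) (hsl : ∀ l, Summable fun t => fhCoeff (f t) l)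
    {Ω' : Type*} [MeasurableSpace Ω'] {P' : Measure Ω'} {T' : S2 → ℤ → Ω' → ℝ} {L : ℕ}
    {c : ℕ → ℤ → ℝ}
    (hc : ∀ t x y, autocovKernel P' T' t x y = multiplierKernel L (fun l => c l t) (dot x y))
    (hcs : ∀ l ≤ L, Summable (c l)) {η lam : ℝ}
    (hη : ∀ l ≤ L, ‖(1 / (2 * Real.pi) : ℂ) *
      ∑' t : ℤ, Complex.exp (-Complex.I * lam * t) * (c l t : ℂ) -
        spectralEigenvalue P T l lam‖ ≤ η) :
    ‖spectralKernel P' T' lam - spectralKernel P T lam‖ ≤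
      η * ∑ l ∈ Finset.range (L + 1), ‖harmKernel l‖ +
        ∑' t, ‖zonalL2 (f t) - zonalTrunc L (f t)‖ := by
  have h1 := hasSum_smul_harmKernel hcs lam
  have h2 := hasSum_smul_harmKernel (L := L) (c := fun l t => fhCoeff (f t) l)
    (fun l _ => hsl l) lam
  have hsn : Summable fun t => ‖zonalL2 (f t) - zonalTrunc L (f t)‖ :=
    Summable.of_nonneg_of_le (fun t => norm_nonneg _)
      (fun t => norm_zonalL2_sub_zonalTrunc_le_norm (f t) L) hs
  have hn : ∀ t : ℤ, ‖Complex.exp (-Complex.I * lam * t) • (zonalL2 (f t) - zonalTrunc L (f t))‖ =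
      ‖zonalL2 (f t) - zonalTrunc L (f t)‖ := fun t => by
    rw [norm_smul, norm_exp_neg_I_mul, one_mul]
  have h3 : Summable fun t : ℤ =>
      Complex.exp (-Complex.I * lam * t) • (zonalL2 (f t) - zonalTrunc L (f t)) :=
    Summable.of_norm (by simpa only [hn] using hsn)
  have e1 : spectralKernel P' T' lam = (1 / (2 * Real.pi) : ℂ) •
      ∑ l ∈ Finset.range (L + 1),
        (∑' t : ℤ, Complex.exp (-Complex.I * lam * t) * (c l t : ℂ)) • harmKernel l := by
    rw [spectralKernel, ← h1.tsum_eq]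
    congr 1
    refine tsum_congr fun t => ?_
    rw [autocovL2_eq_zonalL2 ⟨_, continuous_multiplierKernel L fun l => c l t⟩ (hc t),
      zonalL2_multiplierKernel]
  have e2 : spectralKernel P T lam = (1 / (2 * Real.pi) : ℂ) •
      (∑ l ∈ Finset.range (L + 1),
        (∑' t : ℤ, Complex.exp (-Complex.I * lam * t) * (fhCoeff (f t) l : ℂ)) • harmKernel l +
      ∑' t : ℤ, Complex.exp (-Complex.I * lam * t) • (zonalL2 (f t) - zonalTrunc L (f t))) := by
    rw [spectralKernel, ← (h2.add h3.hasSum).tsum_eq]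
    congr 1
    refine tsum_congr fun t => ?_
    rw [autocovL2_eq hf, ← smul_add, ← zonalTrunc, add_sub_cancel]
  rw [e1, e2, smul_add, ← sub_sub, ← smul_sub, ← Finset.sum_sub_distrib]
  refine (norm_sub_le _ _).trans (add_le_add ?_ ?_)
  · rw [Finset.smul_sum, Finset.mul_sum]
    refine norm_sum_le_of_le _ fun l hl => ?_
    rw [← sub_smul, smul_smul, mul_sub, ← spectralEigenvalue_eq hT hf, norm_smul]
    exact mul_le_mul_of_nonneg_right (hη l (Finset.mem_range_succ_iff.1 hl)) (norm_nonneg _)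
  · rw [norm_smul]
    refine (mul_le_of_le_one_left (norm_nonneg _) norm_one_div_two_pi).trans ?_
    refine (norm_tsum_le_tsum_norm (by simpa only [hn] using hsn)).trans ?_
    simp only [hn]
    exact le_rfl

theorem summable_fhCoeff_of_summable_norm (hs : Summable fun t => ‖zonalL2 (f t)‖) (l : ℕ) :
    Summable fun t => fhCoeff (f t) l :=
  Summable.of_norm_bounded hs fun t =>
    (abs_fhCoeff_le_norm_kernelOp (f t) l).trans (norm_kernelOp_le _)

end Kernels

theorem exists_sphma_spectralKernel_approx {Ω : Type*} [MeasurableSpace Ω] {P : Measure Ω}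
    [IsProbabilityMeasure P] {T : S2 → ℤ → Ω → ℝ} (hT : IsIsotropicStationary P T)
    (hs : SummableL2 P T) {ε : ℝ} (hε : 0 < ε) :
    ∃ (Ω' : Type) (_ : MeasurableSpace Ω') (P' : Measure Ω') (L q : ℕ) (k : Fin q → ℝ → ℝ)
      (θ : ℕ → Fin q → ℝ) (sigmaSq : ℕ → ℝ) (Z T' : S2 → ℤ → Ω' → ℝ),
      IsProbabilityMeasure P' ∧ IsInvertibleBandLimitedSPHMA P' L q k θ sigmaSq Z T' ∧
      (∀ l ≤ L, (sigmaSq l : ℂ) = (1 + ∑ j : Fin q, (θ l j : ℂ) ^ 2)⁻¹ *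
        ∫ lam in (-Real.pi)..Real.pi, spectralEigenvalue P T l lam) ∧
      ∀ lam ∈ Set.Icc (-Real.pi) Real.pi,
        ‖spectralKernel P' T' lam - spectralKernel P T lam‖ ≤ ε := by
  obtain ⟨f, hf⟩ := hT.exists_zonal hs.1
  have hsz : Summable fun t => ‖zonalL2 (f t)‖ := by
    simpa only [autocovL2_eq hf] using hs.2
  have hsl := summable_fhCoeff_of_summable_norm hsz
  obtain ⟨L, hL⟩ := ((tendsto_tsum_norm_zonalL2_sub hsz).eventually_lt_const
    (half_pos hε)).exists
  set K := ∑ l ∈ Finset.range (L + 1), ‖harmKernel l‖ with hK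
  have hK0 : 0 ≤ K := Finset.sum_nonneg fun l _ => norm_nonneg _
  obtain ⟨Ω', mΩ', P', q, k, θ, s, Z, T', c, hP', hproc, hσ, hcov, hcs, hη⟩ :=
    exists_process_approx (ρ := fun t => f t) hT.toIsField (fun t => (f t).continuous) hf hsl L
      -- L, and with it K, is already fixed; the 1 avoids a zero denominator, and the low degrees
      -- contribute at most ε/2.
      (η := ε / (2 * (1 + K))) (by positivity)
  refine ⟨Ω', mΩ', P', L, q, k, θ, s, Z, T', hP', hproc, hσ, fun lam hlam => ?_⟩
  refine (norm_spectralKernel_sub_le hT.toIsField hf hsz hsl hcov hcs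
    (fun l hl => hη l hl lam hlam)).trans ?_
  have h1 : ε / (2 * (1 + K)) * K ≤ ε / 2 := by
    rw [div_mul_eq_mul_div, div_le_div_iff₀ (by positivity) (by positivity)]
    nlinarith
  linarith

/-! ### Approximation of the spectral density operators -/

section Operators

variable {Ω : Type*} [MeasurableSpace Ω] {P : Measure Ω} {T : S2 → ℤ → Ω → ℝ} {f : ℤ → C(ℝ, ℝ)}

theorem autocovOp_sphBasis (hf : ∀ t x y, autocovKernel P T t x y = f t (dot x y)) (t : ℤ)
    (i : HarmIdx) : autocovOp P T t (sphBasis i) = (fhCoeff (f t) i.1.1 : ℂ) • sphBasis i := by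
  rw [autocovOp, autocovL2_eq_zonalL2 (f t) (hf t), kernelOp_zonalL2_sphBasis]

/-- A summable bound on the eigenvalues, uniform in the degree, makes the series converge in
operator norm, so it may be evaluated at a basis vector term by term. -/
theorem spectralOp_sphBasis (hf : ∀ t x y, autocovKernel P T t x y = f t (dot x y))
    {M : ℤ → ℝ} (hM : Summable M) (hfM : ∀ t l, |fhCoeff (f t) l| ≤ M t) (lam : ℝ) (i : HarmIdx) :
    spectralOp P T lam (sphBasis i) = ((1 / (2 * Real.pi) : ℂ) *
      ∑' t : ℤ, Complex.exp (-Complex.I * lam * t) * (fhCoeff (f t) i.1.1 : ℂ)) • sphBasis i := by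
  have hs : Summable fun t : ℤ => Complex.exp (-Complex.I * lam * t) • autocovOp P T t := by
    refine Summable.of_norm_bounded hM fun t => ?_
    rw [norm_smul, norm_exp_neg_I_mul, one_mul]
    refine opNorm_diagonal_le sphBasis (autocovOp_sphBasis hf t) ((abs_nonneg _).trans (hfM t 0))
      fun i => ?_
    rw [Complex.norm_real]
    exact hfM t _
  have hc : Summable fun t : ℤ =>
      Complex.exp (-Complex.I * lam * t) * (fhCoeff (f t) i.1.1 : ℂ) := by
    refine Summable.of_norm_bounded hM fun t => ?_
    rw [norm_mul, norm_exp_neg_I_mul, one_mul, Complex.norm_real]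
    exact hfM t _
  have h1 := (ContinuousLinearMap.apply ℂ L2S (sphBasis i)).map_tsum hs
  simp only [ContinuousLinearMap.apply_apply, smul_apply,
    autocovOp_sphBasis hf, smul_smul] at h1
  rw [spectralOp, smul_apply, h1, hc.tsum_smul_const, smul_smul]

theorem traceNorm_autocovOp (hf : ∀ t x y, autocovKernel P T t x y = f t (dot x y)) (t : ℤ) :
    traceNorm (autocovOp P T t) = ∑' i : HarmIdx, ENNReal.ofReal |fhCoeff (f t) i.1.1| := by
  rw [traceNorm_diagonal sphBasis (autocovOp_sphBasis hf t)]
  simp only [Complex.norm_real, Real.norm_eq_abs]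

theorem abs_fhCoeff_le_traceNorm (hf : ∀ t x y, autocovKernel P T t x y = f t (dot x y))
    {t : ℤ} (h : traceNorm (autocovOp P T t) ≠ ∞) (l : ℕ) :
    |fhCoeff (f t) l| ≤ (traceNorm (autocovOp P T t)).toReal := by
  rw [← ENNReal.ofReal_le_iff_le_toReal h, traceNorm_autocovOp hf]
  exact ENNReal.le_tsum (f := fun i : HarmIdx => ENNReal.ofReal |fhCoeff (f t) i.1.1|)
    ⟨(l, 0), by simp⟩

/-- The indices of the spherical harmonics of degree at most `L`. -/
def harmIdxLE (L : ℕ) : Finset HarmIdx :=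
  (Finset.range (L + 1) ×ˢ Finset.Icc (-(L : ℤ)) L).subtype _

theorem mem_harmIdxLE {L : ℕ} {i : HarmIdx} : i ∈ harmIdxLE L ↔ i.1.1 ≤ L := by
  have h := abs_le.1 i.2
  rw [harmIdxLE, Finset.mem_subtype, Finset.mem_product, Finset.mem_range_succ_iff,
    Finset.mem_Icc]
  omega

/-- Both spectral operators are diagonal in the harmonics, so the trace norm is a sum over (l, m).
For l > L the approximating process contributes nothing. -/
theorem traceNorm_spectralOp_sub_le [IsProbabilityMeasure P] (hT : IsField P T)
    (hf : ∀ t s x y, ∫ ω, T x t ω * T y s ω ∂P = f (t - s) (dot x y))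
    (hs : ∑' t, traceNorm (autocovOp P T t) ≠ ∞)
    {Ω' : Type*} [MeasurableSpace Ω'] {P' : Measure Ω'} {T' : S2 → ℤ → Ω' → ℝ} {L : ℕ}
    {c : ℕ → ℤ → ℝ}
    (hc : ∀ t x y, autocovKernel P' T' t x y = multiplierKernel L (fun l => c l t) (dot x y))
    (hcs : ∀ l ≤ L, Summable (c l)) {η lam : ℝ}
    (hη : ∀ l ≤ L, ‖(1 / (2 * Real.pi) : ℂ) *
      ∑' t : ℤ, Complex.exp (-Complex.I * lam * t) * (c l t : ℂ) -
        spectralEigenvalue P T l lam‖ ≤ η) :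
    traceNorm (spectralOp P' T' lam - spectralOp P T lam) ≤
      (harmIdxLE L).card * ENNReal.ofReal η +
        ∑' i : {i // i ∉ harmIdxLE L}, ∑' t, ENNReal.ofReal |fhCoeff (f t) i.1.1.1| := by
  have hf0 : ∀ t x y, autocovKernel P T t x y = f t (dot x y) := fun t x y => by
    rw [autocovKernel, hf, sub_zero]
  have hM := ENNReal.summable_toReal hs
  have hfM : ∀ t l, |fhCoeff (f t) l| ≤ (traceNorm (autocovOp P T t)).toReal := fun t l =>
    abs_fhCoeff_le_traceNorm hf0 (ENNReal.ne_top_of_tsum_ne_top hs t) l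
  set g : ℤ → C(ℝ, ℝ) := fun t => ⟨_, continuous_multiplierKernel L fun l => c l t⟩ with hg
  have hgc : ∀ t l, fhCoeff (g t) l = if l ≤ L then c l t else 0 := fun t l =>
    fhCoeff_multiplierKernel ..
  have hgM : ∀ t l, |fhCoeff (g t) l| ≤ ∑ l ∈ Finset.range (L + 1), |c l t| := by
    intro t l
    rw [hgc]
    split_ifs with hl
    · exact Finset.single_le_sum (f := fun l => |c l t|) (fun l _ => abs_nonneg _)
        (Finset.mem_range_succ_iff.2 hl)
    · rw [abs_zero]
      exact Finset.sum_nonneg fun l _ => abs_nonneg _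
  have hgs : Summable fun t => ∑ l ∈ Finset.range (L + 1), |c l t| :=
    summable_sum fun l hl => (hcs l (Finset.mem_range_succ_iff.1 hl)).norm
  have hD : ∀ i, (spectralOp P' T' lam - spectralOp P T lam) (sphBasis i) =
      ((1 / (2 * Real.pi) : ℂ) *
        ∑' t : ℤ, Complex.exp (-Complex.I * lam * t) * (fhCoeff (g t) i.1.1 : ℂ) -
          spectralEigenvalue P T i.1.1 lam) • sphBasis i := by
    intro i
    rw [sub_apply, spectralOp_sphBasis (f := g) hc hgs hgM,
      spectralOp_sphBasis hf0 hM hfM, ← sub_smul, spectralEigenvalue_eq hT hf]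
  rw [traceNorm_diagonal sphBasis hD, ← ENNReal.sum_add_tsum_compl (harmIdxLE L)]
  refine add_le_add ?_ (ENNReal.tsum_le_tsum (α := {i // i ∉ harmIdxLE L}) fun i => ?_)
  · rw [← nsmul_eq_mul]
    refine Finset.sum_le_card_nsmul _ _ _ fun i hi => ENNReal.ofReal_le_ofReal ?_
    have hi' := mem_harmIdxLE.1 hi
    simp only [hgc, if_pos hi']
    exact hη _ hi'
  · have hi' : ¬ i.1.1.1 ≤ L := fun h => i.2 (mem_harmIdxLE.2 h)
    have hb : Summable fun t => |fhCoeff (f t) i.1.1.1| :=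
      Summable.of_nonneg_of_le (fun t => abs_nonneg _) (fun t => hfM t _) hM
    rw [← ENNReal.ofReal_tsum_of_nonneg (fun t => abs_nonneg _) hb]
    refine ENNReal.ofReal_le_ofReal ?_
    simp only [hgc, if_neg hi', Complex.ofReal_zero, mul_zero, tsum_zero, zero_sub, norm_neg]
    rw [spectralEigenvalue_eq hT hf, norm_mul]
    refine (mul_le_of_le_one_left (norm_nonneg _) norm_one_div_two_pi).trans ?_
    have hn : ∀ t : ℤ, ‖Complex.exp (-Complex.I * lam * t) * (fhCoeff (f t) i.1.1.1 : ℂ)‖ =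
        |fhCoeff (f t) i.1.1.1| := fun t => by
      rw [norm_mul, norm_exp_neg_I_mul, one_mul, Complex.norm_real, Real.norm_eq_abs]
    refine (norm_tsum_le_tsum_norm (by simpa only [hn] using hb)).trans ?_
    simp only [hn]
    exact le_rfl

end Operators

theorem exists_sphma_spectralOp_approx {Ω : Type*} [MeasurableSpace Ω] {P : Measure Ω}
    [IsProbabilityMeasure P] {T : S2 → ℤ → Ω → ℝ} (hT : IsIsotropicStationary P T)
    (hs : SummableTrace P T) {ε : ℝ} (hε : 0 < ε) :
    ∃ (Ω' : Type) (_ : MeasurableSpace Ω') (P' : Measure Ω') (L q : ℕ) (k : Fin q → ℝ → ℝ)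
      (θ : ℕ → Fin q → ℝ) (sigmaSq : ℕ → ℝ) (Z T' : S2 → ℤ → Ω' → ℝ),
      IsProbabilityMeasure P' ∧ IsInvertibleBandLimitedSPHMA P' L q k θ sigmaSq Z T' ∧
      (∀ l ≤ L, (sigmaSq l : ℂ) = (1 + ∑ j : Fin q, (θ l j : ℂ) ^ 2)⁻¹ *
        ∫ lam in (-Real.pi)..Real.pi, spectralEigenvalue P T l lam) ∧
      ∀ lam ∈ Set.Icc (-Real.pi) Real.pi,
        traceNorm (spectralOp P' T' lam - spectralOp P T lam) ≤ ENNReal.ofReal ε := by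
  obtain ⟨f, hf⟩ := hT.exists_zonal hs.1
  have hf0 : ∀ t x y, autocovKernel P T t x y = f t (dot x y) := fun t x y => by
    rw [autocovKernel, hf, sub_zero]
  have hsl : ∀ l, Summable fun t => fhCoeff (f t) l := fun l =>
    Summable.of_norm_bounded (ENNReal.summable_toReal hs.2.ne) fun t =>
      abs_fhCoeff_le_traceNorm hf0 (ENNReal.ne_top_of_tsum_ne_top hs.2.ne t) l
  -- After interchanging the sums, the trace-norm hypothesis is exactly finiteness of this double
  -- sum.
  have hS : ∑' i : HarmIdx, ∑' t, ENNReal.ofReal |fhCoeff (f t) i.1.1| ≠ ∞ := by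
    rw [ENNReal.tsum_comm]
    simpa only [traceNorm_autocovOp hf0] using hs.2.ne
  obtain ⟨s, hsB⟩ := eventually_atTop.1
    ((ENNReal.tendsto_tsum_compl_atTop_zero hS).eventually_le_const
      (ENNReal.ofReal_pos.2 (half_pos hε)))
  -- The finite set s captures all but ε/2 of the double sum; L is large enough for all its indices
  -- to have degree at most L.
  set L := s.sup fun i => i.1.1 with hL
  have hLs : s ≤ harmIdxLE L := fun i hi =>
    mem_harmIdxLE.2 (Finset.le_sup (f := fun i : HarmIdx => i.1.1) hi)
  set K := ((harmIdxLE L).card : ℝ) with hK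
  obtain ⟨Ω', mΩ', P', q, k, θ, σ, Z, T', c, hP', hproc, hσ, hcov, hcs, hη⟩ :=
    exists_process_approx (ρ := fun t => f t) hT.toIsField (fun t => (f t).continuous) hf hsl L
      (η := ε / (2 * (1 + K))) (by positivity)
  refine ⟨Ω', mΩ', P', L, q, k, θ, σ, Z, T', hP', hproc, hσ, fun lam hlam => ?_⟩
  refine (traceNorm_spectralOp_sub_le hT.toIsField hf hs.2.ne hcov hcs
    (fun l hl => hη l hl lam hlam)).trans ?_
  have h1 : K * (ε / (2 * (1 + K))) ≤ ε / 2 := by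
    rw [mul_div_assoc', div_le_div_iff₀ (by positivity) (by positivity)]
    nlinarith
  calc _ ≤ ENNReal.ofReal (ε / 2) + ENNReal.ofReal (ε / 2) := by
        refine add_le_add ?_ (hsB _ hLs)
        rw [← ENNReal.ofReal_natCast, ← ENNReal.ofReal_mul (Nat.cast_nonneg _)]
        exact ENNReal.ofReal_le_ofReal h1
    _ = ENNReal.ofReal ε := by
        rw [← ENNReal.ofReal_add (half_pos hε).le (half_pos hε).le, add_halves]

end SphereTime

end

theorem mainTheorem2 {Ω : Type*} [MeasurableSpace Ω] (P : MeasureTheory.Measure Ω)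
    [MeasureTheory.IsProbabilityMeasure P] (T : SphereTime.S2 → ℤ → Ω → ℝ)
    (hT : SphereTime.IsIsotropicStationary P T) :
    (SphereTime.SummableL2 P T → ∀ ε : ℝ, 0 < ε →
      ∃ (Ω' : Type) (_ : MeasurableSpace Ω') (P' : MeasureTheory.Measure Ω')
        (L q : ℕ) (k : Fin q → ℝ → ℝ) (θ : ℕ → Fin q → ℝ) (sigmaSq : ℕ → ℝ)
        (Z T' : SphereTime.S2 → ℤ → Ω' → ℝ),
        MeasureTheory.IsProbabilityMeasure P' ∧
        SphereTime.IsInvertibleBandLimitedSPHMA P' L q k θ sigmaSq Z T' ∧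
        (∀ l ≤ L, (sigmaSq l : ℂ) = (1 + ∑ j : Fin q, (θ l j : ℂ) ^ 2)⁻¹ *
          ∫ lam in (-Real.pi)..Real.pi, SphereTime.spectralEigenvalue P T l lam) ∧
        ∀ lam ∈ Set.Icc (-Real.pi) Real.pi,
          ‖SphereTime.spectralKernel P' T' lam - SphereTime.spectralKernel P T lam‖ ≤ ε) ∧
    (SphereTime.SummableTrace P T → ∀ ε : ℝ, 0 < ε →
      ∃ (Ω' : Type) (_ : MeasurableSpace Ω') (P' : MeasureTheory.Measure Ω')
        (L q : ℕ) (k : Fin q → ℝ → ℝ) (θ : ℕ → Fin q → ℝ) (sigmaSq : ℕ → ℝ)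
        (Z T' : SphereTime.S2 → ℤ → Ω' → ℝ),
        MeasureTheory.IsProbabilityMeasure P' ∧
        SphereTime.IsInvertibleBandLimitedSPHMA P' L q k θ sigmaSq Z T' ∧
        (∀ l ≤ L, (sigmaSq l : ℂ) = (1 + ∑ j : Fin q, (θ l j : ℂ) ^ 2)⁻¹ *
          ∫ lam in (-Real.pi)..Real.pi, SphereTime.spectralEigenvalue P T l lam) ∧
        ∀ lam ∈ Set.Icc (-Real.pi) Real.pi,
          SphereTime.traceNorm
            (SphereTime.spectralOp P' T' lam - SphereTime.spectralOp P T lam) ≤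
              ENNReal.ofReal ε) := by
  exact ⟨fun hs _ hε => SphereTime.exists_sphma_spectralKernel_approx hT hs hε,
    fun hs _ hε => SphereTime.exists_sphma_spectralOp_approx hT hs hε⟩
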